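/- **Setting.** Fix $N\ge 1$ and lattice parameters $p_1,\dots,p_N\in\mathbb C$. For a function $f$ on $\mathbb Z^N$ and two directions $k,l$ write $p=p_k$, $q=p_l$, $\tilde f(n)=f(n+e_k)$, $\hat f(n)=f(n+e_l)$, and use under-accents for the inverse shifts. For $\zeta\in\mathbb C$ with $\zeta^2\ne p_r^2$ fix square roots $\alpha_r=(p_r^2-\zeta^2)^{1/2}$ ($1\le r\le N$), write $\alpha_p=\alpha_k$, $\alpha_q=\alpha_l$, and put $\rho(\zeta)=\prod_r\big(\frac{p_r+\zeta}{p_r-\zeta}\big)^{n_r}$, $\rho(\zeta)^{1/2}=\prod_r\big(\frac{p_r+\zeta}{\alpha_r}\big)^{n_r}$. The equations are * (1) $(p+\zeta)\frac{\hat{\tilde\Lambda}}{\hat\Lambda}-(p-\zeta)\frac{\Lambda}{\tilde\Lambda}=(q+\zeta)\frac{\hat{\tilde\Lambda}}{\tilde\Lambda}-(q-\zeta)\frac{\Lambda}{\hat\Lambda}$ on every quadrilateral with $\tilde\Lambda\hat\Lambda\neq0$; * (2) lattice potential mKdV: $\alpha_p(\varphi\hat\varphi-\tilde\varphi\hat{\tilde\varphi})=\alpha_q(\varphi\tilde\varphi-\hat\varphi\hat{\tilde\varphi})$;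 * (3) lattice mKdV for $W=\hat\varphi/\tilde\varphi$ (if $\varphi$ has no zeros and $p^2\ne q^2$): $\frac{\hat{\tilde W}}{W}=\frac{(\alpha_p\hat W-\alpha_q)(\alpha_p-\alpha_q\tilde W)}{(\alpha_p\tilde W-\alpha_q)(\alpha_p-\alpha_q\hat W)}$, with non-vanishing denominators; * (4) for $k\ne l$, $p+q\ne0$: $2p=(p+q)\frac{\hat\Lambda(p)}{\tilde\Lambda(p)}+(p-q)\frac{\Lambda(p)}{\hat{\tilde\Lambda}(p)}$ where the denominators do not vanish, the same with $(p,\tilde{\ })$ and $(q,\hat{\ })$ interchanged, and $\hat{\tilde\Lambda}(p)\hat\Lambda(q)=\hat{\tilde\Lambda}(q)\tilde\Lambda(p)$; if $\Lambda(p),\Lambda(q)$ have no zeros, there is a nowhere vanishing $f$ with $\tilde\Lambda(p)=f/\tilde f$, $\hat\Lambda(q)=f/\hat f$, and every such $f$ satisfies $2pf\hat f=(p+q)\underset{\sim}{\hat f}\tilde f+(p-q)\underset{\sim}{f}\hat{\tilde f}$, the equation obtained from it by interchanging the two directions, and Hirota's discrete-time Toda equation $(p-q)^2\underset{\sim}{\underset{\wedge}{f}}\hat{\tilde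 f}-(p+q)^2\underset{\sim}{\hat f}\,\underset{\wedge}{\tilde f}+4pqf^2=0$; * (5) Schwarzian KdV: for all constants $\mathscr B,\mu_0$ and any direction $j$ (with shift $\bar{\ }$) the function $u=\mathscr B(\mu+\mu_0-\mathscr T)$, $\mu=\sum_{r=1}^N n_r/p_r$, $\mathscr T=\frac{p_j}2\big(\bar\Lambda(0)\Lambda''(0)-\Lambda(0)\bar\Lambda''(0)\big)-\Lambda(0)\bar\Lambda'(0)$, satisfies $p^2(u-\tilde u)(\hat u-\hat{\tilde u})=q^2(u-\hat u)(\tilde u-\hat{\tilde u})$ for all pairs of directions, and $\frac{(u-\tilde u)(\hat u-\hat{\tilde u})}{(u-\hat u)(\tilde u-\hat{\tilde u})}=\frac{q^2}{p^2}$ (with non-zero denominators) if $\mathscr B\ne0$ and $\Lambda(0)$ has no zeros; * (6) lattice KdV: with $\Lambda(\zeta)=1+\Lambda_\epsilon/\zeta+o(1/\zeta)$ as $\zeta\to\infty$, $\mathscr A^2-\mathscr B^2=-1$, $\varrho=\sum_rp_rn_r$ and constants $\varrho_0,\varrho_1$, the function $u=\mathscr B(\varrho+\varrho_0+\Lambda_\epsilon)+(-1)^{n_1+\dots+n_N}\mathscr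 A(\varrho+\varrho_1+\Lambda_\epsilon)$ solves H1, $(u-\hat{\tilde u})(\tilde u-\hat u)+p^2-q^2=0$, and $\tilde u-\hat u=(\mathscr B-(-1)^{n_1+\dots+n_N}\mathscr A)(p-q+\tilde\Lambda_\epsilon-\hat\Lambda_\epsilon)$; if $p^2\ne q^2$, then $\omega=\tilde u-\hat u$, and also $\omega=(\mathscr B-(-1)^{n_k+n_l}\mathscr A)(p-q+\tilde\Lambda_\epsilon-\hat\Lambda_\epsilon)$, vanishes nowhere and solves $\omega-\hat{\tilde\omega}=(p^2-q^2)\big(\frac1{\hat\omega}-\frac1{\tilde\omega}\big)$. **(A) Solutions of $\mathrm{Q3}_\delta$.** Let $P_k^2=(p_k^2-a^2)(p_k^2-b^2)$, $P_k\ne0$, and let $u:\mathbb Z^N\to\mathbb C$ solve, in all pairs of directions, $P(u\hat u+\tilde u\hat{\tilde u})-Q(u\tilde u+\hat u\hat{\tilde u})-(p^2-q^2)\big(\tilde u\hat u+u\hat{\tilde u}+\frac{\delta^2}{4PQ}\big)=0$, where $P=P_k$, $Q=P_l$. Let $\mathscr U$ be nowhere zero with $\mathscr U\tilde{\mathscr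 U}=P(u^2+\tilde u^2)-(2p^2-a^2-b^2)u\tilde u+\frac{\delta^2}{4P}$ in every direction. Then $\frac{Q\hat{\tilde u}-(q^2-p^2)\tilde u-Pu}{\tilde{\mathscr U}}=\frac{P\hat{\tilde u}-(p^2-q^2)\hat u-Qu}{\hat{\mathscr U}}$. Let moreover $\zeta^2\ne b^2$, $\zeta^2\ne p_r^2$ for all $r$, and let $\phi=(\phi_1,\phi_2)^T$ solve in every direction the Lax equation $$\alpha_p\tilde\phi=\frac1{\mathscr U}\begin{pmatrix}P\tilde u-(p^2-b^2)u&\zeta^2-b^2\\ \mathscr U\tilde{\mathscr U}-\frac{\delta^2(p^2-b^2)}{4P(\zeta^2-b^2)}&(p^2-b^2)\tilde u-Pu\end{pmatrix}\phi ,$$ and write $\phi_1=\Lambda\,\rho(\zeta)^{1/2}$. Then $(q+\zeta)\hat{\tilde\Lambda}+(p-\zeta)\Lambda=\frac{Q\hat{\tilde u}-(q^2-p^2)\tilde u-Pu}{\tilde{\mathscr U}}\tilde\Lambda$, $\Lambda$ satisfies (1), and $\varphi=\phi_1$ satisfies (2) and (3). If the Lax equations are rewritten for $\phi/\rho(\zeta)^{1/2}$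 (so that $\alpha_p$ is replaced by $p+\zeta$), then, for $k\neq l$ with $p,q,p+q\ne0$, first components $\Lambda(p),\Lambda(q)$ of solutions at $\zeta=p$ and $\zeta=q$ satisfy (4). **(B) Inverse scattering solutions.** Let all $p_r\ne0$. A staircase $\Gamma$ is a sequence of lattice points $\Gamma_i$ ($i\in\mathbb Z$), $\Gamma_0=0$, $\Gamma_{i+1}=\Gamma_i+e_{s(i)}$, with any $s:\mathbb Z\to\{1,\dots,N\}$; $I$ is the range of $s$, and the index $i$ on parameters means $p_{s(i)}$. Let $\upsilon:\mathbb Z\to\mathbb C$, let $K>1$ with $\sum_i|\upsilon_i|K^{|i|}(1+|i|)<\infty$, and let $\mathscr P=\bigcup_{r\in I}\{|\frac{p_r-\zeta}{p_r+\zeta}|>K\}$, $\mathscr P^*=-\mathscr P$. For $l\le i$ let $F(i,l;\zeta)=\frac1{2\zeta}\big[1-\prod_{r=l}^{i-1}\frac{p_r-\zeta}{p_r+\zeta}\big]$. On $\Gamma$ the Jost functions are the Neumann series solutions of $\Lambda(i;\zeta)=1+\sum_{l<i}F(i,l;\zeta)\upsilon_l\Lambda(l;\zeta)$ and $\Upsilon(i;\zeta)=1+\sum_{l>i}F(l,i;\zeta)\upsilon_l\Upsilon(l;\zeta)$,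 and $$\mathtt A(\zeta)=\tfrac1{2\zeta}\big[(p_0+\zeta)\Upsilon(0;\zeta)\Lambda(1;\zeta)-(p_0-\zeta)\Upsilon(1;\zeta)\Lambda(0;\zeta)\big],\quad \mathtt B(\zeta)=\tfrac{p_0-\zeta}{2\zeta}\big[\Lambda(0;-\zeta)\Upsilon(1;\zeta)-\Lambda(1;-\zeta)\Upsilon(0;\zeta)\big].$$ Assume that $\upsilon$ is admissible: $\mathtt A$ has finitely many zeros $\zeta_1,\dots,\zeta_M\neq 0$ outside $\mathscr P\cup\partial\mathscr P$, all simple. Let $L$ be a positively oriented simple closed rectifiable curve outside $\mathscr P\cup\partial\mathscr P$, with interior $\mathcal R^+$ and exterior $\mathcal R^-$, such that $\mathscr P^*\subseteq\mathcal R^+$, $0\in\mathcal R^-$, all $\zeta_j\in\mathcal R^+$, $-(L\cup\mathcal R^+)\subseteq\mathcal R^-$, and no $\pm p_r$ lies on $L$ or is one of the $\zeta_j$. Let $R=\mathtt B/\mathtt A$ and $C_j=c_j/\mathtt A'(\zeta_j)$, where $c_j=\mathtt B(\zeta_j)$ if $\zeta_j\notin\mathscr P^*$, and $\Upsilon(i;\zeta_j)=c_j\,\rho(\zeta_j)|_{n=\Gamma_i}\,\Lambda(i;\zeta_j)$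 for all $i$ if $\zeta_j\in\mathscr P^*$. Let $\Lambda(\zeta)=\Lambda(n;\zeta)$ be the $N$-dimensional Jost function, that is, suppose that for every $n\in\mathbb Z^N$ it is the unique solution of $$\Lambda(\zeta)=1-\sum_{j=1}^M\frac{C_j\Lambda(\zeta_j)}{\zeta+\zeta_j}\rho(\zeta_j)+\frac1{2\pi i}\int_L\frac{R(\sigma)\Lambda(\sigma)}{\sigma+\zeta}\rho(\sigma)\,d\sigma,\qquad -\zeta\in\mathcal R^- .$$ Then every $\zeta\in\mathbb C$ satisfies $-\zeta\in\mathcal R^-$ or $\zeta\in\mathcal R^-$ (so that, (2) and (3) being invariant under $\zeta\to-\zeta$, solutions of them are obtained for all $\zeta$ with $\zeta^2\neq p_r^2$ for all $r$); for every $\zeta$ with $-\zeta\in\mathcal R^-$, $\Lambda(\zeta)$ satisfies (1) and, if $\zeta^2\ne p_r^2$ for all $r$, $\varphi=\Lambda(\zeta)\rho(\zeta)^{1/2}$ satisfies (2) and (3); (4) holds if $-p,-q\in\mathcal R^-$; (5) holds; and $\Lambda_\epsilon$ exists and (6) holds. **(C) Summability.** Let all $p_r\ne0$, $K\ge1$ and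 $\sum_i|\upsilon_i|K^{|i|}(1+|i|)<\infty$ (for $K=1$: $\sum_i|\upsilon_i|(1+|i|)<\infty$), with $\mathscr P$ as above. Then for every $\zeta\notin\mathscr P$ the Neumann series of $\Lambda(i;\zeta)$ and the sums in it converge absolutely; $\Lambda$ solves $(p_{i+1}+\zeta)\Lambda(i+2)-(p_i+p_{i+1}+\upsilon_{i+1})\Lambda(i+1)+(p_i-\zeta)\Lambda(i)=0$ and $\Lambda(i;\zeta)\to1$ as $i\to-\infty$; $\Lambda(i;\cdot)$ is holomorphic outside $\mathscr P\cup\partial\mathscr P$; and $\zeta(\Lambda(i;\zeta)-1)$ has a limit as $\zeta\to\infty$, $\zeta\notin\mathscr P$. Moreover, let $\mathbb C\setminus\mathscr P$ be unbounded, and let $\Lambda(n;\zeta)$ ($n\in\mathbb Z^N$, $\zeta\notin\mathscr P$) agree with this Jost function on $\Gamma$, satisfy for all directions $k,l$ (possibly equal) an evolution equation $(q+\zeta)\hat{\tilde\Lambda}(\zeta)-V_{kl}(n)\tilde\Lambda(\zeta)+(p-\zeta)\Lambda(\zeta)=0$ with $V_{kl}(n)$ independent of $\zeta$, and have the expansion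 $\Lambda=1+\Lambda_\epsilon/\zeta+o(1/\zeta)$ as $\zeta\to\infty$, $\zeta\notin\mathscr P$. Then for every $\zeta\notin\mathscr P$ it satisfies (1) and, if $\zeta^2\neq p_r^2$ for all $r$, $\varphi=\Lambda\rho(\zeta)^{1/2}$ satisfies (2) and (3); (4) holds if $p,q\notin\mathscr P$; and (6) holds. -/

import Mathlib

open Filter Topology

noncomputable section

namespace LatticeIST

/-! ## Lattice, shifts and plane waves -/

/-- The shift `n_k ↦ n_k + 1` on the `N`-dimensional lattice. -/
def step {N : ℕ} (k : Fin N) (n : Fin N → ℤ) : Fin N → ℤ := n + Pi.single k 1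

/-- The backward shift `n_k ↦ n_k - 1`. -/
def back {N : ℕ} (k : Fin N) (n : Fin N → ℤ) : Fin N → ℤ := n - Pi.single k 1

/-- The plane-wave factor `ρ(ζ) = ∏ ((p_r + ζ) / (p_r - ζ)) ^ n_r`. -/
def rho {N : ℕ} (p : Fin N → ℂ) (n : Fin N → ℤ) (ζ : ℂ) : ℂ :=
  ∏ r, ((p r + ζ) / (p r - ζ)) ^ n r

/-- The plane-wave factor `ρ(ζ)^{1/2} = ∏ ((p_r + ζ) / (p_r - ζ)) ^ (n_r / 2)`. The branch is fixed
by a choice `α_r` of the square roots `(p_r² - ζ²)^{1/2}`: the square root of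
`(p_r + ζ) / (p_r - ζ)` that is used is `(p_r + ζ) / α_r`. -/
def rhoHalf {N : ℕ} (p α : Fin N → ℂ) (ζ : ℂ) (n : Fin N → ℤ) : ℂ :=
  ∏ r, ((p r + ζ) / α r) ^ n r

/-! ## The equation `Q3_δ` and its Lax equations -/

/-- `u` solves `Q3_δ` on every elementary quadrilateral of the lattice. -/
def IsQ3Solution {N : ℕ} (p P : Fin N → ℂ) (δ : ℂ) (u : (Fin N → ℤ) → ℂ) : Prop :=
  ∀ (k l : Fin N) (n : Fin N → ℤ),
    P k * (u n * u (step l n) + u (step k n) * u (step l (step k n)))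
      - P l * (u n * u (step k n) + u (step l n) * u (step l (step k n)))
      - (p k ^ 2 - p l ^ 2) *
        ((u (step k n) * u (step l n) + u n * u (step l (step k n))) + δ ^ 2 / (4 * P k * P l)) = 0

/-- The biquadratic `ℋ_𝔭(x, y)` with `𝔭 = (p, P)`. -/
def biquadratic (a b δ p P x y : ℂ) : ℂ :=
  P * (x ^ 2 + y ^ 2) - (2 * p ^ 2 - a ^ 2 - b ^ 2) * x * y + δ ^ 2 / (4 * P)

/-- `U` factorises the biquadratics of `u` in all lattice directions. -/
def IsFactorisation {N : ℕ} (p P : Fin N → ℂ) (a b δ : ℂ) (u U : (Fin N → ℤ) → ℂ) : Prop :=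
  ∀ (k : Fin N) (n : Fin N → ℤ),
    U n * U (step k n) = biquadratic a b δ (p k) (P k) (u n) (u (step k n))

/-- The Lax matrix (including the prefactor `1 / U`) in the direction `k` at the point `n`. -/
def laxMatrix {N : ℕ} (p P : Fin N → ℂ) (b δ : ℂ) (u U : (Fin N → ℤ) → ℂ) (ζ : ℂ)
    (k : Fin N) (n : Fin N → ℤ) : Matrix (Fin 2) (Fin 2) ℂ :=
  (1 / U n) •
    !![P k * u (step k n) - (p k ^ 2 - b ^ 2) * u n, ζ ^ 2 - b ^ 2;
       U n * U (step k n) - δ ^ 2 * (p k ^ 2 - b ^ 2) / (4 * P k * (ζ ^ 2 - b ^ 2)),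
       (p k ^ 2 - b ^ 2) * u (step k n) - P k * u n]

/-- `φ` solves the Lax equations `(p_k² - ζ²)^{1/2} φ(n + e_k) = L_k(n; ζ) φ(n)` in all directions;
`α k` is the chosen square root of `p_k² - ζ²`. -/
def IsLaxSolution {N : ℕ} (p P : Fin N → ℂ) (b δ : ℂ) (u U : (Fin N → ℤ) → ℂ) (ζ : ℂ)
    (α : Fin N → ℂ) (φ : (Fin N → ℤ) → Fin 2 → ℂ) : Prop :=
  ∀ (k : Fin N) (n : Fin N → ℤ),
    α k • φ (step k n) = (laxMatrix p P b δ u U ζ k n).mulVec (φ n)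

/-- The Lax equations written for the vector `Ψ = φ / ρ(ζ)^{1/2}`, whose first component is
`Λ(ζ)`. In this form they also make sense at `ζ = p_k`, where `ρ(ζ)` is singular; away from such
points they are equivalent to the Lax equations for `φ`, see `isLaxSolution_iff`. -/
def IsReducedLaxSolution {N : ℕ} (p P : Fin N → ℂ) (b δ : ℂ) (u U : (Fin N → ℤ) → ℂ) (ζ : ℂ)
    (Ψ : (Fin N → ℤ) → Fin 2 → ℂ) : Prop :=
  ∀ (k : Fin N) (n : Fin N → ℤ),
    (p k + ζ) • Ψ (step k n) = (laxMatrix p P b δ u U ζ k n).mulVec (Ψ n)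

theorem rhoHalf_step {N : ℕ} (p α : Fin N → ℂ) (ζ : ℂ)
    (h : ∀ r, (p r + ζ) / α r ≠ 0) (k : Fin N) (n : Fin N → ℤ) :
    rhoHalf p α ζ (step k n) = rhoHalf p α ζ n * ((p k + ζ) / α k) := by
  unfold rhoHalf step
  have : ∀ r, ((p r + ζ) / α r) ^ ((n + Pi.single k 1 : Fin N → ℤ) r)
      = ((p r + ζ) / α r) ^ n r * (if r = k then (p k + ζ) / α k else 1) := by
    intro r
    by_cases hr : r = k
    · subst hr
      simp [zpow_add₀ (h r)]
    · simp [hr]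
  simp_rw [this, Finset.prod_mul_distrib]
  simp

theorem isLaxSolution_iff {N : ℕ} (p P : Fin N → ℂ) (b δ : ℂ) (u U : (Fin N → ℤ) → ℂ) (ζ : ℂ)
    (α : Fin N → ℂ) (hα : ∀ r, α r ^ 2 = p r ^ 2 - ζ ^ 2) (hα0 : ∀ r, α r ≠ 0)
    (Ψ : (Fin N → ℤ) → Fin 2 → ℂ) :
    IsLaxSolution p P b δ u U ζ α (fun n => rhoHalf p α ζ n • Ψ n)
      ↔ IsReducedLaxSolution p P b δ u U ζ Ψ := by
  have h1 : ∀ r, p r + ζ ≠ 0 := by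
    intro r h0
    apply hα0 r
    have h2 : α r ^ 2 = (p r + ζ) * (p r - ζ) := by rw [hα r]; ring
    rw [h0, zero_mul] at h2
    exact pow_eq_zero_iff (two_ne_zero) |>.mp h2
  have h2 : ∀ r, (p r + ζ) / α r ≠ 0 := fun r => div_ne_zero (h1 r) (hα0 r)
  have h3 : ∀ n, rhoHalf p α ζ n ≠ 0 :=
    fun n => Finset.prod_ne_zero_iff.mpr fun r _ => zpow_ne_zero _ (h2 r)
  unfold IsLaxSolution IsReducedLaxSolution
  refine forall₂_congr fun k n => ?_
  beta_reduce
  rw [rhoHalf_step p α ζ h2 k n, Matrix.mulVec_smul, smul_smul,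
    show α k * (rhoHalf p α ζ n * ((p k + ζ) / α k)) = rhoHalf p α ζ n * (p k + ζ) by
      field_simp [hα0 k], mul_smul]
  exact (smul_right_injective _ (h3 n)).eq_iff

/-- The coefficient of the second-order equation for the first component of the Lax vector, for a
step in the direction `k` followed by a step in the direction `l`. -/
def linCoeff {N : ℕ} (p P : Fin N → ℂ) (u U : (Fin N → ℤ) → ℂ) (k l : Fin N)
    (n : Fin N → ℤ) : ℂ :=
  (P l * u (step l (step k n)) - (p l ^ 2 - p k ^ 2) * u (step k n) - P k * u n) / U (step k n)

/-! ## The lattice equations -/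

/-- The closed-form quad-lattice equation for `Λ(ζ)`, on all quadrilaterals on which the
denominators do not vanish. -/
def SolvesClosedForm {N : ℕ} (p : Fin N → ℂ) (ζ : ℂ) (L : (Fin N → ℤ) → ℂ) : Prop :=
  ∀ (k l : Fin N) (n : Fin N → ℤ), L (step k n) ≠ 0 → L (step l n) ≠ 0 →
    (p k + ζ) * (L (step l (step k n)) / L (step l n)) - (p k - ζ) * (L n / L (step k n))
      = (p l + ζ) * (L (step l (step k n)) / L (step k n)) - (p l - ζ) * (L n / L (step l n))

/-- The lattice potential modified KdV equation with parameters `α`. -/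
def SolvesLpMKdV {N : ℕ} (α : Fin N → ℂ) (φ : (Fin N → ℤ) → ℂ) : Prop :=
  ∀ (k l : Fin N) (n : Fin N → ℤ),
    α k * (φ n * φ (step l n) - φ (step k n) * φ (step l (step k n)))
      = α l * (φ n * φ (step k n) - φ (step l n) * φ (step l (step k n)))

/-- The lattice modified KdV equation in the `(k, l)`-plane, with non-vanishing denominators. -/
def SolvesLMKdV {N : ℕ} (α : Fin N → ℂ) (k l : Fin N) (W : (Fin N → ℤ) → ℂ) : Prop :=
  ∀ n : Fin N → ℤ,
    W n ≠ 0 ∧ α k * W (step k n) - α l ≠ 0 ∧ α k - α l * W (step l n) ≠ 0 ∧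
    W (step l (step k n)) / W n
      = ((α k * W (step l n) - α l) * (α k - α l * W (step k n)))
        / ((α k * W (step k n) - α l) * (α k - α l * W (step l n)))

/-- `φ` solves the lattice potential modified KdV equation with the parameters `α` and, if it does
not vanish, `W = φ(n + e_l) / φ(n + e_k)` solves the lattice modified KdV equation. -/
def MKdVConclusion {N : ℕ} (p α : Fin N → ℂ) (φ : (Fin N → ℤ) → ℂ) : Prop :=
  SolvesLpMKdV α φ ∧
  ((∀ n, φ n ≠ 0) → ∀ k l : Fin N, p k ^ 2 ≠ p l ^ 2 →
    SolvesLMKdV α k l (fun n => φ (step l n) / φ (step k n)))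

/-- The same for `φ = Λ(ζ) ρ(ζ)^{1/2}`, for every choice `α` of the square roots
`(p_r² - ζ²)^{1/2} ≠ 0`. -/
def MKdVConclusionFor {N : ℕ} (p : Fin N → ℂ) (ζ : ℂ) (L : (Fin N → ℤ) → ℂ) : Prop :=
  ∀ α : Fin N → ℂ, (∀ r, α r ^ 2 = p r ^ 2 - ζ ^ 2) → (∀ r, α r ≠ 0) →
    MKdVConclusion p α (fun n => L n * rhoHalf p α ζ n)

/-- Statements on `Lp = Λ(p_k)` and `Lq = Λ(p_l)`: the equations obtained at `ζ = p_k` and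
`ζ = p_l`, the existence of a `τ`-function `f`, the two six-point equations, and Hirota's
discrete-time Toda equation for every such `τ`-function. -/
def TodaConclusion {N : ℕ} (p : Fin N → ℂ) (k l : Fin N) (Lp Lq : (Fin N → ℤ) → ℂ) : Prop :=
  (∀ n, Lp (step k n) ≠ 0 → Lp (step l (step k n)) ≠ 0 →
    2 * p k = (p k + p l) * (Lp (step l n) / Lp (step k n))
      + (p k - p l) * (Lp n / Lp (step l (step k n)))) ∧
  (∀ n, Lq (step l n) ≠ 0 → Lq (step l (step k n)) ≠ 0 →
    2 * p l = (p l + p k) * (Lq (step k n) / Lq (step l n))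
      + (p l - p k) * (Lq n / Lq (step l (step k n)))) ∧
  (∀ n, Lp (step l (step k n)) * Lq (step l n) = Lq (step l (step k n)) * Lp (step k n)) ∧
  ((∀ n, Lp n ≠ 0) → (∀ n, Lq n ≠ 0) →
    (∃ f : (Fin N → ℤ) → ℂ, (∀ n, f n ≠ 0) ∧
      ∀ n, Lp (step k n) = f n / f (step k n) ∧ Lq (step l n) = f n / f (step l n)) ∧
    (∀ f : (Fin N → ℤ) → ℂ, (∀ n, f n ≠ 0) →
      (∀ n, Lp (step k n) = f n / f (step k n) ∧ Lq (step l n) = f n / f (step l n)) →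
      ∀ n,
        2 * p k * f n * f (step l n)
          = (p k + p l) * f (step l (back k n)) * f (step k n)
            + (p k - p l) * f (back k n) * f (step l (step k n)) ∧
        2 * p l * f n * f (step k n)
          = (p l + p k) * f (step k (back l n)) * f (step l n)
            + (p l - p k) * f (back l n) * f (step l (step k n)) ∧
        (p k - p l) ^ 2 * f (back l (back k n)) * f (step l (step k n))
          - (p k + p l) ^ 2 * f (step l (back k n)) * f (step k (back l n))
          + 4 * p k * p l * f n ^ 2 = 0))

/-- The function `𝒯`, computed with the shift in the direction `j`. -/
def schwarzT {N : ℕ} (p : Fin N → ℂ) (Lam : (Fin N → ℤ) → ℂ → ℂ) (j : Fin N)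
    (n : Fin N → ℤ) : ℂ :=
  p j / 2 * (Lam (step j n) 0 * deriv (deriv (Lam n)) 0
      - Lam n 0 * deriv (deriv (Lam (step j n))) 0)
    - Lam n 0 * deriv (Lam (step j n)) 0

/-- `u = ℬ (μ + μ₀ - 𝒯)` solves the Schwarzian KdV (cross-ratio) equation, in product form, and
also in quotient form (with non-vanishing denominators) if `ℬ ≠ 0` and `Λ(0)` does not vanish. -/
def SchwarzianConclusion {N : ℕ} (p : Fin N → ℂ) (Lam : (Fin N → ℤ) → ℂ → ℂ) : Prop :=
  ∀ (B μ₀ : ℂ) (j : Fin N) (u : (Fin N → ℤ) → ℂ),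
    (∀ n, u n = B * ((∑ r, (n r : ℂ) / p r) + μ₀ - schwarzT p Lam j n)) →
    ∀ (k l : Fin N) (n : Fin N → ℤ),
      p k ^ 2 * ((u n - u (step k n)) * (u (step l n) - u (step l (step k n))))
        = p l ^ 2 * ((u n - u (step l n)) * (u (step k n) - u (step l (step k n)))) ∧
      (B ≠ 0 → (∀ m, Lam m 0 ≠ 0) →
        (u n - u (step l n)) * (u (step k n) - u (step l (step k n))) ≠ 0 ∧
        ((u n - u (step k n)) * (u (step l n) - u (step l (step k n))))
          / ((u n - u (step l n)) * (u (step k n) - u (step l (step k n))))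
          = p l ^ 2 / p k ^ 2)

/-- The lattice KdV equation in the `(k, l)`-plane, for a nowhere vanishing `ω`. -/
def SolvesLatticeKdV {N : ℕ} (p : Fin N → ℂ) (k l : Fin N) (ω : (Fin N → ℤ) → ℂ) : Prop :=
  (∀ n, ω n ≠ 0) ∧
  ∀ n, ω n - ω (step l (step k n)) = (p k ^ 2 - p l ^ 2) * (1 / ω (step l n) - 1 / ω (step k n))

/-- With `x = Λ_ε` and `𝒜² - ℬ² = -1`: the function
`u = ℬ (ϱ + ϱ₀ + x) + (-1)^{n₁ + ⋯ + n_N} 𝒜 (ϱ + ϱ₁ + x)` solves H1 in all planes; the difference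
`u(n + e_k) - u(n + e_l)` solves the lattice KdV equation and has the stated form; and in each
plane `(ℬ - (-1)^{n_k + n_l} 𝒜) (p_k - p_l + x(n + e_k) - x(n + e_l))` solves lattice KdV. -/
def KdVConclusion {N : ℕ} (p : Fin N → ℂ) (x : (Fin N → ℤ) → ℂ) : Prop :=
  ∀ A B ρ₀ ρ₁ : ℂ, A ^ 2 - B ^ 2 = -1 →
    ∀ u : (Fin N → ℤ) → ℂ,
    (∀ n, u n = B * ((∑ r, p r * (n r : ℂ)) + ρ₀ + x n)
        + (-1 : ℂ) ^ (∑ r, n r) * A * ((∑ r, p r * (n r : ℂ)) + ρ₁ + x n)) →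
    ∀ k l : Fin N,
      (∀ n, (u n - u (step l (step k n))) * (u (step k n) - u (step l n))
          + p k ^ 2 - p l ^ 2 = 0) ∧
      (∀ n, u (step k n) - u (step l n)
          = (B - (-1 : ℂ) ^ (∑ r, n r) * A) * (p k - p l + x (step k n) - x (step l n))) ∧
      (p k ^ 2 ≠ p l ^ 2 →
        SolvesLatticeKdV p k l (fun n => u (step k n) - u (step l n)) ∧
        SolvesLatticeKdV p k l (fun n =>
          (B - (-1 : ℂ) ^ (n k + n l) * A) * (p k - p l + x (step k n) - x (step l n))))

/-! ## Direct scattering along a staircase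

A staircase through the origin is given by the sequence `s : ℤ → Fin N` of the directions of its
steps: the step from the `i`-th point to the next one goes in the direction `s i`. The set `I` of
directions in which it exists is `Set.range s`. -/

/-- The `i`-th point of the staircase. -/
def stairs {N : ℕ} (s : ℤ → Fin N) (i : ℤ) : Fin N → ℤ := fun r =>
  (((Finset.Ico 0 i).filter fun j => s j = r).card : ℤ)
    - (((Finset.Ico i 0).filter fun j => s j = r).card : ℤ)

/-- The summability condition `∑ |υ_i| K^{|i|} (1 + |i|) < ∞`. -/
def WeightedSummable (K : ℝ) (υ : ℤ → ℂ) : Prop :=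
  Summable fun i : ℤ => ‖υ i‖ * K ^ i.natAbs * (1 + |(i : ℝ)|)

/-- The region `𝒫`: the union over `r ∈ I` of `|(p_r - ζ) / (p_r + ζ)| > K`, with the value at
`ζ = -p_r` read as infinity. -/
def regionP {N : ℕ} (K : ℝ) (p : Fin N → ℂ) (s : ℤ → Fin N) : Set ℂ :=
  {ζ | ∃ r ∈ Set.range s, K * ‖p r + ζ‖ < ‖p r - ζ‖}

/-- The region `𝒫*`. -/
def regionPstar {N : ℕ} (K : ℝ) (p : Fin N → ℂ) (s : ℤ → Fin N) : Set ℂ :=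
  {ζ | ∃ r ∈ Set.range s, K * ‖p r - ζ‖ < ‖p r + ζ‖}

/-- The kernel `F(i, l; ζ) = (1 / 2ζ) (1 - ∏_{r = l}^{i - 1} (p_r - ζ) / (p_r + ζ))` for `l ≤ i`,
written so that the removable singularity at `ζ = 0` is removed; see `two_mul_kernelF`. -/
def kernelF {N : ℕ} (p : Fin N → ℂ) (s : ℤ → Fin N) (i l : ℤ) (ζ : ℂ) : ℂ :=
  ∑ r ∈ Finset.Ico l i, (1 / (p (s r) + ζ)) *
    ∏ j ∈ Finset.Ico l r, ((p (s j) - ζ) / (p (s j) + ζ))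

theorem two_mul_kernelF {N : ℕ} (p : Fin N → ℂ) (s : ℤ → Fin N) (ζ : ℂ)
    (h : ∀ i, p (s i) + ζ ≠ 0) (l : ℤ) (m : ℕ) :
    2 * ζ * kernelF p s (l + m) l ζ
      = 1 - ∏ r ∈ Finset.Ico l (l + m), ((p (s r) - ζ) / (p (s r) + ζ)) := by
  induction m with
  | zero => simp [kernelF]
  | succ m ih =>
    have e : Finset.Ico l (l + ((m + 1 : ℕ) : ℤ)) = insert (l + (m : ℤ)) (Finset.Ico l (l + m)) := by
      ext x
      simp only [Finset.mem_Ico, Finset.mem_insert]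
      push_cast
      omega
    have hn : l + (m : ℤ) ∉ Finset.Ico l (l + (m : ℤ)) := by simp
    have ih' := ih
    unfold kernelF at ih' ⊢
    rw [e, Finset.sum_insert hn, Finset.prod_insert hn, mul_add, ih']
    have := h (l + m)
    field_simp
    ring

/-- The terms `H_k(i; ζ)` of the Neumann series of `Λ(i; ζ)`. -/
def jostTerm {N : ℕ} (p : Fin N → ℂ) (s : ℤ → Fin N) (υ : ℤ → ℂ) (ζ : ℂ) : ℕ → ℤ → ℂ
  | 0, _ => 1
  | k + 1, i => ∑' l : ℤ, if l < i then kernelF p s i l ζ * υ l * jostTerm p s υ ζ k l else 0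

/-- The Jost function `Λ(i; ζ)` on the staircase. -/
def jost {N : ℕ} (p : Fin N → ℂ) (s : ℤ → Fin N) (υ : ℤ → ℂ) (i : ℤ) (ζ : ℂ) : ℂ :=
  ∑' k : ℕ, jostTerm p s υ ζ k i

/-- The terms `J_k(i; ζ)` of the Neumann series of `Υ(i; ζ)`. -/
def jostTermPlus {N : ℕ} (p : Fin N → ℂ) (s : ℤ → Fin N) (υ : ℤ → ℂ) (ζ : ℂ) : ℕ → ℤ → ℂ
  | 0, _ => 1
  | k + 1, i => ∑' l : ℤ, if i < l then kernelF p s l i ζ * υ l * jostTermPlus p s υ ζ k l else 0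

/-- The Jost function `Υ(i; ζ)` on the staircase. -/
def jostPlus {N : ℕ} (p : Fin N → ℂ) (s : ℤ → Fin N) (υ : ℤ → ℂ) (i : ℤ) (ζ : ℂ) : ℂ :=
  ∑' k : ℕ, jostTermPlus p s υ ζ k i

/-- The spectral function `A` in `ψ = A φ̊ + B φ`, as the Wronskian `W(ψ, φ) / 2ζ` at the base
point of the staircase. -/
def specA {N : ℕ} (p : Fin N → ℂ) (s : ℤ → Fin N) (υ : ℤ → ℂ) (ζ : ℂ) : ℂ :=
  1 / (2 * ζ) * ((p (s 0) + ζ) * jostPlus p s υ 0 ζ * jost p s υ 1 ζ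
    - (p (s 0) - ζ) * jostPlus p s υ 1 ζ * jost p s υ 0 ζ)

/-- The spectral function `B` in `ψ = A φ̊ + B φ`, as the Wronskian `W(φ̊, ψ) / 2ζ` at the base
point of the staircase; here `φ̊(ζ) = φ(-ζ)`. -/
def specB {N : ℕ} (p : Fin N → ℂ) (s : ℤ → Fin N) (υ : ℤ → ℂ) (ζ : ℂ) : ℂ :=
  (p (s 0) - ζ) / (2 * ζ) * (jost p s υ 0 (-ζ) * jostPlus p s υ 1 ζ
    - jost p s υ 1 (-ζ) * jostPlus p s υ 0 ζ)

/-- The zeros `ζ_j` of `A` outside `𝒫 ∪ ∂𝒫` (the point `ζ = 0`, where `A` has a pole in general and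
where the formula for `A` is not meaningful, does not count). -/
def zerosA {N : ℕ} (K : ℝ) (p : Fin N → ℂ) (s : ℤ → Fin N) (υ : ℤ → ℂ) : Set ℂ :=
  {ζ | ζ ∉ closure (regionP K p s) ∧ ζ ≠ 0 ∧ specA p s υ ζ = 0}

/-- Admissible potentials: weighted summability, and finitely many zeros of `A`, all simple. -/
def IsAdmissible {N : ℕ} (K : ℝ) (p : Fin N → ℂ) (s : ℤ → Fin N) (υ : ℤ → ℂ) : Prop :=
  WeightedSummable K υ ∧ (zerosA K p s υ).Finite ∧
    ∀ z ∈ zerosA K p s υ, deriv (specA p s υ) z ≠ 0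

/-- `c` is the constant in `ψ(i; z) = c φ(i; z)` at a zero `z` of `A`. -/
def IsProportionality {N : ℕ} (p : Fin N → ℂ) (s : ℤ → Fin N) (υ : ℤ → ℂ) (z c : ℂ) : Prop :=
  ∀ i : ℤ, jostPlus p s υ i z = c * rho p (stairs s i) z * jost p s υ i z

open Classical in
/-- The constants `C_j`. -/
def normC {N : ℕ} (K : ℝ) (p : Fin N → ℂ) (s : ℤ → Fin N) (υ : ℤ → ℂ) (c : ℂ → ℂ) (z : ℂ) : ℂ :=
  (if z ∈ regionPstar K p s then c z else specB p s υ z) / deriv (specA p s υ) z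

/-! ## The contour and the singular integral equation -/

/-- The winding number of the closed curve `γ : [0, 1] → ℂ` about `w`. -/
def winding (γ : ℝ → ℂ) (w : ℂ) : ℂ :=
  1 / (2 * Real.pi * Complex.I) * ∫ t in (0 : ℝ)..1, deriv γ t / (γ t - w)

/-- The exterior region `ℛ⁻` of the curve. -/
def exteriorOf (γ : ℝ → ℂ) : Set ℂ := {w | w ∉ Set.range γ ∧ winding γ w = 0}

/-- The interior region `ℛ⁺` of the curve. -/
def interiorOf (γ : ℝ → ℂ) : Set ℂ := {w | w ∉ Set.range γ ∧ winding γ w = 1}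

/-- `γ` is a (Lipschitz parametrisation of a) positively oriented simple closed curve. -/
def IsPositiveJordan (γ : ℝ → ℂ) : Prop :=
  (∃ C, LipschitzWith C γ) ∧ Function.Periodic γ 1 ∧ Set.InjOn γ (Set.Ico 0 1) ∧
    ∀ w, w ∉ Set.range γ → w ∈ exteriorOf γ ∨ w ∈ interiorOf γ

/-- Contours `L` that may be used in the singular integral equation. The last three conditions say
that the equation makes sense on `L` and at the `ζ_j`: its kernels `1 / (σ + ζ)` and
`1 / (ζ + ζ_j)` and its plane-wave factors are not singular there. -/
def IsContourFor {N : ℕ} (K : ℝ) (p : Fin N → ℂ) (s : ℤ → Fin N) (υ : ℤ → ℂ) (γ : ℝ → ℂ) : Prop :=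
  IsPositiveJordan γ ∧
  (∀ w ∈ Set.range γ, w ∉ closure (regionP K p s)) ∧
  regionPstar K p s ⊆ interiorOf γ ∧
  0 ∈ exteriorOf γ ∧
  zerosA K p s υ ⊆ interiorOf γ ∧
  (∀ w, w ∈ Set.range γ ∨ w ∈ interiorOf γ → -w ∈ exteriorOf γ) ∧
  (∀ r, p r ∉ Set.range γ ∧ -p r ∉ Set.range γ) ∧
  (∀ r, p r ∉ zerosA K p s υ ∧ -p r ∉ zerosA K p s υ)

/-- `f` solves the singular integral equation at the lattice point `n`:
`f(ζ) = 1 - ∑_j C_j f(ζ_j) ρ(ζ_j) / (ζ + ζ_j) + (1 / 2πi) ∫_L R(σ) f(σ) ρ(σ) / (σ + ζ) dσ`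
for all `ζ` with `-ζ ∈ ℛ⁻`, where `R = B / A`; the integrand is required to be integrable. -/
def SolvesIntegralEq {N : ℕ} (K : ℝ) (p : Fin N → ℂ) (s : ℤ → Fin N) (υ : ℤ → ℂ) (c : ℂ → ℂ)
    (γ : ℝ → ℂ) (n : Fin N → ℤ) (f : ℂ → ℂ) : Prop :=
  IntervalIntegrable
    (fun t => specB p s υ (γ t) / specA p s υ (γ t) * f (γ t) * rho p n (γ t) * deriv γ t)
    MeasureTheory.volume 0 1 ∧
  ∀ ζ, -ζ ∈ exteriorOf γ →
    f ζ = 1 - (∑ᶠ z ∈ zerosA K p s υ, normC K p s υ c z * f z / (ζ + z) * rho p n z)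
      + 1 / (2 * Real.pi * Complex.I) *
        ∫ t in (0 : ℝ)..1, specB p s υ (γ t) / specA p s υ (γ t) * f (γ t) / (γ t + ζ)
          * rho p n (γ t) * deriv γ t

/-- `Λ` is the `N`-dimensional Jost function: at every lattice point it is the unique solution of
the singular integral equation. -/
def IsInverseScatteringJost {N : ℕ} (K : ℝ) (p : Fin N → ℂ) (s : ℤ → Fin N) (υ : ℤ → ℂ)
    (c : ℂ → ℂ) (γ : ℝ → ℂ) (Lam : (Fin N → ℤ) → ℂ → ℂ) : Prop :=
  ∀ n, SolvesIntegralEq K p s υ c γ n (Lam n) ∧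
    ∀ f, SolvesIntegralEq K p s υ c γ n f → ∀ ζ, -ζ ∈ exteriorOf γ → f ζ = Lam n ζ

/-- `Λ` is the `N`-dimensional Jost function in the sense of the linear problem: on the staircase it
is the Jost function of the potential, and in every pair of directions (equal ones included) it
solves the second-order evolution equation with a coefficient that does not depend on `ζ`. -/
def IsLinearProblemJost {N : ℕ} (K : ℝ) (p : Fin N → ℂ) (s : ℤ → Fin N) (υ : ℤ → ℂ)
    (Lam : (Fin N → ℤ) → ℂ → ℂ) : Prop :=
  (∀ i, ∀ ζ, ζ ∉ regionP K p s → Lam (stairs s i) ζ = jost p s υ i ζ) ∧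
  ∀ (k l : Fin N) (n : Fin N → ℤ), ∃ V : ℂ, ∀ ζ, ζ ∉ regionP K p s →
    (p l + ζ) * Lam (step l (step k n)) ζ - V * Lam (step k n) ζ + (p k - ζ) * Lam n ζ = 0

/-- Existence of the Jost function on the staircase for every `ζ ∉ 𝒫`: the Neumann series and the
sums in its terms converge absolutely, and the sum solves the scattering problem with the boundary
condition `Λ → 1`; it is holomorphic outside `𝒫 ∪ ∂𝒫`, and the coefficient `Λ_ε` exists. -/
def JostExists {N : ℕ} (K : ℝ) (p : Fin N → ℂ) (s : ℤ → Fin N) (υ : ℤ → ℂ) : Prop :=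
  (∀ ζ, ζ ∉ regionP K p s →
    (∀ k i, Summable fun l : ℤ =>
      ‖if l < i then kernelF p s i l ζ * υ l * jostTerm p s υ ζ k l else 0‖) ∧
    (∀ i, Summable fun k : ℕ => ‖jostTerm p s υ ζ k i‖) ∧
    (∀ i : ℤ, (p (s (i + 1)) + ζ) * jost p s υ (i + 2) ζ
      - (p (s i) + p (s (i + 1)) + υ (i + 1)) * jost p s υ (i + 1) ζ
      + (p (s i) - ζ) * jost p s υ i ζ = 0) ∧
    Tendsto (fun i : ℤ => jost p s υ i ζ) atBot (𝓝 1)) ∧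
  (∀ i, DifferentiableOn ℂ (jost p s υ i) (closure (regionP K p s))ᶜ) ∧
  (∀ i, ∃ x : ℂ, Tendsto (fun ζ => ζ * (jost p s υ i ζ - 1))
    (Bornology.cobounded ℂ ⊓ 𝓟 (regionP K p s)ᶜ) (𝓝 x))

end LatticeIST

end

namespace LatticeIST

variable {N : ℕ}

/-! Everything rests on one linear relation, `LinearPair`: (q+ζ)Λ̂̃ + (p−ζ)Λ = VΛ̃, together with
its mirror image under exchange of the two directions, with the same coefficient V. Eliminating V
gives the closed quad equation (1). The factor ρ^{1/2} symmetrises (1) into lattice potential mKdV,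
and solving that for the far corner of two neighbouring quadrilaterals gives lattice mKdV. At ζ=p
and ζ=q one term of the relation drops out. The common V then couples Λ(p) to Λ(q), and this
coupling is exactly the closedness of a multiplicative 1-form. Its integral is the τ-function, and
three six-point equations combine to Toda.

The symmetric V has three sources. For Q3 it is a quotient of a partial derivative of the quad
polynomial by a factor of a biquadratic. Its symmetry is `q3_derivatives_proportional`, and the
relation itself follows by eliminating the second Lax component (`IsReducedLaxSolution.linear`). For
inverse scattering the residue sum and the contour integral form a single Cauchy integral against
one measure. The combination (q+ζ)Λ̂̃ + (p−ζ)Λ − (V−1)Λ̃ solves the integral equation of Λ̃, so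
uniqueness identifies the two (`SolvesCauchyEq.linear`). For a solution of the evolution equations
the expansion at ζ=∞ forces V = p+q+x̂̃−x with x=Λ_ε, which is visibly symmetric
(`linear_coeff_of_expansion`).

The next order in 1/ζ of the two mirror relations yields (p+q+x̂̃−x)(p−q+x̃−x̂) = p²−q², from which
H1 and lattice KdV are algebra. For Schwarzian KdV one expands at ζ=0 to second order and adds the
Wronskian identity `SolvesCauchyEq.wronskian`; the result is u−ũ = −ℬΛ(0)Λ̃(0)/p, and the
cross-ratio equation is immediate.

Existence of the staircase Jost function is Volterra theory: the k-th Neumann term is at most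
E^k/k!, where E is a tail sum of the majorant. The kernel is a Green's function of the free
equation, so the sum solves the scattering problem. Locally uniform majorants give holomorphy, and
dominated convergence gives Λ_ε. -/

theorem step_comm (k l : Fin N) (n : Fin N → ℤ) : step l (step k n) = step k (step l n) := by
  simp only [step]; abel

theorem step_back (k : Fin N) (n : Fin N → ℤ) : step k (back k n) = n := by simp [step, back]

theorem step_back_comm (k l : Fin N) (n : Fin N → ℤ) :
    step l (back k n) = back k (step l n) := by
  simp only [step, back]; abel

/-- The linear problem in the two directions `k`, `l`, with a common coefficient `V`. -/
def LinearPair (p : Fin N → ℂ) (ζ : ℂ) (k l : Fin N) (V : (Fin N → ℤ) → ℂ)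
    (L : (Fin N → ℤ) → ℂ) : Prop :=
  ∀ n, (p l + ζ) * L (step l (step k n)) + (p k - ζ) * L n = V n * L (step k n) ∧
    (p k + ζ) * L (step l (step k n)) + (p l - ζ) * L n = V n * L (step l n)

/-! ### Consequences of the linear pair: closed form and modified KdV -/

theorem solvesClosedForm_of_linearPair {p : Fin N → ℂ} {ζ : ℂ} {L : (Fin N → ℤ) → ℂ}
    (h : ∀ k l, ∃ V, LinearPair p ζ k l V L) : SolvesClosedForm p ζ L := by
  intro k l n hk hl
  obtain ⟨V, hV⟩ := h k l
  obtain ⟨h1, h2⟩ := hV n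
  field_simp
  linear_combination (-L (step l n)) * h1 + L (step k n) * h2

theorem add_ne_zero_of_sqrt {p α ζ : ℂ} (h : α ^ 2 = p ^ 2 - ζ ^ 2) (h0 : α ≠ 0) : p + ζ ≠ 0 := by
  intro h1
  apply h0
  have h2 : α ^ 2 = (p + ζ) * (p - ζ) := by rw [h]; ring
  rw [h1, zero_mul] at h2
  exact (pow_eq_zero_iff two_ne_zero).mp h2

/-- Cross-multiplying the pair removes V without dividing by Λ, so zeros of Λ do no harm. Writing
p−ζ = α²/(p+ζ) and noting that a shift multiplies ρ^{1/2} by (p+ζ)/α, the factors p+ζ are absorbed.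
-/
theorem solvesLpMKdV_of_linearPair {p α : Fin N → ℂ} {ζ : ℂ} {L : (Fin N → ℤ) → ℂ}
    (h : ∀ k l, ∃ V, LinearPair p ζ k l V L) (hα : ∀ r, α r ^ 2 = p r ^ 2 - ζ ^ 2)
    (hα0 : ∀ r, α r ≠ 0) : SolvesLpMKdV α (fun n => L n * rhoHalf p α ζ n) := by
  have hne : ∀ r, (p r + ζ) / α r ≠ 0 := fun r =>
    div_ne_zero (add_ne_zero_of_sqrt (hα r) (hα0 r)) (hα0 r)
  intro k l n
  obtain ⟨V, hV⟩ := h k l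
  obtain ⟨h1, h2⟩ := hV n
  beta_reduce
  rw [rhoHalf_step p α ζ hne l (step k n), rhoHalf_step p α ζ hne k n, rhoHalf_step p α ζ hne l n]
  have ak := hα0 k
  have al := hα0 l
  have e3 : L (step l n) * ((p l + ζ) * L (step l (step k n)) + (p k - ζ) * L n)
      = L (step k n) * ((p k + ζ) * L (step l (step k n)) + (p l - ζ) * L n) := by
    rw [h1, h2]; ring
  have e4 : p k - ζ = α k ^ 2 / (p k + ζ) := by
    rw [eq_div_iff (add_ne_zero_of_sqrt (hα k) ak), hα k]; ring
  have e5 : p l - ζ = α l ^ 2 / (p l + ζ) := by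
    rw [eq_div_iff (add_ne_zero_of_sqrt (hα l) al), hα l]; ring
  have bk := add_ne_zero_of_sqrt (hα k) ak
  have bl := add_ne_zero_of_sqrt (hα l) al
  rw [e4, e5] at e3
  field_simp at e3 ⊢
  linear_combination rhoHalf p α ζ n ^ 2 * e3

/-- The potential mKdV equation says that φ times the first form equals φ̂̃ times the second, so the
two forms vanish together. As linear forms in (φ̃, φ̂) they are independent because α_k² − α_l² =
p_k² − p_l² ≠ 0. -/
theorem SolvesLpMKdV.ne {p α : Fin N → ℂ} {ζ : ℂ} {φ : (Fin N → ℤ) → ℂ} (h : SolvesLpMKdV α φ)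
    (hα : ∀ r, α r ^ 2 = p r ^ 2 - ζ ^ 2)
    (hφ : ∀ n, φ n ≠ 0) {k l : Fin N} (hkl : p k ^ 2 ≠ p l ^ 2) (n : Fin N → ℤ) :
    α k * φ (step l n) - α l * φ (step k n) ≠ 0 ∧
      α k * φ (step k n) - α l * φ (step l n) ≠ 0 := by
  have hne : α k ^ 2 - α l ^ 2 ≠ 0 := by
    rw [hα, hα]; intro h0; exact hkl (by linear_combination h0)
  have e := h k l n
  have key : φ n * (α k * φ (step l n) - α l * φ (step k n))
      = φ (step l (step k n)) * (α k * φ (step k n) - α l * φ (step l n)) := by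
    linear_combination e
  have both : ¬ (α k * φ (step l n) - α l * φ (step k n) = 0 ∧
      α k * φ (step k n) - α l * φ (step l n) = 0) := by
    rintro ⟨h1, h2⟩
    have : (α k ^ 2 - α l ^ 2) * (φ (step k n) * φ (step l n)) = 0 := by
      linear_combination α k * φ (step k n) * h1 + α l * φ (step k n) * h2
    rcases mul_eq_zero.mp this with h3 | h3
    · exact hne h3
    · exact mul_ne_zero (hφ _) (hφ _) h3
  constructor
  · intro h1
    rw [h1, mul_zero] at key
    exact both ⟨h1, (mul_eq_zero.mp key.symm).resolve_left (hφ _)⟩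
  · intro h1
    rw [h1, mul_zero] at key
    exact both ⟨(mul_eq_zero.mp key).resolve_left (hφ _), h1⟩

theorem SolvesLpMKdV.mKdVConclusion {p α : Fin N → ℂ} {ζ : ℂ} {φ : (Fin N → ℤ) → ℂ}
    (h : SolvesLpMKdV α φ) (hα : ∀ r, α r ^ 2 = p r ^ 2 - ζ ^ 2) :
    MKdVConclusion p α φ := by
  refine ⟨h, fun hφ k l hkl => ?_⟩
  have key : ∀ n, φ n * (α k * φ (step l n) - α l * φ (step k n))
      = φ (step l (step k n)) * (α k * φ (step k n) - α l * φ (step l n)) := by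
    intro n
    linear_combination h k l n
  have w1 : ∀ n, α k * (φ (step l n) / φ (step k n)) - α l
      = (α k * φ (step l n) - α l * φ (step k n)) / φ (step k n) := by
    intro n
    have := hφ (step k n)
    field_simp
  have w2 : ∀ n, α k - α l * (φ (step l n) / φ (step k n))
      = (α k * φ (step k n) - α l * φ (step l n)) / φ (step k n) := by
    intro n
    have := hφ (step k n)
    field_simp
  intro n
  beta_reduce
  rw [w1, w2, w1, w2]
  have n1 := h.ne hα hφ hkl (step k n)
  have n2 := h.ne hα hφ hkl (step l n)
  refine ⟨div_ne_zero (hφ _) (hφ _), div_ne_zero n1.1 (hφ _), div_ne_zero n2.2 (hφ _), ?_⟩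
  -- The equation at n+e_k and n+e_l gives the two far corners whose quotient is the shifted W.
  have k1 := key (step k n)
  have k2 := key (step l n)
  have c1 : step k (step l (step k n)) = step l (step k (step k n)) := step_comm _ _ _
  have c2 : step l (step k (step l n)) = step l (step l (step k n)) := by
    rw [step_comm l k n]
  rw [c2] at k2
  rw [c1]
  have a1 := n1.2
  have a2 := n2.2
  have a3 := n1.1
  have a4 := n2.1
  have e1 : φ (step l (step k (step k n))) = φ (step k n) *
      (α k * φ (step l (step k n)) - α l * φ (step k (step k n))) /
      (α k * φ (step k (step k n)) - α l * φ (step l (step k n))) := by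
    rw [k1]; field_simp
  have e2 : φ (step l (step l (step k n))) = φ (step l n) *
      (α k * φ (step l (step l n)) - α l * φ (step k (step l n))) /
      (α k * φ (step k (step l n)) - α l * φ (step l (step l n))) := by
    rw [k2]; field_simp
  rw [e1, e2]
  have b1 := hφ (step k n)
  have b2 := hφ (step l n)
  have b3 := hφ (step k (step k n))
  have b4 := hφ (step k (step l n))
  field_simp

theorem mKdVConclusion_of_linearPair {p α : Fin N → ℂ} {ζ : ℂ} {L : (Fin N → ℤ) → ℂ}
    (h : ∀ k l, ∃ V, LinearPair p ζ k l V L) (hα : ∀ r, α r ^ 2 = p r ^ 2 - ζ ^ 2)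
    (hα0 : ∀ r, α r ≠ 0) : MKdVConclusion p α (fun n => L n * rhoHalf p α ζ n) :=
  (solvesLpMKdV_of_linearPair h hα hα0).mKdVConclusion hα

/-! ## The `τ`-function and the Toda equation -/

/-- A multiplicative antiderivative on ℤ: at most one of the two products is nonempty, the numerator
for positive and the denominator for negative indices. -/
theorem exists_int_integral (g : ℤ → ℂ) (hg : ∀ i, g i ≠ 0) :
    ∃ F : ℤ → ℂ, (∀ i, F i ≠ 0) ∧ ∀ i, F (i + 1) = g i * F i := by
  refine ⟨fun i => (∏ j ∈ Finset.Ico 0 i, g j) / ∏ j ∈ Finset.Ico i 0, g j, fun i => ?_, fun i => ?_⟩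
  · exact div_ne_zero (Finset.prod_ne_zero_iff.mpr fun j _ => hg j)
      (Finset.prod_ne_zero_iff.mpr fun j _ => hg j)
  · beta_reduce
    rcases le_or_gt 0 i with hi | hi
    · have e : Finset.Ico 0 (i + 1) = insert i (Finset.Ico 0 i) := by
        ext x; simp only [Finset.mem_Ico, Finset.mem_insert]; omega
      rw [e, Finset.prod_insert (by simp), Finset.Ico_eq_empty (by omega : ¬ i + 1 < 0),
        Finset.Ico_eq_empty (by omega : ¬ i < 0)]
      simp
    · have e : Finset.Ico i 0 = insert i (Finset.Ico (i + 1) 0) := by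
        ext x; simp only [Finset.mem_Ico, Finset.mem_insert]; omega
      rw [e, Finset.prod_insert (by simp), Finset.Ico_eq_empty (by omega : ¬ 0 < i + 1),
        Finset.Ico_eq_empty (by omega : ¬ 0 < i)]
      have := hg i
      have h2 : ∏ j ∈ Finset.Ico (i + 1) 0, g j ≠ 0 := Finset.prod_ne_zero_iff.mpr fun j _ => hg j
      field_simp

theorem step_apply_self (k : Fin N) (n : Fin N → ℤ) : step k n k = n k + 1 := by simp [step]

theorem step_apply_of_ne {k l : Fin N} (h : k ≠ l) (n : Fin N → ℤ) : step k n l = n l := by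
  simp [step, h.symm]

theorem update_step_self (k : Fin N) (n : Fin N → ℤ) (i : ℤ) :
    Function.update (step k n) k i = Function.update n k i := by
  ext r
  by_cases h : r = k
  · subst h; simp
  · simp [h, step]

theorem update_step_of_ne {k l : Fin N} (h : k ≠ l) (n : Fin N → ℤ) (i : ℤ) :
    Function.update (step l n) k i = step l (Function.update n k i) := by
  ext r
  by_cases h1 : r = k
  · subst h1; simp [step, h]
  · simp [h1, step]

theorem step_update_self (k : Fin N) (n : Fin N → ℤ) (i : ℤ) :
    step k (Function.update n k i) = Function.update n k (i + 1) := by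
  ext r
  by_cases h1 : r = k
  · subst h1; simp [step]
  · simp [h1, step]

/-- A multiplicative 1-form in the (k, l)-plane, closed on every quadrilateral, is exact; the
remaining coordinates are parameters. -/
theorem exists_lattice_integral {k l : Fin N} (hkl : k ≠ l) (g h : (Fin N → ℤ) → ℂ)
    (hg : ∀ n, g n ≠ 0) (hh : ∀ n, h n ≠ 0)
    (comp : ∀ n, g (step l n) * h n = h (step k n) * g n) :
    ∃ f : (Fin N → ℤ) → ℂ, (∀ n, f n ≠ 0) ∧
      ∀ n, f (step k n) = g n * f n ∧ f (step l n) = h n * f n := by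
  choose G hG0 hG using fun n : Fin N → ℤ =>
    exists_int_integral (fun i => g (Function.update n k i)) fun i => hg _
  choose H hH0 hH using fun n : Fin N → ℤ =>
    exists_int_integral (fun i => h (Function.update n l i)) fun i => hh _
  -- normalised integrals in the two directions
  let G' : (Fin N → ℤ) → ℤ → ℂ := fun n i => G (Function.update n k 0) i / G (Function.update n k 0) 0
  let H' : (Fin N → ℤ) → ℤ → ℂ := fun n i => H (Function.update n l 0) i / H (Function.update n l 0) 0
  have hG0' : ∀ n i, G' n i ≠ 0 := fun n i => div_ne_zero (hG0 _ _) (hG0 _ _)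
  have hH0' : ∀ n i, H' n i ≠ 0 := fun n i => div_ne_zero (hH0 _ _) (hH0 _ _)
  have hG' : ∀ n i, G' n (i + 1) = g (Function.update n k i) * G' n i := by
    intro n i
    simp only [G', hG, Function.update_idem]
    ring
  have hH' : ∀ n i, H' n (i + 1) = h (Function.update n l i) * H' n i := by
    intro n i
    simp only [H', hH, Function.update_idem]
    ring
  have hG1 : ∀ n, G' n 0 = 1 := fun n => div_self (hG0 _ _)
  -- Since the integral is based at the point with `n k` reset to 0, it depends only on the line in
  -- direction `k` and not on the position along it.
  have hGk : ∀ n, G' (step k n) = G' n := by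
    intro n; simp only [G', update_step_self]
  -- transport of `G'` in the direction `l`
  have tr : ∀ n i, G' (step l n) i * h (Function.update n k 0)
      = h (Function.update n k i) * G' n i := by
    intro n i
    have up : ∀ i, G' (step l n) i * h (Function.update n k 0)
        = h (Function.update n k i) * G' n i →
        G' (step l n) (i + 1) * h (Function.update n k 0)
        = h (Function.update n k (i + 1)) * G' n (i + 1) := by
      intro i hi
      rw [hG', hG', update_step_of_ne hkl]
      have c := comp (Function.update n k i)
      rw [step_update_self] at c
      linear_combination g (step l (Function.update n k i)) * hi + G' n i * c
    have down : ∀ i, G' (step l n) (i + 1) * h (Function.update n k 0)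
        = h (Function.update n k (i + 1)) * G' n (i + 1) →
        G' (step l n) i * h (Function.update n k 0)
        = h (Function.update n k i) * G' n i := by
      intro i hi
      rw [hG', hG', update_step_of_ne hkl] at hi
      have c := comp (Function.update n k i)
      rw [step_update_self] at c
      apply mul_left_cancel₀ (hg (step l (Function.update n k i)))
      linear_combination hi - G' n i * c
    induction i using Int.induction_on with
    | zero => rw [hG1, hG1]; ring
    | succ i ih => exact up _ ih
    | pred i ih => exact down _ (by simpa using ih)
  -- Integrate along `l` inside the hyperplane `n k = 0`, then along `k`. The step in direction `k`
  -- is then automatic, and the step in direction `l` is the transport relation `tr`.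
  let f : (Fin N → ℤ) → ℂ := fun n => G' n (n k) * H' (Function.update n k 0) (n l)
  refine ⟨f, fun n => mul_ne_zero (hG0' _ _) (hH0' _ _), fun n => ⟨?_, ?_⟩⟩
  · simp only [f, hGk, update_step_self, step_apply_self, step_apply_of_ne hkl, hG',
      Function.update_eq_self]
    ring
  · have e1 : H' (step l (Function.update n k 0)) = H' (Function.update n k 0) := by
      simp only [H', update_step_self]
    have e2 : Function.update (Function.update n k 0) l (n l) = Function.update n k 0 := by
      ext r
      by_cases h1 : r = l
      · subst h1; simp [hkl.symm]
      · simp [h1]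
    have t := tr n (n k)
    rw [Function.update_eq_self] at t
    simp only [f, update_step_of_ne hkl, step_apply_self, step_apply_of_ne hkl.symm, e1, hH', e2,
      update_step_self]
    linear_combination H' (Function.update n k 0) (n l) * t

/-- At ζ = p_k the first relation loses its Λ-term, at ζ = p_l the second one does. What remains is
(p+q)Λ̂̃(p) = VΛ̃(p) and (p+q)Λ̂̃(q) = VΛ̂(q), and the common V gives the coupling `E3`. This is the
closedness condition for the pair 1/Λ̃(p), 1/Λ̂(q), whose integral is f. -/
theorem todaConclusion_of_linearPair {p : Fin N → ℂ} {k l : Fin N} (hkl : k ≠ l)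
    (hpq : p k + p l ≠ 0) {V Lp Lq : (Fin N → ℤ) → ℂ} (hp : LinearPair p (p k) k l V Lp)
    (hq : LinearPair p (p l) k l V Lq) : TodaConclusion p k l Lp Lq := by
  have E1 : ∀ n, Lp (step k n) ≠ 0 → Lp (step l (step k n)) ≠ 0 →
      2 * p k = (p k + p l) * (Lp (step l n) / Lp (step k n))
        + (p k - p l) * (Lp n / Lp (step l (step k n))) := by
    intro n h1 h2
    obtain ⟨a, b⟩ := hp n
    field_simp
    linear_combination Lp (step k n) * b - Lp (step l n) * a
  have E2 : ∀ n, Lq (step l n) ≠ 0 → Lq (step l (step k n)) ≠ 0 →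
      2 * p l = (p l + p k) * (Lq (step k n) / Lq (step l n))
        + (p l - p k) * (Lq n / Lq (step l (step k n))) := by
    intro n h1 h2
    obtain ⟨a, b⟩ := hq n
    field_simp
    linear_combination Lq (step l n) * a - Lq (step k n) * b
  have E3 : ∀ n, Lp (step l (step k n)) * Lq (step l n)
      = Lq (step l (step k n)) * Lp (step k n) := by
    intro n
    obtain ⟨a, -⟩ := hp n
    obtain ⟨-, b⟩ := hq n
    apply mul_left_cancel₀ hpq
    linear_combination Lq (step l n) * a - Lp (step k n) * b
  refine ⟨E1, E2, E3, fun hLp hLq => ⟨?_, fun f hf0 hf => ?_⟩⟩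
  · obtain ⟨f, hf0, hf⟩ := exists_lattice_integral hkl (fun n => (Lp (step k n))⁻¹)
      (fun n => (Lq (step l n))⁻¹) (fun n => inv_ne_zero (hLp _)) (fun n => inv_ne_zero (hLq _))
      (by
        intro n
        have h1 := E3 n
        rw [← step_comm k l n, ← mul_inv, ← mul_inv, h1])
    refine ⟨f, hf0, fun n => ?_⟩
    obtain ⟨a, b⟩ := hf n
    rw [a, b]
    have h0 := hf0 n
    have h1 := hLp (step k n)
    have h2 := hLq (step l n)
    constructor <;> field_simp
  · have S1 : ∀ n, 2 * p k * f n * f (step l n)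
        = (p k + p l) * f (step l (back k n)) * f (step k n)
          + (p k - p l) * f (back k n) * f (step l (step k n)) := by
      intro n
      have h1 := (hf n).1
      have h2 := (hf (back k n)).1
      have h3 := (hf (step l n)).1
      have h4 := (hf (back k (step l n))).1
      rw [step_back] at h2 h4
      rw [← step_comm] at h3
      have e := E1 n (hLp _) (hLp _)
      rw [h1, h2, h3, h4, ← step_back_comm] at e
      have a1 := hf0 n
      have a2 := hf0 (step l n)
      have a3 := hf0 (step k n)
      have a4 := hf0 (step l (step k n))
      field_simp at e
      linear_combination e
    have S2 : ∀ n, 2 * p l * f n * f (step k n)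
        = (p l + p k) * f (step k (back l n)) * f (step l n)
          + (p l - p k) * f (back l n) * f (step l (step k n)) := by
      intro n
      have h1 := (hf n).2
      have h2 := (hf (back l n)).2
      have h3 := (hf (step k n)).2
      have h4 := (hf (back l (step k n))).2
      rw [step_back] at h2 h4
      have e := E2 n (hLq _) (hLq _)
      rw [h1, h2, h3, h4, ← step_back_comm] at e
      have a1 := hf0 n
      have a2 := hf0 (step l n)
      have a3 := hf0 (step k n)
      have a4 := hf0 (step l (step k n))
      field_simp at e
      linear_combination e
    intro n
    refine ⟨S1 n, S2 n, ?_⟩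
    have s1 := S1 n
    have s2 := S2 n
    have s3 := S1 (back l n)
    rw [step_back, step_back_comm l k, step_back, ← step_back_comm l k] at s3
    have c : back k (back l n) = back l (back k n) := by simp only [back]; abel
    have c2 : step l (back k (back l n)) = back k n := by rw [c, step_back]
    rw [c2, c] at s3
    -- Both six-point equations at n and the first one at the point shifted back in direction `l`
    -- eliminate f̂ and the values of f at the two backward neighbours; the result is the Toda
    -- equation times f̃.
    apply mul_left_cancel₀ (hf0 (step k n))
    linear_combination (2 * p k * f n) * s2 + (p k + p l) * f (step k (back l n)) * s1
      - (p k - p l) * f (step l (step k n)) * s3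

/-! ## The lattice KdV equation -/

/-- Because (B−σA)(B+σA) = B² − A² = 1, the product hypothesis gives (p²−q²)/ω = (B+σA)(p+q+x̂̃−x).
A shift flips σ, so the difference of the two shifted reciprocals carries the same prefactor B−σA as
ω − ω̂̃. -/
theorem solvesLatticeKdV_of_mul {p : Fin N → ℂ} {x : (Fin N → ℤ) → ℂ} {k l : Fin N}
    (hx : ∀ n, (p k + p l + x (step l (step k n)) - x n) * (p k - p l + x (step k n) - x (step l n))
      = p k ^ 2 - p l ^ 2) (hpq : p k ^ 2 ≠ p l ^ 2) {A B : ℂ} (hAB : A ^ 2 - B ^ 2 = -1)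
    {σ : (Fin N → ℤ) → ℂ} (h1 : ∀ n, σ n ^ 2 = 1) (hk : ∀ n, σ (step k n) = -σ n)
    (hl : ∀ n, σ (step l n) = -σ n) :
    SolvesLatticeKdV p k l (fun n => (B - σ n * A) * (p k - p l + x (step k n) - x (step l n))) := by
  have hω : ∀ n, (B - σ n * A) * (p k - p l + x (step k n) - x (step l n))
      * ((B + σ n * A) * (p k + p l + x (step l (step k n)) - x n)) = p k ^ 2 - p l ^ 2 := by
    intro n
    linear_combination hx n + (p k + p l + x (step l (step k n)) - x n)
      * (p k - p l + x (step k n) - x (step l n)) * (-A ^ 2 * h1 n - hAB)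
  have h0 : ∀ n, (B - σ n * A) * (p k - p l + x (step k n) - x (step l n)) ≠ 0 := by
    intro n h
    have := hω n
    rw [h, zero_mul] at this
    exact hpq (by linear_combination -this)
  refine ⟨h0, fun n => ?_⟩
  have e : ∀ m, (p k ^ 2 - p l ^ 2) *
      (1 / ((B - σ m * A) * (p k - p l + x (step k m) - x (step l m))))
      = (B + σ m * A) * (p k + p l + x (step l (step k m)) - x m) := by
    intro m
    rw [← hω m, mul_one_div, div_eq_iff (h0 m)]
    ring
  have c1 : step l (step k (step l n)) = step l (step l (step k n)) := by rw [step_comm k l n]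
  beta_reduce
  rw [mul_sub (p k ^ 2 - p l ^ 2), e, e, hl n, hk n, hl (step k n), hk n, c1,
    step_comm k l (step k n)]
  ring

theorem sum_step (n : Fin N → ℤ) (k : Fin N) : ∑ r, step k n r = (∑ r, n r) + 1 := by
  simp [step, Finset.sum_add_distrib]

theorem sum_mul_step (p : Fin N → ℂ) (n : Fin N → ℤ) (k : Fin N) :
    ∑ r, p r * (step k n r : ℂ) = (∑ r, p r * (n r : ℂ)) + p k := by
  have : ∀ r, p r * (step k n r : ℂ) = p r * (n r : ℂ) + if r = k then p k else 0 := by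
    intro r
    by_cases h : r = k
    · subst h; simp [step]; ring
    · simp [step, h]
  simp [this, Finset.sum_add_distrib]

theorem sq_neg_one_zpow (m : ℤ) : ((-1 : ℂ) ^ m) ^ 2 = 1 := by
  rw [← zpow_natCast, ← zpow_mul, mul_comm, zpow_mul]; simp

theorem neg_one_zpow_succ (m : ℤ) : (-1 : ℂ) ^ (m + 1) = -(-1 : ℂ) ^ m := by
  rw [zpow_add₀ (by norm_num)]; simp

/-- One shift flips the parity sign σ, two shifts restore it. Hence ũ−û carries the factor B−σA and
u−û̃ the factor −(B+σA), and the product of these is −1. -/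
theorem kdVConclusion_of_mul {p : Fin N → ℂ} {x : (Fin N → ℤ) → ℂ}
    (hx : ∀ k l n, (p k + p l + x (step l (step k n)) - x n)
      * (p k - p l + x (step k n) - x (step l n)) = p k ^ 2 - p l ^ 2) : KdVConclusion p x := by
  intro A B ρ₀ ρ₁ hAB u hu k l
  have d1 : ∀ n, u (step k n) - u (step l n)
      = (B - (-1 : ℂ) ^ (∑ r, n r) * A) * (p k - p l + x (step k n) - x (step l n)) := by
    intro n
    rw [hu, hu, sum_step, sum_step, neg_one_zpow_succ, sum_mul_step, sum_mul_step]
    ring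
  have d2 : ∀ n, u n - u (step l (step k n)) = -(B + (-1 : ℂ) ^ (∑ r, n r) * A)
      * (p k + p l + x (step l (step k n)) - x n) := by
    intro n
    rw [hu, hu (step l (step k n)), sum_step, sum_step, neg_one_zpow_succ, neg_one_zpow_succ,
      sum_mul_step, sum_mul_step]
    ring
  refine ⟨fun n => ?_, d1, fun hpq => ⟨?_, ?_⟩⟩
  · rw [d1, d2]
    have s := sq_neg_one_zpow (∑ r, n r)
    have e : (B + (-1 : ℂ) ^ (∑ r, n r) * A) * (B - (-1 : ℂ) ^ (∑ r, n r) * A) = 1 := by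
      linear_combination -A ^ 2 * s - hAB
    linear_combination -(hx k l n) - (p k + p l + x (step l (step k n)) - x n)
      * (p k - p l + x (step k n) - x (step l n)) * e
  · simp_rw [d1]
    exact solvesLatticeKdV_of_mul (σ := fun n => (-1 : ℂ) ^ (∑ r, n r)) (hx k l) hpq hAB
      (fun n => sq_neg_one_zpow _) (fun n => by rw [sum_step, neg_one_zpow_succ])
      (fun n => by rw [sum_step, neg_one_zpow_succ])
  -- The parity of `n k + n l` flips under a single shift only when the directions are distinct.
  · have hkl : k ≠ l := fun h => hpq (by rw [h])
    refine solvesLatticeKdV_of_mul (σ := fun n => (-1 : ℂ) ^ (n k + n l)) (hx k l) hpq hAB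
      (fun n => sq_neg_one_zpow _) (fun n => ?_) (fun n => ?_)
    · rw [step_apply_self, step_apply_of_ne hkl, ← neg_one_zpow_succ]; congr 1; ring
    · rw [step_apply_self, step_apply_of_ne hkl.symm, ← neg_one_zpow_succ]; congr 1; ring

/-- A solution of the linear problem whose coefficient does not depend on `ζ` and which has an
expansion `1 + x / ζ + o(1 / ζ)` along a filter at infinity. -/
theorem linear_coeff_of_expansion {p : Fin N → ℂ} {F : Filter ℂ} [F.NeBot]
    (hF : F ≤ Bornology.cobounded ℂ) {Lam : (Fin N → ℤ) → ℂ → ℂ} {x : (Fin N → ℤ) → ℂ}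
    (hx : ∀ n, Tendsto (fun ζ => ζ * (Lam n ζ - 1)) F (𝓝 (x n))) {k l : Fin N} {n : Fin N → ℤ}
    {V : ℂ} (hV : ∀ᶠ ζ in F, (p l + ζ) * Lam (step l (step k n)) ζ - V * Lam (step k n) ζ
      + (p k - ζ) * Lam n ζ = 0) :
    V = p k + p l + x (step l (step k n)) - x n := by
  have hinv : Tendsto (fun ζ : ℂ => ζ⁻¹) F (𝓝 0) := tendsto_inv₀_cobounded.mono_left hF
  have hne : ∀ᶠ ζ in F, ζ ≠ 0 := by
    refine hF ?_
    filter_upwards [Bornology.isBounded_singleton (x := (0 : ℂ))] with ζ hζ using hζ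
  have one : ∀ n, Tendsto (Lam n) F (𝓝 1) := by
    intro n
    have h := (hinv.mul (hx n)).const_add 1
    simp only [zero_mul, add_zero] at h
    refine h.congr' ?_
    filter_upwards [hne] with ζ hζ
    field_simp
    ring
  -- The terms of order ζ cancel between Λ̂̃ and Λ; the grouping isolates the order-zero part of the
  -- linear relation.
  have lim : Tendsto (fun ζ => p l * Lam (step l (step k n)) ζ
      + ζ * (Lam (step l (step k n)) ζ - 1) + p k * Lam n ζ - ζ * (Lam n ζ - 1)
      - V * Lam (step k n) ζ) F
      (𝓝 (p l * 1 + x (step l (step k n)) + p k * 1 - x n - V * 1)) :=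
    ((((one _).const_mul _).add (hx _)).add ((one _).const_mul _) |>.sub (hx _)).sub
      ((one _).const_mul _)
  have zero : Tendsto (fun ζ => p l * Lam (step l (step k n)) ζ
      + ζ * (Lam (step l (step k n)) ζ - 1) + p k * Lam n ζ - ζ * (Lam n ζ - 1)
      - V * Lam (step k n) ζ) F (𝓝 0) := by
    refine tendsto_const_nhds.congr' ?_
    filter_upwards [hV] with ζ hζ
    linear_combination -hζ
  have := tendsto_nhds_unique lim zero
  linear_combination -this

/-- The two mirror relations share Λ̂̃, Λ and V, so their difference is (q−p)(Λ̂̃−Λ) = V(Λ̃−Λ̂).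
Multiplied by ζ, its limit is the claim, with V as found at order zero. -/
theorem mul_eq_of_expansion {p : Fin N → ℂ} {F : Filter ℂ} [F.NeBot]
    {Lam : (Fin N → ℤ) → ℂ → ℂ} {x : (Fin N → ℤ) → ℂ}
    (hx : ∀ n, Tendsto (fun ζ => ζ * (Lam n ζ - 1)) F (𝓝 (x n)))
    (hV : ∀ k l n, ∀ᶠ ζ in F, (p l + ζ) * Lam (step l (step k n)) ζ
      - (p k + p l + x (step l (step k n)) - x n) * Lam (step k n) ζ
      + (p k - ζ) * Lam n ζ = 0) (k l : Fin N) (n : Fin N → ℤ) :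
    (p k + p l + x (step l (step k n)) - x n)
      * (p k - p l + x (step k n) - x (step l n)) = p k ^ 2 - p l ^ 2 := by
  have h1 := ((hx (step l (step k n))).sub (hx n)).const_mul (p l - p k)
  have h2 := ((hx (step k n)).sub (hx (step l n))).const_mul
    (p k + p l + x (step l (step k n)) - x n)
  have h3 := tendsto_nhds_unique (h1.congr' (by
    filter_upwards [hV k l n, hV l k n] with ζ a b
    rw [← step_comm] at b
    linear_combination ζ * (a - b))) h2
  linear_combination -h3

/-! ## Solutions of `Q3_δ` -/

/-- On a solution of `Q3_δ`, two partial derivatives of the quad polynomial are proportional to the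
factors of the biquadratics. -/
theorem q3_derivatives_proportional {p q P Q a b δ x y z w X Y Z : ℂ}
    (hP : P ^ 2 = (p ^ 2 - a ^ 2) * (p ^ 2 - b ^ 2)) (hP0 : P ≠ 0)
    (hQ : Q ^ 2 = (q ^ 2 - a ^ 2) * (q ^ 2 - b ^ 2)) (hQ0 : Q ≠ 0)
    (h : P * (x * z + y * w) - Q * (x * y + z * w)
      - (p ^ 2 - q ^ 2) * ((y * z + x * w) + δ ^ 2 / (4 * P * Q)) = 0)
    (hX : X ≠ 0) (hY : Y ≠ 0) (hXY : X * Y = biquadratic a b δ p P x y)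
    (hXZ : X * Z = biquadratic a b δ q Q x z) :
    (Q * w - (q ^ 2 - p ^ 2) * y - P * x) * Z = (P * w - (p ^ 2 - q ^ 2) * z - Q * x) * Y := by
  unfold biquadratic at hXY hXZ
  -- In this degenerate case P = ±Q and the quad polynomial factorises. If the factor x ∓ w
  -- vanishes, both sides vanish; if z ∓ y does, then Z = ±Y and both sides agree.
  by_cases hpq : p ^ 2 = q ^ 2
  · rw [hpq, sub_self, zero_mul, sub_zero] at h
    rw [hpq] at hXY
    have hPQ : P ^ 2 = Q ^ 2 := by rw [hP, hQ, hpq]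
    rcases sq_eq_sq_iff_eq_or_eq_neg.mp hPQ with rfl | rfl
    · have h1 : P * ((x - w) * (z - y)) = 0 := by linear_combination h
      rcases mul_eq_zero.mp ((mul_eq_zero.mp h1).resolve_left hP0) with h2 | h2
      · rw [hpq]; linear_combination (-P * (Z - Y)) * h2
      · have hzy : z = y := by linear_combination h2
        subst hzy
        have : Y = Z := mul_left_cancel₀ hX (by rw [hXY, hXZ])
        rw [this, hpq]
    · have h1 : Q * ((x + w) * (z + y)) = 0 := by linear_combination -h
      rcases mul_eq_zero.mp ((mul_eq_zero.mp h1).resolve_left hQ0) with h2 | h2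
      · rw [hpq]; linear_combination (Q * (Z + Y)) * h2
      · have hzy : z = -y := by linear_combination h2
        subst hzy
        have : Y = -Z := by
          apply mul_left_cancel₀ hX
          have e : δ ^ 2 / (4 * -Q) = -(δ ^ 2 / (4 * Q)) := by rw [mul_neg, div_neg]
          rw [e] at hXY
          linear_combination hXY + hXZ
        rw [this, hpq]; ring
  · have hpq' : p ^ 2 - q ^ 2 ≠ 0 := sub_ne_zero.mpr hpq
    -- The second factor is the derivative of the quad polynomial in w; the first is minus its
    -- derivative in z. On solutions, the product of the derivatives in two variables is a multiple
    -- of the biquadratic in the other two. As XY ≠ 0, the common factor cannot vanish.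
    have e1 : (Q * w - (q ^ 2 - p ^ 2) * y - P * x) * (P * y - Q * z - (p ^ 2 - q ^ 2) * x)
        = (p ^ 2 - q ^ 2) * (X * Y) := by
      have d : Q * (δ ^ 2 / (4 * P * Q)) = δ ^ 2 / (4 * P) := by field_simp
      rw [hXY]
      linear_combination Q * h + (p ^ 2 - q ^ 2) * d - x * y * hP + x * y * hQ
    have e2 : (P * w - (p ^ 2 - q ^ 2) * z - Q * x) * (P * y - Q * z - (p ^ 2 - q ^ 2) * x)
        = (p ^ 2 - q ^ 2) * (X * Z) := by
      have d : P * (δ ^ 2 / (4 * P * Q)) = δ ^ 2 / (4 * Q) := by field_simp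
      rw [hXZ]
      linear_combination P * h + (p ^ 2 - q ^ 2) * d - x * z * hP + x * z * hQ
    have hD : P * y - Q * z - (p ^ 2 - q ^ 2) * x ≠ 0 := by
      intro h0
      rw [h0, mul_zero] at e1
      exact mul_ne_zero hpq' (mul_ne_zero hX hY) e1.symm
    apply mul_left_cancel₀ hD
    linear_combination Z * e1 - Y * e2

theorem linCoeff_symm {p P : Fin N → ℂ} {a b δ : ℂ} {u U : (Fin N → ℤ) → ℂ}
    (hP : ∀ k, P k ^ 2 = (p k ^ 2 - a ^ 2) * (p k ^ 2 - b ^ 2)) (hP0 : ∀ k, P k ≠ 0)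
    (hu : IsQ3Solution p P δ u) (hU : IsFactorisation p P a b δ u U) (hU0 : ∀ n, U n ≠ 0)
    (k l : Fin N) (n : Fin N → ℤ) : linCoeff p P u U k l n = linCoeff p P u U l k n := by
  unfold linCoeff
  rw [← step_comm k l n, div_eq_div_iff (hU0 _) (hU0 _)]
  exact q3_derivatives_proportional (hP k) (hP0 k) (hP l) (hP0 l) (hu k l n) (hU0 n) (hU0 _)
    (hU k n) (hU l n)

theorem IsReducedLaxSolution.components {p P : Fin N → ℂ} {b δ : ℂ} {u U : (Fin N → ℤ) → ℂ}
    (hU0 : ∀ n, U n ≠ 0) {ζ : ℂ} {Ψ : (Fin N → ℤ) → Fin 2 → ℂ}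
    (h : IsReducedLaxSolution p P b δ u U ζ Ψ) (k : Fin N) (n : Fin N → ℤ) :
    (p k + ζ) * Ψ (step k n) 0 * U n
      = (P k * u (step k n) - (p k ^ 2 - b ^ 2) * u n) * Ψ n 0 + (ζ ^ 2 - b ^ 2) * Ψ n 1 ∧
    (p k + ζ) * Ψ (step k n) 1 * U n
      = (U n * U (step k n) - δ ^ 2 * (p k ^ 2 - b ^ 2) / (4 * P k * (ζ ^ 2 - b ^ 2))) * Ψ n 0
        + ((p k ^ 2 - b ^ 2) * u (step k n) - P k * u n) * Ψ n 1 := by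
  have a := h k n
  rw [laxMatrix, Matrix.smul_mulVec] at a
  constructor
  · have a1 := congrFun a 0
    rw [Pi.smul_apply, Pi.smul_apply, smul_eq_mul, smul_eq_mul, one_div_mul_eq_div,
      eq_div_iff (hU0 n)] at a1
    simpa [Matrix.mulVec, dotProduct, Fin.sum_univ_two] using a1
  · have a1 := congrFun a 1
    rw [Pi.smul_apply, Pi.smul_apply, smul_eq_mul, smul_eq_mul, one_div_mul_eq_div,
      eq_div_iff (hU0 n)] at a1
    simpa [Matrix.mulVec, dotProduct, Fin.sum_univ_two] using a1

/-- Elimination of the second Lax component: two consecutive steps are combined with the equation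
for Ψ₁, and the remaining term in Ψ₀ collapses by the biquadratic factorisation and the curve
equation for P². -/
theorem IsReducedLaxSolution.linear {p P : Fin N → ℂ} {a b δ : ℂ} {u U : (Fin N → ℤ) → ℂ}
    (hP : ∀ k, P k ^ 2 = (p k ^ 2 - a ^ 2) * (p k ^ 2 - b ^ 2))
    (hU : IsFactorisation p P a b δ u U) (hU0 : ∀ n, U n ≠ 0) {ζ : ℂ} (hζ : ζ ^ 2 ≠ b ^ 2)
    {Ψ : (Fin N → ℤ) → Fin 2 → ℂ} (h : IsReducedLaxSolution p P b δ u U ζ Ψ) {k : Fin N}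
    (hk : p k + ζ ≠ 0) (l : Fin N) (n : Fin N → ℤ) :
    (p l + ζ) * Ψ (step l (step k n)) 0 + (p k - ζ) * Ψ n 0
      = linCoeff p P u U k l n * Ψ (step k n) 0 := by
  obtain ⟨a1, a2⟩ := h.components hU0 k n
  obtain ⟨a3, -⟩ := h.components hU0 l (step k n)
  have f := hU k n
  unfold biquadratic at f
  unfold linCoeff
  have u0 := hU0 n
  have u1 := hU0 (step k n)
  have hb : ζ ^ 2 - b ^ 2 ≠ 0 := sub_ne_zero.mpr hζ
  -- The δ-term of the Lax matrix, times ζ²−b², is p²−b² times the δ-term of the biquadratic, so the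
  -- two cancel.
  have e1 : δ ^ 2 * (p k ^ 2 - b ^ 2) / (4 * P k * (ζ ^ 2 - b ^ 2)) * (ζ ^ 2 - b ^ 2)
      = δ ^ 2 / (4 * P k) * (p k ^ 2 - b ^ 2) := by
    rw [div_mul_eq_mul_div, mul_comm (4 * P k), mul_comm _ (ζ ^ 2 - b ^ 2),
      mul_div_mul_left _ _ hb]
    ring
  generalize δ ^ 2 * (p k ^ 2 - b ^ 2) / (4 * P k * (ζ ^ 2 - b ^ 2)) = D at *
  generalize δ ^ 2 / (4 * P k) = E at *
  have pk := hP k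
  generalize Ψ (step l (step k n)) 0 = X at *
  generalize Ψ (step k n) 0 = Y at *
  generalize Ψ (step k n) 1 = Y' at *
  generalize Ψ n 0 = Z at *
  generalize Ψ n 1 = Z' at *
  generalize u (step l (step k n)) = w at *
  generalize u (step k n) = y at *
  generalize u n = x at *
  generalize U (step k n) = Uk at *
  generalize U n = Un at *
  apply mul_left_cancel₀ hk
  apply mul_left_cancel₀ u1
  apply mul_left_cancel₀ u0
  have g : Uk * ((p k + ζ) * ((P l * w - (p l ^ 2 - p k ^ 2) * y - P k * x) / Uk * Y))
      = (p k + ζ) * ((P l * w - (p l ^ 2 - p k ^ 2) * y - P k * x) * Y) := by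
    field_simp
  rw [g]
  linear_combination (Un * (p k + ζ)) * a3 + (ζ ^ 2 - b ^ 2) * a2
    - ((p k ^ 2 - b ^ 2) * y - P k * x) * a1 - Z * e1 + (p k ^ 2 - b ^ 2) * Z * f + x * y * Z * pk

theorem IsReducedLaxSolution.linearPair {p P : Fin N → ℂ} {a b δ : ℂ} {u U : (Fin N → ℤ) → ℂ}
    (hP : ∀ k, P k ^ 2 = (p k ^ 2 - a ^ 2) * (p k ^ 2 - b ^ 2)) (hP0 : ∀ k, P k ≠ 0)
    (hu : IsQ3Solution p P δ u)
    (hU : IsFactorisation p P a b δ u U) (hU0 : ∀ n, U n ≠ 0) {ζ : ℂ} (hζ : ζ ^ 2 ≠ b ^ 2)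
    {Ψ : (Fin N → ℤ) → Fin 2 → ℂ} (h : IsReducedLaxSolution p P b δ u U ζ Ψ) {k l : Fin N}
    (hk : p k + ζ ≠ 0) (hl : p l + ζ ≠ 0) :
    LinearPair p ζ k l (linCoeff p P u U k l) (fun n => Ψ n 0) := by
  intro n
  refine ⟨h.linear hP hU hU0 hζ hk l n, ?_⟩
  rw [linCoeff_symm hP hP0 hu hU hU0, step_comm]
  exact h.linear hP hU hU0 hζ hl k n

theorem q3_conclusions {p P : Fin N → ℂ} {a b δ : ℂ} {u U : (Fin N → ℤ) → ℂ}
    (hP : ∀ k, P k ^ 2 = (p k ^ 2 - a ^ 2) * (p k ^ 2 - b ^ 2)) (hP0 : ∀ k, P k ≠ 0)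
    (hu : IsQ3Solution p P δ u)
    (hU : IsFactorisation p P a b δ u U) (hU0 : ∀ n, U n ≠ 0) {ζ : ℂ} {α : Fin N → ℂ}
    {φ : (Fin N → ℤ) → Fin 2 → ℂ} {Lam : (Fin N → ℤ) → ℂ} (hζ : ζ ^ 2 ≠ b ^ 2)
    (hα : ∀ r, α r ^ 2 = p r ^ 2 - ζ ^ 2) (hα0 : ∀ r, α r ≠ 0)
    (hφ : IsLaxSolution p P b δ u U ζ α φ) (hLam : ∀ n, φ n 0 = Lam n * rhoHalf p α ζ n) :
    (∀ k l n, (p l + ζ) * Lam (step l (step k n)) + (p k - ζ) * Lam n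
      = linCoeff p P u U k l n * Lam (step k n)) ∧
    SolvesClosedForm p ζ Lam ∧ MKdVConclusion p α (fun n => φ n 0) := by
  have hp : ∀ r, p r + ζ ≠ 0 := fun r => add_ne_zero_of_sqrt (hα r) (hα0 r)
  have hρ : ∀ n, rhoHalf p α ζ n ≠ 0 := fun n =>
    Finset.prod_ne_zero_iff.mpr fun r _ => zpow_ne_zero _ (div_ne_zero (hp r) (hα0 r))
  have hΨ : IsReducedLaxSolution p P b δ u U ζ (fun n => (rhoHalf p α ζ n)⁻¹ • φ n) := by
    rw [← isLaxSolution_iff p P b δ u U ζ α hα hα0]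
    simpa [smul_smul, mul_inv_cancel₀ (hρ _)] using hφ
  have hL : (fun n => ((rhoHalf p α ζ n)⁻¹ • φ n) 0) = Lam := by
    funext n
    have := hρ n
    rw [Pi.smul_apply, smul_eq_mul, hLam]
    field_simp
  have lin : ∀ k l, LinearPair p ζ k l (linCoeff p P u U k l) Lam := fun k l => by
    have := hΨ.linearPair hP hP0 hu hU hU0 hζ (hp k) (hp l)
    rwa [hL] at this
  have lin' : ∀ k l, ∃ V, LinearPair p ζ k l V Lam := fun k l => ⟨_, lin k l⟩
  refine ⟨fun k l n => (lin k l n).1, solvesClosedForm_of_linearPair lin', ?_⟩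
  simp_rw [hLam]
  exact mKdVConclusion_of_linearPair lin' hα hα0

theorem q3_todaConclusion {p P : Fin N → ℂ} {a b δ : ℂ} {u U : (Fin N → ℤ) → ℂ}
    (hP : ∀ k, P k ^ 2 = (p k ^ 2 - a ^ 2) * (p k ^ 2 - b ^ 2)) (hP0 : ∀ k, P k ≠ 0)
    (hu : IsQ3Solution p P δ u)
    (hU : IsFactorisation p P a b δ u U) (hU0 : ∀ n, U n ≠ 0) {k l : Fin N}
    {Ψ Ω : (Fin N → ℤ) → Fin 2 → ℂ} (hkl : k ≠ l) (hk : p k ≠ 0) (hl : p l ≠ 0)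
    (hpq : p k + p l ≠ 0) (hΨ : IsReducedLaxSolution p P b δ u U (p k) Ψ)
    (hΩ : IsReducedLaxSolution p P b δ u U (p l) Ω) :
    TodaConclusion p k l (fun n => Ψ n 0) (fun n => Ω n 0) := by
  -- The spectral values ζ = p_r avoid the singularity ζ² = b² of the Lax matrix because p_r² = b²
  -- would force P_r = 0.
  have hb : ∀ r, p r ^ 2 ≠ b ^ 2 := fun r h => hP0 r (by
    have := hP r
    rw [h, sub_self, mul_zero] at this
    exact (pow_eq_zero_iff two_ne_zero).mp this)
  have two : ∀ r, p r ≠ 0 → p r + p r ≠ 0 := fun r h => by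
    rw [← two_mul]; exact mul_ne_zero two_ne_zero h
  exact todaConclusion_of_linearPair hkl hpq
    (hΨ.linearPair hP hP0 hu hU hU0 (hb k) (two k hk) (by rwa [add_comm]))
    (hΩ.linearPair hP hP0 hu hU hU0 (hb l) hpq (two l hl))

/-! ## Neumann series of Volterra sum equations -/

/-- The sum of `g` over all `l < i`. -/
noncomputable def tailSum (g : ℤ → ℝ) (i : ℤ) : ℝ := ∑' l : ℤ, if l < i then g l else 0

section Neumann

variable {g : ℤ → ℝ} (hg0 : ∀ l, 0 ≤ g l) (hg : Summable g)
include hg0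

theorem tailSum_nonneg (i : ℤ) : 0 ≤ tailSum g i :=
  tsum_nonneg fun l => by split_ifs <;> simp [hg0]

include hg

theorem summable_tail (i : ℤ) : Summable fun l : ℤ => if l < i then g l else 0 :=
  Summable.of_nonneg_of_le (fun l => by split_ifs <;> simp [hg0])
    (fun l => by split_ifs <;> simp [hg0]) hg

theorem tailSum_succ (i : ℤ) : tailSum g (i + 1) = tailSum g i + g i := by
  have h := (summable_tail hg0 hg i).tsum_add (hasSum_ite_eq i (g i)).summable
  rw [tsum_ite_eq] at h
  unfold tailSum
  rw [← h]
  refine tsum_congr fun l => ?_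
  rcases lt_trichotomy l i with h1 | h1 | h1
  · simp [h1, h1.ne, h1.trans (lt_add_one i)]
  · simp [h1]
  · rw [if_neg (by omega), if_neg (by omega), if_neg (by omega), add_zero]

theorem tailSum_le_tsum (i : ℤ) : tailSum g i ≤ ∑' l, g l :=
  (summable_tail hg0 hg i).tsum_le_tsum (fun l => by split_ifs <;> simp [hg0]) hg

theorem tendsto_tailSum : Tendsto (tailSum g) atBot (𝓝 0) := by
  have h := tendsto_tsum_of_dominated_convergence (𝓕 := atBot)
    (f := fun (i l : ℤ) => if l < i then g l else 0) (g := fun _ => (0 : ℝ)) hg (fun l => ?_)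
    (Eventually.of_forall fun i l => ?_)
  · rw [tsum_zero] at h; exact h
  · refine tendsto_const_nhds.congr' ?_
    filter_upwards [eventually_le_atBot l] with i hi
    rw [if_neg (by omega)]
  · split_ifs <;> simp [hg0, abs_of_nonneg]

/-- Discrete form of ∫ E^k/k! dE = E^{k+1}/(k+1)!, where g is the increment of E = `tailSum g`. The
inequality comes from keeping only the first two terms of the binomial expansion of (E+x)^{k+1}. -/
theorem sum_mul_tailSum_pow_le (k : ℕ) (a : ℤ) (m : ℕ) :
    ∑ l ∈ Finset.Ico a (a + m), g l * (tailSum g l ^ k / k.factorial)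
      ≤ tailSum g (a + m) ^ (k + 1) / (k + 1).factorial := by
  induction m with
  | zero =>
    simp only [Nat.cast_zero, add_zero, Finset.Ico_self, Finset.sum_empty]
    have := tailSum_nonneg hg0 a
    positivity
  | succ m ih =>
    have e : Finset.Ico a (a + ((m + 1 : ℕ) : ℤ)) = insert (a + (m : ℤ)) (Finset.Ico a (a + m)) := by
      ext x
      simp only [Finset.mem_Ico, Finset.mem_insert]
      push_cast
      omega
    rw [e, Finset.sum_insert (by simp)]
    push_cast
    rw [← add_assoc, tailSum_succ hg0 hg]
    set E := tailSum g (a + m)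
    set x := g (a + m)
    have hE : 0 ≤ E := tailSum_nonneg hg0 _
    have hx : 0 ≤ x := hg0 _
    have key : E ^ (k + 1) + (k + 1) * E ^ k * x ≤ (E + x) ^ (k + 1) := by
      clear ih e
      induction k with
      | zero => simp
      | succ k ih =>
        have h1 := mul_le_mul_of_nonneg_right ih (add_nonneg hE hx)
        have h2 : 0 ≤ ((k : ℝ) + 1) * E ^ k * x ^ 2 := by positivity
        rw [pow_succ (E + x)]
        push_cast
        calc _ ≤ (E ^ (k + 1) + (k + 1) * E ^ k * x) * (E + x) := by
              rw [pow_succ E (k + 1), pow_succ E k]; nlinarith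
          _ ≤ _ := h1
    have e2 : x * (E ^ k / k.factorial) = ((k + 1) * E ^ k * x) / (k + 1).factorial := by
      rw [Nat.factorial_succ]; push_cast; field_simp
    rw [e2]
    calc _ ≤ ((k + 1) * E ^ k * x) / (k + 1).factorial + E ^ (k + 1) / (k + 1).factorial := by
          gcongr
      _ = (E ^ (k + 1) + (k + 1) * E ^ k * x) / (k + 1).factorial := by ring
      _ ≤ _ := by gcongr

variable {G : ℤ → ℤ → ℂ} {T : ℕ → ℤ → ℂ} {i₀ : ℤ}
  (hG : ∀ i l, l < i → i ≤ i₀ → ‖G i l‖ ≤ g l) (hT0 : ∀ i, T 0 i = 1)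
  (hT : ∀ k i, T (k + 1) i = ∑' l : ℤ, if l < i then G i l * T k l else 0)
include hG hT0 hT

/-- Iterating a kernel supported on l < i gains the factorial, so no smallness of the majorant is
needed. All indices stay at or below i₀, so the kernel bound is required only there. -/
theorem neumann_term_bound (k : ℕ) : ∀ i ≤ i₀, ‖T k i‖ ≤ tailSum g i ^ k / k.factorial := by
  induction k with
  | zero => intro i _; simp [hT0]
  | succ k ih =>
    intro i hi
    have hle : ∀ l : ℤ, ‖if l < i then G i l * T k l else 0‖
        ≤ if l < i then g l * (tailSum g l ^ k / k.factorial) else 0 := by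
      intro l
      split_ifs with h
      · rw [norm_mul]
        exact mul_le_mul (hG i l h hi) (ih l (h.le.trans hi)) (norm_nonneg _) (hg0 l)
      · simp
    -- A bound uniform over finite sets gives summability and the bound on the sum at once; the
    -- indices that contribute lie in a finite interval ending at i.
    have hfin : ∀ u : Finset ℤ, ∑ l ∈ u, ‖if l < i then G i l * T k l else 0‖
        ≤ tailSum g i ^ (k + 1) / (k + 1).factorial := by
      intro u
      obtain ⟨a, ha⟩ : ∃ a : ℤ, a ≤ i ∧ ∀ l ∈ u, a ≤ l := by
        obtain ⟨b, hb⟩ := u.bddBelow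
        exact ⟨min b i, min_le_right _ _, fun l hl => (min_le_left _ _).trans (hb hl)⟩
      obtain ⟨m, rfl⟩ : ∃ m : ℕ, i = a + m := ⟨(i - a).toNat, by omega⟩
      refine le_trans ?_ (sum_mul_tailSum_pow_le hg0 hg k a m)
      calc ∑ l ∈ u, ‖if l < a + m then G (a + m) l * T k l else 0‖
          ≤ ∑ l ∈ u, if l < a + m then g l * (tailSum g l ^ k / k.factorial) else 0 :=
            Finset.sum_le_sum fun l _ => hle l
        _ = ∑ l ∈ u.filter (· < a + (m : ℤ)), g l * (tailSum g l ^ k / k.factorial) :=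
            (Finset.sum_filter _ _).symm
        _ ≤ _ := by
            refine Finset.sum_le_sum_of_subset_of_nonneg (fun l hl => ?_) fun l _ _ => ?_
            · rw [Finset.mem_filter] at hl
              exact Finset.mem_Ico.mpr ⟨ha.2 l hl.1, hl.2⟩
            · have := tailSum_nonneg hg0 l
              have := hg0 l
              positivity
    have hs := summable_of_sum_le (fun l => norm_nonneg _) hfin
    rw [hT]
    exact (norm_tsum_le_tsum_norm hs).trans (hs.tsum_le_of_sum_le hfin)

theorem neumann_term_bound' (k : ℕ) (i : ℤ) (hi : i ≤ i₀) :
    ‖T k i‖ ≤ (∑' l, g l) ^ k / k.factorial :=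
  (neumann_term_bound hg0 hg hG hT0 hT k i hi).trans (by
    have := tailSum_nonneg hg0 i
    have := tailSum_le_tsum hg0 hg i
    gcongr)

theorem neumann_summand_bound (k : ℕ) (i l : ℤ) (hi : i ≤ i₀) :
    ‖if l < i then G i l * T k l else 0‖ ≤ g l * ((∑' l, g l) ^ k / k.factorial) := by
  have h0 : 0 ≤ ∑' l, g l := tsum_nonneg hg0
  split_ifs with h
  · rw [norm_mul]
    exact mul_le_mul (hG i l h hi) (neumann_term_bound' hg0 hg hG hT0 hT k l (h.le.trans hi))
      (norm_nonneg _) (hg0 l)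
  · have := hg0 l
    rw [norm_zero]; positivity

theorem neumann_summand_summable (k : ℕ) (i : ℤ) (hi : i ≤ i₀) :
    Summable fun l : ℤ => ‖if l < i then G i l * T k l else 0‖ :=
  Summable.of_nonneg_of_le (fun _ => norm_nonneg _)
    (fun l => neumann_summand_bound hg0 hg hG hT0 hT k i l hi) (hg.mul_right _)

theorem neumann_summable (i : ℤ) (hi : i ≤ i₀) : Summable fun k => ‖T k i‖ :=
  Summable.of_nonneg_of_le (fun _ => norm_nonneg _)
    (fun k => neumann_term_bound' hg0 hg hG hT0 hT k i hi) (Real.summable_pow_div_factorial _)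

/-- Summing the recursion over k and exchanging the two sums, which is allowed because the double
series is dominated by a product of convergent series. -/
theorem neumann_eq (i : ℤ) (hi : i ≤ i₀) :
    ∑' k, T k i = 1 + ∑' l : ℤ, if l < i then G i l * ∑' k, T k l else 0 := by
  rw [(neumann_summable hg0 hg hG hT0 hT i hi).of_norm.tsum_eq_zero_add, hT0]
  congr 1
  simp_rw [hT]
  have hs : Summable (Function.uncurry fun (k : ℕ) (l : ℤ) => if l < i then G i l * T k l else 0) := by
    have h1 : Summable fun q : ℕ × ℤ => (∑' l, g l) ^ q.1 / q.1.factorial * g q.2 :=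
      (Real.summable_pow_div_factorial _).mul_of_nonneg hg
        (fun k => by have : 0 ≤ ∑' l, g l := tsum_nonneg hg0
                     simp only [Pi.zero_apply]; positivity) hg0
    refine Summable.of_norm_bounded h1 fun q => ?_
    rw [mul_comm]
    exact neumann_summand_bound hg0 hg hG hT0 hT q.1 i q.2 hi
  rw [← hs.tsum_comm]
  refine tsum_congr fun l => ?_
  split_ifs
  · rw [tsum_mul_left]
  · simp

/-- This is what makes Λ → 1 both as i → −∞ and as ζ → ∞: in either limit the relevant tail sum
tends to 0. -/
theorem norm_neumann_sub_one_le (i : ℤ) (hi : i ≤ i₀) :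
    ‖∑' k, T k i - 1‖ ≤ Real.exp (tailSum g i) - 1 := by
  have hs := neumann_summable hg0 hg hG hT0 hT i hi
  have he := Real.summable_pow_div_factorial (tailSum g i)
  have h1 : ∑' k, tailSum g i ^ k / k.factorial = Real.exp (tailSum g i) := by
    rw [Real.exp_eq_exp_ℝ, NormedSpace.exp_eq_tsum_div]
  rw [hs.of_norm.tsum_eq_zero_add, hT0, add_sub_cancel_left, ← h1, he.tsum_eq_zero_add]
  simp only [pow_zero, Nat.factorial_zero, Nat.cast_one, div_one, add_sub_cancel_left]
  have hs' := (summable_nat_add_iff 1).mpr hs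
  exact (norm_tsum_le_tsum_norm hs').trans (hs'.tsum_le_tsum
    (fun k => neumann_term_bound hg0 hg hG hT0 hT (k + 1) i hi) ((summable_nat_add_iff 1).mpr he))

end Neumann

/-! ## Direct scattering -/

theorem add_ne_zero_of_notMem_regionP {K : ℝ} {p : Fin N → ℂ} {s : ℤ → Fin N} (hp : ∀ r, p r ≠ 0)
    {ζ : ℂ} (hζ : ζ ∉ regionP K p s) (j : ℤ) : p (s j) + ζ ≠ 0 := by
  intro h
  apply hζ
  refine ⟨s j, ⟨j, rfl⟩, ?_⟩
  have e : p (s j) - ζ = 2 * p (s j) := by linear_combination -h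
  rw [h, e]
  simpa using hp _

theorem norm_ratio_le {K : ℝ} {p : Fin N → ℂ} {s : ℤ → Fin N} (hp : ∀ r, p r ≠ 0)
    {ζ : ℂ} (hζ : ζ ∉ regionP K p s) (j : ℤ) : ‖(p (s j) - ζ) / (p (s j) + ζ)‖ ≤ K := by
  have h := add_ne_zero_of_notMem_regionP hp hζ j
  rw [norm_div, div_le_iff₀ (norm_pos_iff.mpr h)]
  by_contra! h1
  exact hζ ⟨s j, ⟨j, rfl⟩, h1⟩

open Classical in
/-- A bound for `1 / |p_r + ζ|` over the directions of the staircase. -/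
noncomputable def invBound (p : Fin N → ℂ) (s : ℤ → Fin N) (ζ : ℂ) : ℝ :=
  ∑ r, if r ∈ Set.range s then ‖1 / (p r + ζ)‖ else 0

theorem norm_inv_le_invBound (p : Fin N → ℂ) (s : ℤ → Fin N) (ζ : ℂ) (j : ℤ) :
    ‖1 / (p (s j) + ζ)‖ ≤ invBound p s ζ := by
  classical
  have := Finset.single_le_sum (f := fun r => if r ∈ Set.range s then ‖1 / (p r + ζ)‖ else 0)
    (fun r _ => by split_ifs <;> positivity) (Finset.mem_univ (s j))
  rw [if_pos ⟨j, rfl⟩] at this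
  unfold invBound
  convert this

theorem invBound_nonneg (p : Fin N → ℂ) (s : ℤ → Fin N) (ζ : ℂ) : 0 ≤ invBound p s ζ :=
  Finset.sum_nonneg fun r _ => by split_ifs <;> positivity

theorem continuousAt_invBound {K : ℝ} {p : Fin N → ℂ} {s : ℤ → Fin N} (hp : ∀ r, p r ≠ 0)
    {ζ : ℂ} (hζ : ζ ∉ regionP K p s) : ContinuousAt (invBound p s) ζ := by
  unfold invBound
  refine tendsto_finsetSum _ fun r _ => ?_
  by_cases h : r ∈ Set.range s
  · obtain ⟨j, rfl⟩ := h
    have := add_ne_zero_of_notMem_regionP hp hζ j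
    simp only [Set.mem_range_self, if_true]
    exact ContinuousAt.norm (ContinuousAt.div (by fun_prop) (by fun_prop) this)
  · simp only [h, if_false]
    exact tendsto_const_nhds

theorem tendsto_add_div_cobounded (a b : ℂ) :
    Tendsto (fun ζ : ℂ => (b + ζ) / (a + ζ)) (Bornology.cobounded ℂ) (𝓝 1) := by
  have hinv : Tendsto (fun ζ : ℂ => ζ⁻¹) (Bornology.cobounded ℂ) (𝓝 0) := tendsto_inv₀_cobounded
  have h := ((hinv.const_mul b).add_const 1).div ((hinv.const_mul a).add_const 1) (by simp)
  simp only [mul_zero, zero_add, div_one] at h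
  refine h.congr' ?_
  have hne : ∀ᶠ ζ in Bornology.cobounded ℂ, ζ ≠ 0 := by
    filter_upwards [Bornology.isBounded_singleton (x := (0 : ℂ))] with ζ hζ using hζ
  filter_upwards [hne] with ζ hζ
  have e1 : b * ζ⁻¹ + 1 = (b + ζ) * ζ⁻¹ := by field_simp
  have e2 : a * ζ⁻¹ + 1 = (a + ζ) * ζ⁻¹ := by field_simp
  simp only [Pi.div_apply]
  rw [e1, e2, mul_div_mul_right _ _ (inv_ne_zero hζ)]

theorem tendsto_one_div_cobounded (a : ℂ) :
    Tendsto (fun ζ : ℂ => 1 / (a + ζ)) (Bornology.cobounded ℂ) (𝓝 0) := by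
  simp only [one_div]
  exact tendsto_inv₀_cobounded.comp (tendsto_const_add_cobounded a)

theorem tendsto_invBound (p : Fin N → ℂ) (s : ℤ → Fin N) :
    Tendsto (invBound p s) (Bornology.cobounded ℂ) (𝓝 0) := by
  have e : (0 : ℝ) = ∑ _r : Fin N, (0 : ℝ) := by simp
  unfold invBound
  conv => rhs; rw [e]
  refine tendsto_finsetSum _ fun r _ => ?_
  split_ifs
  · simpa using (tendsto_one_div_cobounded (p r)).norm
  · exact tendsto_const_nhds

/-- Each of at most N summands tends to 1 after multiplication by |ζ|; the extra 1 is slack. -/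
theorem eventually_norm_mul_invBound_le (p : Fin N → ℂ) (s : ℤ → Fin N) :
    ∀ᶠ ζ in Bornology.cobounded ℂ, ‖ζ‖ * invBound p s ζ ≤ N + 1 := by
  classical
  have h : Tendsto (fun ζ : ℂ => ∑ r : Fin N, ‖(0 + ζ) / (p r + ζ)‖) (Bornology.cobounded ℂ)
      (𝓝 (∑ _r : Fin N, ‖(1 : ℂ)‖)) :=
    tendsto_finsetSum _ fun r _ => (tendsto_add_div_cobounded (p r) 0).norm
  have h2 := h.eventually (ge_mem_nhds (show _ < (N : ℝ) + 1 by simp))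
  filter_upwards [h2] with ζ hζ
  refine le_trans ?_ hζ
  unfold invBound
  rw [Finset.mul_sum]
  refine Finset.sum_le_sum fun r _ => ?_
  split_ifs
  · rw [← norm_mul, zero_add, mul_one_div]
  · rw [mul_zero]; positivity

/-- The kernel is a sum of i−l terms, each at most C·K^{i−l}. The count i−l is the source of the
factor 1+|i| in the summability condition. -/
theorem norm_kernelF_le {K C : ℝ} (hK : 1 ≤ K) {p : Fin N → ℂ} {s : ℤ → Fin N} {ζ : ℂ}
    (h1 : ∀ j, ‖(p (s j) - ζ) / (p (s j) + ζ)‖ ≤ K) (h2 : ∀ j, ‖1 / (p (s j) + ζ)‖ ≤ C)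
    {i l : ℤ} (hli : l < i) : ‖kernelF p s i l ζ‖ ≤ C * ((i - l : ℤ) * K ^ (i - l).toNat) := by
  have hC : 0 ≤ C := (norm_nonneg _).trans (h2 0)
  unfold kernelF
  refine (norm_sum_le _ _).trans ?_
  have : ∀ r ∈ Finset.Ico l i, ‖1 / (p (s r) + ζ) *
      ∏ j ∈ Finset.Ico l r, ((p (s j) - ζ) / (p (s j) + ζ))‖ ≤ C * K ^ (i - l).toNat := by
    intro r hr
    rw [Finset.mem_Ico] at hr
    rw [norm_mul, norm_prod]
    refine mul_le_mul (h2 r) ?_ (Finset.prod_nonneg fun _ _ => norm_nonneg _) hC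
    calc _ ≤ ∏ j ∈ Finset.Ico l r, K := Finset.prod_le_prod (fun _ _ => norm_nonneg _) fun j _ => h1 j
      _ = K ^ (r - l).toNat := by simp
      _ ≤ _ := pow_le_pow_right₀ hK (by omega)
  refine (Finset.sum_le_sum this).trans (le_of_eq ?_)
  rw [Finset.sum_const, Int.card_Ico, nsmul_eq_mul]
  have : (((i - l).toNat : ℕ) : ℝ) = ((i - l : ℤ) : ℝ) := by
    exact_mod_cast congrArg (Int.cast : ℤ → ℝ) (Int.toNat_of_nonneg (by omega : 0 ≤ i - l))
  rw [this]; ring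

/-- The weight of the summability condition. -/
noncomputable def weight (K : ℝ) (υ : ℤ → ℂ) (l : ℤ) : ℝ :=
  ‖υ l‖ * K ^ l.natAbs * (1 + |(l : ℝ)|)

theorem weight_nonneg {K : ℝ} (hK : 1 ≤ K) (υ : ℤ → ℂ) (l : ℤ) : 0 ≤ weight K υ l := by
  unfold weight; positivity

/-- Below a fixed m one has i−l ≤ m+|l|, so the growth of the kernel separates into a constant
depending on m and the weight at l. -/
theorem growth_le {K : ℝ} (hK : 1 ≤ K) (υ : ℤ → ℂ) {i l : ℤ} {m : ℕ} (hl : l < i) (hi : i ≤ m) :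
    ((i - l : ℤ) * K ^ (i - l).toNat) * ‖υ l‖ ≤ (1 + m) * K ^ m * weight K υ l := by
  have a : K ^ (i - l).toNat ≤ K ^ m * K ^ l.natAbs := by
    rw [← pow_add]
    exact pow_le_pow_right₀ hK (by omega)
  have b : ((i - l : ℤ) : ℝ) ≤ (1 + m) * (1 + |(l : ℝ)|) := by
    have h1 : (i : ℝ) ≤ m := by exact_mod_cast hi
    have h2 := neg_abs_le (l : ℝ)
    have h3 := abs_nonneg (l : ℝ)
    have h4 : (0 : ℝ) ≤ m := Nat.cast_nonneg _
    push_cast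
    nlinarith
  have c : (0 : ℝ) ≤ ((i - l : ℤ) : ℝ) := by exact_mod_cast (by omega : 0 ≤ i - l)
  unfold weight
  calc _ ≤ ((1 + m) * (1 + |(l : ℝ)|) * (K ^ m * K ^ l.natAbs)) * ‖υ l‖ := by gcongr
    _ = _ := by ring

section Jost

variable {K : ℝ} {p : Fin N → ℂ} {s : ℤ → Fin N} {υ : ℤ → ℂ} {ζ : ℂ}

theorem norm_kernel_mul_le {C : ℝ} (hK : 1 ≤ K) (hp : ∀ r, p r ≠ 0) (hζ : ζ ∉ regionP K p s)
    (hC : invBound p s ζ ≤ C) (m : ℕ) (i l : ℤ) (hl : l < i) (hi : i ≤ (m : ℤ)) :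
    ‖kernelF p s i l ζ * υ l‖ ≤ C * ((1 + m) * K ^ m) * weight K υ l := by
  have h1 := norm_kernelF_le hK (norm_ratio_le hp hζ)
    (fun j => (norm_inv_le_invBound p s ζ j).trans hC) hl
  have hC0 : 0 ≤ C := (invBound_nonneg _ _ _).trans hC
  rw [norm_mul]
  calc _ ≤ C * ((i - l : ℤ) * K ^ (i - l).toNat) * ‖υ l‖ := by gcongr
    _ = C * (((i - l : ℤ) * K ^ (i - l).toNat) * ‖υ l‖) := by ring
    _ ≤ C * ((1 + m) * K ^ m * weight K υ l) := mul_le_mul_of_nonneg_left (growth_le hK υ hl hi) hC0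
    _ = _ := by ring

/-- The majorant of the kernel for `i ≤ m`. -/
noncomputable def majorant (K : ℝ) (υ : ℤ → ℂ) (C : ℝ) (m : ℕ) (l : ℤ) : ℝ :=
  C * ((1 + m) * K ^ m) * weight K υ l

theorem majorant_nonneg {C : ℝ} (hK : 1 ≤ K) (hC : 0 ≤ C) (υ : ℤ → ℂ) (m : ℕ) (l : ℤ) :
    0 ≤ majorant K υ C m l := by
  have := weight_nonneg hK υ l
  unfold majorant
  positivity

theorem summable_majorant (hυ : WeightedSummable K υ) (C : ℝ) (m : ℕ) :
    Summable (majorant K υ C m) := Summable.mul_left _ hυ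

theorem tsum_majorant (C : ℝ) (m : ℕ) :
    ∑' l, majorant K υ C m l = C * ((1 + m) * K ^ m * ∑' l, weight K υ l) := by
  unfold majorant
  rw [tsum_mul_left, mul_assoc]

theorem jost_eq (hK : 1 ≤ K) (hp : ∀ r, p r ≠ 0) (hυ : WeightedSummable K υ)
    (hζ : ζ ∉ regionP K p s) (i : ℤ) :
    jost p s υ i ζ
      = 1 + ∑' l : ℤ, if l < i then kernelF p s i l ζ * υ l * jost p s υ l ζ else 0 :=
  neumann_eq (majorant_nonneg hK (invBound_nonneg p s ζ) υ i.toNat) (summable_majorant hυ _ _)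
    (norm_kernel_mul_le hK hp hζ le_rfl i.toNat) (fun _ => rfl) (fun _ _ => rfl) i
    (Int.self_le_toNat i)

theorem summable_jost_summand (hK : 1 ≤ K) (hp : ∀ r, p r ≠ 0) (hυ : WeightedSummable K υ)
    (hζ : ζ ∉ regionP K p s) (k : ℕ) (i : ℤ) :
    Summable fun l : ℤ =>
      ‖if l < i then kernelF p s i l ζ * υ l * jostTerm p s υ ζ k l else 0‖ :=
  neumann_summand_summable (majorant_nonneg hK (invBound_nonneg p s ζ) υ i.toNat)
    (summable_majorant hυ _ _) (norm_kernel_mul_le hK hp hζ le_rfl i.toNat) (fun _ => rfl)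
    (fun _ _ => rfl) k i (Int.self_le_toNat i)

theorem summable_jostTerm (hK : 1 ≤ K) (hp : ∀ r, p r ≠ 0) (hυ : WeightedSummable K υ)
    (hζ : ζ ∉ regionP K p s) (i : ℤ) : Summable fun k : ℕ => ‖jostTerm p s υ ζ k i‖ :=
  neumann_summable (majorant_nonneg hK (invBound_nonneg p s ζ) υ i.toNat)
    (summable_majorant hυ _ _) (norm_kernel_mul_le hK hp hζ le_rfl i.toNat) (fun _ => rfl)
    (fun _ _ => rfl) i (Int.self_le_toNat i)

theorem norm_jost_sub_one_le (hK : 1 ≤ K) (hp : ∀ r, p r ≠ 0) (hυ : WeightedSummable K υ)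
    (hζ : ζ ∉ regionP K p s) (m : ℕ) (i : ℤ) (hi : i ≤ m) :
    ‖jost p s υ i ζ - 1‖ ≤ Real.exp (tailSum (majorant K υ (invBound p s ζ) m) i) - 1 :=
  norm_neumann_sub_one_le (majorant_nonneg hK (invBound_nonneg p s ζ) υ m)
    (summable_majorant hυ _ _) (norm_kernel_mul_le hK hp hζ le_rfl m) (fun _ => rfl)
    (fun _ _ => rfl) i hi

theorem norm_jost_sub_one_le' (hK : 1 ≤ K) (hp : ∀ r, p r ≠ 0) (hυ : WeightedSummable K υ)
    (hζ : ζ ∉ regionP K p s) (m : ℕ) (i : ℤ) (hi : i ≤ m) :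
    ‖jost p s υ i ζ - 1‖
      ≤ Real.exp (invBound p s ζ * ((1 + m) * K ^ m * ∑' l, weight K υ l)) - 1 := by
  refine (norm_jost_sub_one_le hK hp hυ hζ m i hi).trans ?_
  have := tailSum_le_tsum (majorant_nonneg hK (invBound_nonneg p s ζ) υ m)
    (summable_majorant hυ _ _) i
  rw [tsum_majorant] at this
  gcongr

theorem tendsto_jost_atBot (hK : 1 ≤ K) (hp : ∀ r, p r ≠ 0) (hυ : WeightedSummable K υ)
    (hζ : ζ ∉ regionP K p s) : Tendsto (fun i : ℤ => jost p s υ i ζ) atBot (𝓝 1) := by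
  rw [tendsto_iff_norm_sub_tendsto_zero]
  have h := ((Real.continuous_exp.tendsto 0).comp (tendsto_tailSum
    (majorant_nonneg hK (invBound_nonneg p s ζ) υ 0) (summable_majorant hυ _ _))).sub_const 1
  simp only [Real.exp_zero, sub_self] at h
  refine squeeze_zero' (Eventually.of_forall fun _ => norm_nonneg _) ?_ h
  filter_upwards [eventually_le_atBot 0] with i hi
  exact norm_jost_sub_one_le hK hp hυ hζ 0 i hi

/-! ### The scattering problem -/

theorem kernelF_self (p : Fin N → ℂ) (s : ℤ → Fin N) (i : ℤ) (ζ : ℂ) : kernelF p s i i ζ = 0 := by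
  simp [kernelF]

theorem kernelF_succ (p : Fin N → ℂ) (s : ℤ → Fin N) {i l : ℤ} (h : l ≤ i) (ζ : ℂ) :
    kernelF p s (i + 1) l ζ = kernelF p s i l ζ
      + 1 / (p (s i) + ζ) * ∏ j ∈ Finset.Ico l i, ((p (s j) - ζ) / (p (s j) + ζ)) := by
  unfold kernelF
  rw [← Finset.insert_Ico_right_eq_Ico_add_one h, Finset.sum_insert (by simp), add_comm]

/-- The kernel is a discrete Green's function: in i it solves the free scattering equation, it
vanishes at i = l, and it is normalised at i = l+1 by `kernelF_succ_self`. -/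
theorem kernelF_recurrence (hne : ∀ j, p (s j) + ζ ≠ 0) {i l : ℤ} (h : l ≤ i) :
    (p (s (i + 1)) + ζ) * kernelF p s (i + 2) l ζ
      - (p (s i) + p (s (i + 1))) * kernelF p s (i + 1) l ζ
      + (p (s i) - ζ) * kernelF p s i l ζ = 0 := by
  rw [show i + 2 = i + 1 + 1 by ring, kernelF_succ p s (by omega : l ≤ i + 1), kernelF_succ p s h,
    ← Finset.insert_Ico_right_eq_Ico_add_one h, Finset.prod_insert (by simp)]
  have h1 := hne i
  have h2 := hne (i + 1)
  field_simp
  ring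

theorem kernelF_succ_self (hne : ∀ j, p (s j) + ζ ≠ 0) (i : ℤ) :
    (p (s i) + ζ) * kernelF p s (i + 1) i ζ = 1 := by
  rw [kernelF_succ p s le_rfl, kernelF_self]
  have h1 := hne i
  simp
  field_simp

theorem summable_kernel_mul_jost (hK : 1 ≤ K) (hp : ∀ r, p r ≠ 0) (hυ : WeightedSummable K υ)
    (hζ : ζ ∉ regionP K p s) (i : ℤ) :
    Summable fun l : ℤ => if l < i then kernelF p s i l ζ * υ l * jost p s υ l ζ else 0 := by
  set m := i.toNat
  have hm : i ≤ m := Int.self_le_toNat i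
  set X := Real.exp (invBound p s ζ * ((1 + m) * K ^ m * ∑' l, weight K υ l))
  have hg := majorant_nonneg hK (invBound_nonneg p s ζ) υ m
  refine Summable.of_norm_bounded ((summable_majorant hυ (invBound p s ζ) m).mul_right X)
    fun l => ?_
  split_ifs with h
  · rw [norm_mul]
    refine mul_le_mul (norm_kernel_mul_le hK hp hζ le_rfl m i l h hm) ?_ (norm_nonneg _) (hg l)
    have h1 := norm_jost_sub_one_le' hK hp hυ hζ m l (h.le.trans hm)
    have h2 := norm_add_le (jost p s υ l ζ - 1) 1
    rw [sub_add_cancel, norm_one] at h2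
    linarith
  · rw [norm_zero]
    exact mul_nonneg (hg l) (Real.exp_nonneg _)

/-- Apply the free operator to the Volterra equation. It annihilates the constant 1 and, since the
kernel is a Green's function, only the term l = i+1 survives in the sum. -/
theorem jost_scattering (hK : 1 ≤ K) (hp : ∀ r, p r ≠ 0) (hυ : WeightedSummable K υ)
    (hζ : ζ ∉ regionP K p s) (i : ℤ) :
    (p (s (i + 1)) + ζ) * jost p s υ (i + 2) ζ
      - (p (s i) + p (s (i + 1)) + υ (i + 1)) * jost p s υ (i + 1) ζ
      + (p (s i) - ζ) * jost p s υ i ζ = 0 := by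
  have hne := add_ne_zero_of_notMem_regionP hp hζ
  have S := summable_kernel_mul_jost hK hp hυ hζ
  have e : ∀ l : ℤ, (p (s (i + 1)) + ζ)
        * (if l < i + 2 then kernelF p s (i + 2) l ζ * υ l * jost p s υ l ζ else 0)
      - (p (s i) + p (s (i + 1)))
        * (if l < i + 1 then kernelF p s (i + 1) l ζ * υ l * jost p s υ l ζ else 0)
      + (p (s i) - ζ) * (if l < i then kernelF p s i l ζ * υ l * jost p s υ l ζ else 0)
      = if l = i + 1 then υ (i + 1) * jost p s υ (i + 1) ζ else 0 := by
    intro l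
    rcases lt_trichotomy l (i + 1) with h | h | h
    · have r := kernelF_recurrence hne (show l ≤ i by omega)
      -- At l = i the condition l < i fails but the kernel vanishes, so the recurrence still
      -- applies.
      have h0 : (if l < i then kernelF p s i l ζ * υ l * jost p s υ l ζ else 0)
          = kernelF p s i l ζ * υ l * jost p s υ l ζ := by
        split_ifs with h1
        · rfl
        · rw [show l = i by omega, kernelF_self]; ring
      rw [h0, if_pos (by omega), if_pos h, if_neg h.ne]
      linear_combination υ l * jost p s υ l ζ * r
    · subst h
      rw [if_pos (by omega), if_neg (by omega), if_neg (by omega), if_pos rfl]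
      have r := kernelF_succ_self hne (i + 1)
      rw [show i + 1 + 1 = i + 2 by ring] at r
      linear_combination υ (i + 1) * jost p s υ (i + 1) ζ * r
    · rw [if_neg (by omega), if_neg (by omega), if_neg (by omega), if_neg h.ne']
      ring
  have t := (((S (i + 2)).mul_left (p (s (i + 1)) + ζ)).sub
    ((S (i + 1)).mul_left (p (s i) + p (s (i + 1))))).tsum_add ((S i).mul_left (p (s i) - ζ))
  rw [((S (i + 2)).mul_left (p (s (i + 1)) + ζ)).tsum_sub
    ((S (i + 1)).mul_left (p (s i) + p (s (i + 1)))), tsum_mul_left, tsum_mul_left, tsum_mul_left,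
    tsum_congr e, tsum_ite_eq] at t
  have j2 := jost_eq hK hp hυ hζ (i + 2)
  have j1 := jost_eq hK hp hυ hζ (i + 1)
  have j0 := jost_eq hK hp hυ hζ i
  linear_combination (p (s (i + 1)) + ζ) * j2 - (p (s i) + p (s (i + 1))) * j1
    + (p (s i) - ζ) * j0 - t

/-! ### Holomorphy and the behaviour at infinity -/

theorem differentiableOn_kernelF {V : Set ℂ} (hne : ∀ ζ ∈ V, ∀ j, p (s j) + ζ ≠ 0) (i l : ℤ) :
    DifferentiableOn ℂ (kernelF p s i l) V := by
  unfold kernelF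
  refine DifferentiableOn.fun_sum fun r _ => DifferentiableOn.mul ?_ ?_
  · exact DifferentiableOn.div (by fun_prop) (by fun_prop) fun ζ h => hne ζ h r
  · exact DifferentiableOn.fun_finsetProd fun j _ => DifferentiableOn.div (by fun_prop) (by fun_prop) fun ζ h => hne ζ h j

theorem differentiableOn_jost (hK : 1 ≤ K) (hp : ∀ r, p r ≠ 0) (hυ : WeightedSummable K υ)
    (i : ℤ) : DifferentiableOn ℂ (jost p s υ i) (closure (regionP K p s))ᶜ := by
  intro ζ₀ hζ₀
  apply DifferentiableAt.differentiableWithinAt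
  have h0 : ζ₀ ∉ regionP K p s := fun h => hζ₀ (subset_closure h)
  -- The slack makes one majorant valid on a whole neighbourhood, as Weierstrass' theorem on series
  -- of holomorphic functions requires.
  set C := invBound p s ζ₀ + 1
  have hev : ∀ᶠ ζ in 𝓝 ζ₀, invBound p s ζ ≤ C ∧ ζ ∉ regionP K p s := by
    refine ((continuousAt_invBound hp h0).eventually (ge_mem_nhds (lt_add_one _))).and ?_
    filter_upwards [isClosed_closure.isOpen_compl.mem_nhds hζ₀] with ζ h h1 using h (subset_closure h1)
  obtain ⟨V, hV, hVo, hζV⟩ := mem_nhds_iff.mp hev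
  have hC : 0 ≤ C := add_nonneg (invBound_nonneg _ _ _) zero_le_one
  set m := i.toNat
  have hg := majorant_nonneg hK hC υ m
  have hgs := summable_majorant hυ C m
  have hker : ∀ ζ ∈ V, ∀ i l : ℤ, l < i → i ≤ (m : ℤ) →
      ‖kernelF p s i l ζ * υ l‖ ≤ majorant K υ C m l := fun ζ h i l =>
    norm_kernel_mul_le hK hp (hV h).2 (hV h).1 m i l
  have hterm : ∀ k : ℕ, ∀ i ≤ (m : ℤ), DifferentiableOn ℂ (fun ζ => jostTerm p s υ ζ k i) V := by
    intro k
    induction k with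
    | zero => intro i _; exact differentiableOn_const 1
    | succ k ih =>
      intro i hi
      refine Complex.differentiableOn_tsum_of_summable_norm
        (hgs.mul_right ((∑' l, majorant K υ C m l) ^ k / k.factorial)) (fun l => ?_) hVo
        fun l ζ hζ => neumann_summand_bound hg hgs (hker ζ hζ) (fun _ => rfl) (fun _ _ => rfl)
          k i l hi
      split_ifs with h
      · exact ((differentiableOn_kernelF (fun ζ hζ => add_ne_zero_of_notMem_regionP hp (hV hζ).2)
          i l).mul_const _).mul (ih l (h.le.trans hi))
      · exact differentiableOn_const 0
  have hj : DifferentiableOn ℂ (jost p s υ i) V :=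
    Complex.differentiableOn_tsum_of_summable_norm (Real.summable_pow_div_factorial _)
      (fun k => hterm k i (Int.self_le_toNat i)) hVo
      fun k ζ hζ => neumann_term_bound' hg hgs (hker ζ hζ) (fun _ => rfl) (fun _ _ => rfl)
        k i (Int.self_le_toNat i)
  exact hj.differentiableAt (hVo.mem_nhds hζV)

theorem tendsto_mul_kernelF (p : Fin N → ℂ) (s : ℤ → Fin N) (i l : ℤ) :
    Tendsto (fun ζ => ζ * kernelF p s i l ζ) (Bornology.cobounded ℂ)
      (𝓝 (∑ r ∈ Finset.Ico l i, 1 * ∏ _j ∈ Finset.Ico l r, (-1 : ℂ))) := by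
  unfold kernelF
  simp_rw [Finset.mul_sum, ← mul_assoc]
  refine tendsto_finsetSum _ fun r _ => Tendsto.mul ?_ (tendsto_finsetProd _ fun j _ => ?_)
  · refine (tendsto_add_div_cobounded (p (s r)) 0).congr fun ζ => ?_
    rw [zero_add, mul_one_div]
  · refine (tendsto_add_div_cobounded (p (s j)) (-p (s j))).neg.congr fun ζ => ?_
    rw [← neg_div]; congr 1; ring

/-- Multiply the Volterra equation by ζ and pass to the limit under the sum: ζF has a limit for each
l, and Λ(l) → 1. -/
theorem exists_tendsto_mul_jost_sub_one (hK : 1 ≤ K) (hp : ∀ r, p r ≠ 0)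
    (hυ : WeightedSummable K υ) (i : ℤ) :
    ∃ x : ℂ, Tendsto (fun ζ => ζ * (jost p s υ i ζ - 1))
      (Bornology.cobounded ℂ ⊓ 𝓟 (regionP K p s)ᶜ) (𝓝 x) := by
  set m := i.toNat
  have hm : i ≤ m := Int.self_le_toNat i
  set F := Bornology.cobounded ℂ ⊓ 𝓟 (regionP K p s)ᶜ
  have hF : F ≤ Bornology.cobounded ℂ := inf_le_left
  have hmem : ∀ᶠ ζ in F, ζ ∉ regionP K p s := mem_inf_of_right (mem_principal_self _)
  set D : ℝ := (1 + m) * K ^ m * ∑' l, weight K υ l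
  have hexp : Tendsto (fun ζ => Real.exp (invBound p s ζ * D) - 1) F (𝓝 0) := by
    have h := ((Real.continuous_exp.tendsto _).comp
      (((tendsto_invBound p s).mul_const D).mono_left hF)).sub_const 1
    simpa using h
  have hone : ∀ l < i, Tendsto (fun ζ => jost p s υ l ζ) F (𝓝 1) := by
    intro l hl
    rw [tendsto_iff_norm_sub_tendsto_zero]
    refine squeeze_zero' (Eventually.of_forall fun _ => norm_nonneg _) ?_ hexp
    filter_upwards [hmem] with ζ hζ
    exact norm_jost_sub_one_le' hK hp hυ hζ m l (hl.le.trans hm)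
  have hlim : Tendsto (fun ζ => ∑' l : ℤ, if l < i then
      ζ * kernelF p s i l ζ * υ l * jost p s υ l ζ else 0) F
      (𝓝 (∑' l : ℤ, if l < i then
        (∑ r ∈ Finset.Ico l i, 1 * ∏ _j ∈ Finset.Ico l r, (-1 : ℂ)) * υ l * 1 else 0)) := by
    refine tendsto_tsum_of_dominated_convergence
      ((summable_majorant hυ ((N : ℝ) + 1) m).mul_right 2) (fun l => ?_) ?_
    · split_ifs with h
      · exact (((tendsto_mul_kernelF p s i l).mono_left hF).mul_const _).mul (hone l h)
      · exact tendsto_const_nhds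
    -- Near infinity |ζ| times the kernel bound is at most N+1 times the weight, and |Λ| ≤ 2 because
    -- |Λ−1| ≤ 1; these are the two constants in the dominating series.
    · filter_upwards [hmem, hF (eventually_norm_mul_invBound_le p s),
        hexp.eventually (ge_mem_nhds one_pos)] with ζ hζ h1 h2 l
      have hg := majorant_nonneg hK (by positivity : (0 : ℝ) ≤ N + 1) υ m l
      split_ifs with h
      · have h3 := norm_kernel_mul_le (υ := υ) hK hp hζ le_rfl m i l h hm
        have h4 := norm_jost_sub_one_le' hK hp hυ hζ m l (h.le.trans hm)
        have h5 := norm_add_le (jost p s υ l ζ - 1) 1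
        rw [sub_add_cancel, norm_one] at h5
        rw [norm_mul, mul_assoc ζ, norm_mul]
        refine mul_le_mul ?_ (by linarith) (norm_nonneg _) hg
        have hw := weight_nonneg hK υ l
        calc _ ≤ ‖ζ‖ * (invBound p s ζ * ((1 + m) * K ^ m) * weight K υ l) := by gcongr
          _ = (‖ζ‖ * invBound p s ζ) * (((1 + m) * K ^ m) * weight K υ l) := by ring
          _ ≤ (N + 1) * (((1 + m) * K ^ m) * weight K υ l) := by gcongr
          _ = majorant K υ (N + 1) m l := by unfold majorant; ring
      · rw [norm_zero]; positivity
  refine ⟨_, hlim.congr' ?_⟩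
  filter_upwards [hmem] with ζ hζ
  rw [jost_eq hK hp hυ hζ i, add_sub_cancel_left, ← tsum_mul_left]
  refine tsum_congr fun l => ?_
  split_ifs
  · ring
  · simp

theorem jostExists (hK : 1 ≤ K) (hp : ∀ r, p r ≠ 0) (hυ : WeightedSummable K υ) :
    JostExists K p s υ :=
  ⟨fun _ hζ => ⟨summable_jost_summand hK hp hυ hζ, summable_jostTerm hK hp hυ hζ,
    jost_scattering hK hp hυ hζ, tendsto_jost_atBot hK hp hυ hζ⟩,
    differentiableOn_jost hK hp hυ, exists_tendsto_mul_jost_sub_one hK hp hυ⟩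

end Jost

/-! ### Solutions of the linear problem with an expansion at infinity -/

/-- The coefficient p_k + p_l + x̂̃ − x is invariant under exchange of k and l, so the relation for
(l, k) is the missing half of the pair. -/
theorem linearPair_of_linear {p : Fin N → ℂ} {ζ : ℂ} {L x : (Fin N → ℤ) → ℂ}
    (h : ∀ k l n, (p l + ζ) * L (step l (step k n))
      - (p k + p l + x (step l (step k n)) - x n) * L (step k n) + (p k - ζ) * L n = 0)
    (k l : Fin N) :
    LinearPair p ζ k l (fun n => p k + p l + x (step l (step k n)) - x n) L := by
  refine fun n => ⟨by linear_combination h k l n, ?_⟩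
  have h1 := h l k n
  rw [← step_comm k l n] at h1
  linear_combination h1

theorem linearProblem_conclusions {K : ℝ} {p : Fin N → ℂ} {s : ℤ → Fin N} {υ : ℤ → ℂ}
    {Lam : (Fin N → ℤ) → ℂ → ℂ} {x : (Fin N → ℤ) → ℂ} (hL : IsLinearProblemJost K p s υ Lam)
    (hb : ¬ Bornology.IsBounded (regionP K p s)ᶜ)
    (hx : ∀ n, Tendsto (fun ζ => ζ * (Lam n ζ - 1))
      (Bornology.cobounded ℂ ⊓ 𝓟 (regionP K p s)ᶜ) (𝓝 (x n))) :
    (∀ ζ, ζ ∉ regionP K p s →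
      SolvesClosedForm p ζ (fun n => Lam n ζ) ∧ MKdVConclusionFor p ζ (fun n => Lam n ζ)) ∧
    (∀ k l : Fin N, k ≠ l → p k + p l ≠ 0 → p k ∉ regionP K p s → p l ∉ regionP K p s →
      TodaConclusion p k l (fun n => Lam n (p k)) (fun n => Lam n (p l))) ∧
    KdVConclusion p x := by
  -- Unboundedness of the complement of 𝒫 makes the filter at infinity nontrivial, hence limits
  -- along it unique.
  have hne : (Bornology.cobounded ℂ ⊓ 𝓟 (regionP K p s)ᶜ).NeBot := by
    rw [← frequently_mem_iff_neBot]
    intro h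
    apply hb
    rw [Bornology.isBounded_def]
    exact h
  have hmem : ∀ᶠ ζ in Bornology.cobounded ℂ ⊓ 𝓟 (regionP K p s)ᶜ, ζ ∉ regionP K p s :=
    mem_inf_of_right (mem_principal_self _)
  have lin : ∀ ζ ∉ regionP K p s, ∀ k l n, (p l + ζ) * Lam (step l (step k n)) ζ
      - (p k + p l + x (step l (step k n)) - x n) * Lam (step k n) ζ
      + (p k - ζ) * Lam n ζ = 0 := by
    intro ζ hζ k l n
    obtain ⟨V, hV⟩ := hL.2 k l n
    rw [← linear_coeff_of_expansion inf_le_left hx (hmem.mono hV)]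
    exact hV ζ hζ
  have pair := fun ζ hζ => linearPair_of_linear (L := fun n => Lam n ζ) (lin ζ hζ)
  refine ⟨fun ζ hζ => ⟨solvesClosedForm_of_linearPair fun k l => ⟨_, pair ζ hζ k l⟩,
    fun α hα hα0 => mKdVConclusion_of_linearPair (fun k l => ⟨_, pair ζ hζ k l⟩) hα hα0⟩,
    fun k l hkl hpq hk hl => todaConclusion_of_linearPair hkl hpq (pair _ hk k l) (pair _ hl k l),
    kdVConclusion_of_mul (mul_eq_of_expansion hx fun k l n => hmem.mono fun ζ hζ => lin ζ hζ k l n)⟩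

open MeasureTheory

/-! ## Cauchy integrals -/

/-- Multiplication with a continuous function of a bounded location preserves integrability. -/
theorem integrable_mul_continuousOn {T X : Type*} [MeasurableSpace T] [TopologicalSpace X]
    [MeasurableSpace X] [BorelSpace X] {μ : Measure T}
    {z : T → X} (hz : Measurable z) {S : Set X} (hS : IsCompact S) (hmem : ∀ t, z t ∈ S)
    {b : T → ℂ} (hb : Integrable b μ) {g : X → ℂ} (hg : ContinuousOn g S) :
    Integrable (fun t => b t * g (z t)) μ := by
  obtain ⟨C, hC⟩ := hS.exists_bound_of_continuousOn hg
  have h1 : Measurable (fun t => S.domRestrict g ⟨z t, hmem t⟩) :=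
    (continuousOn_iff_continuous_domRestrict.mp hg).measurable.comp (hz.subtype_mk)
  exact hb.mul_bdd (c := C) h1.aestronglyMeasurable (Eventually.of_forall fun t => hC _ (hmem t))

/-- The sources `z t ∈ S` of a Cauchy integral `∫ b t / (z t + ζ)`, and a set `D` of arguments `ζ`
at which it is regular. -/
structure CauchySources {T : Type*} [MeasurableSpace T] (z : T → ℂ) (S D : Set ℂ) : Prop where
  measurable : Measurable z
  isCompact : IsCompact S
  mem : ∀ t, z t ∈ S
  subset : S ⊆ D
  separated : ∀ ζ ∈ D, -ζ ∉ S

section Cauchy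

variable {T : Type*} [MeasurableSpace T] {μ : Measure T} {z : T → ℂ} {S D : Set ℂ}

theorem CauchySources.add_ne_zero (h : CauchySources z S D) {σ ζ : ℂ} (hσ : σ ∈ S) (hζ : ζ ∈ D) :
    σ + ζ ≠ 0 := fun h0 => h.separated ζ hζ (by rwa [← eq_neg_of_add_eq_zero_left h0])

theorem CauchySources.add_ne_zero' (h : CauchySources z S D) {ζ : ℂ} (hζ : ζ ∈ D) (t : T) :
    z t + ζ ≠ 0 := h.add_ne_zero (h.mem t) hζ

theorem CauchySources.integrable_mul (h : CauchySources z S D) {b : T → ℂ} (hb : Integrable b μ)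
    {g : ℂ → ℂ} (hg : ContinuousOn g S) : Integrable (fun t => b t * g (z t)) μ :=
  integrable_mul_continuousOn h.measurable h.isCompact h.mem hb hg

theorem CauchySources.integrable_div (h : CauchySources z S D) {b : T → ℂ} (hb : Integrable b μ)
    {ζ : ℂ} (hζ : ζ ∈ D) : Integrable (fun t => b t / (z t + ζ)) μ := by
  have : ContinuousOn (fun σ => (σ + ζ)⁻¹) S :=
    ContinuousOn.inv₀ (by fun_prop) fun σ hσ => h.add_ne_zero hσ hζ
  exact h.integrable_mul hb this

/-- From (a+ζ)/(z+ζ) = 1 + (a−z)/(z+ζ): a factor in ζ is traded for a factor in the source plus the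
total mass. -/
theorem CauchySources.add_mul_integral (h : CauchySources z S D) {b : T → ℂ} (hb : Integrable b μ)
    {ζ : ℂ} (hζ : ζ ∈ D) (a : ℂ) :
    (a + ζ) * ∫ t, b t / (z t + ζ) ∂μ
      = (∫ t, b t ∂μ) + ∫ t, b t * (a - z t) / (z t + ζ) ∂μ := by
  have hb' : Integrable (fun t => b t * (a - z t)) μ :=
    h.integrable_mul (g := fun σ => a - σ) hb (by fun_prop)
  rw [← integral_const_mul, ← integral_add hb (h.integrable_div hb' hζ)]
  refine integral_congr_ae (Eventually.of_forall fun t => ?_)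
  have := h.add_ne_zero' hζ t
  simp only
  field_simp
  ring

theorem CauchySources.sub_mul_integral (h : CauchySources z S D) {b : T → ℂ} (hb : Integrable b μ)
    {ζ : ℂ} (hζ : ζ ∈ D) (a : ℂ) :
    (a - ζ) * ∫ t, b t / (z t + ζ) ∂μ
      = (∫ t, b t * (a + z t) / (z t + ζ) ∂μ) - ∫ t, b t ∂μ := by
  have hb' : Integrable (fun t => b t * (a + z t)) μ :=
    h.integrable_mul (g := fun σ => a + σ) hb (by fun_prop)
  rw [← integral_const_mul, ← integral_sub (h.integrable_div hb' hζ) hb]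
  refine integral_congr_ae (Eventually.of_forall fun t => ?_)
  have := h.add_ne_zero' hζ t
  simp only
  field_simp
  ring

/-- The compact S stays at positive distance from −ζ for ζ near ζ₀, which dominates the
differentiated integrand. -/
theorem CauchySources.differentiableAt (h : CauchySources z S D) {b : T → ℂ}
    (hb : Integrable b μ) {ζ₀ : ℂ} (hζ₀ : ζ₀ ∈ D) :
    DifferentiableAt ℂ (fun ζ => ∫ t, b t / (z t + ζ) ∂μ) ζ₀ := by
  obtain ⟨ε, hε, hsep⟩ : ∃ ε > 0, ∀ ζ ∈ Metric.ball ζ₀ ε, ∀ σ ∈ S, ε ≤ ‖σ + ζ‖ := by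
    have hcl : IsClosed S := h.isCompact.isClosed
    obtain ⟨δ, hδ, hball⟩ := Metric.isOpen_iff.mp hcl.isOpen_compl (-ζ₀) (h.separated ζ₀ hζ₀)
    refine ⟨δ / 2, by positivity, fun ζ hζ σ hσ => ?_⟩
    rw [mem_ball_iff_norm] at hζ
    by_contra! hlt
    refine hball (a := σ) ?_ hσ
    rw [mem_ball_iff_norm]
    calc ‖σ - -ζ₀‖ = ‖(σ + ζ) - (ζ - ζ₀)‖ := by congr 1; ring
      _ ≤ ‖σ + ζ‖ + ‖ζ - ζ₀‖ := norm_sub_le _ _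
      _ < δ := by linarith
  have hne : ∀ ζ ∈ Metric.ball ζ₀ ε, ∀ σ ∈ S, σ + ζ ≠ 0 := fun ζ hζ σ hσ h0 => by
    have := hsep ζ hζ σ hσ
    rw [h0, norm_zero] at this
    linarith
  have meas : ∀ ζ ∈ Metric.ball ζ₀ ε, ∀ k : ℕ, Integrable (fun t => b t * ((z t + ζ) ^ k)⁻¹) μ :=
    fun ζ hζ k => h.integrable_mul (g := fun σ => ((σ + ζ) ^ k)⁻¹) hb
      (ContinuousOn.inv₀ (by fun_prop) fun σ hσ => pow_ne_zero _ (hne ζ hζ σ hσ))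
  have h0 := Metric.mem_ball_self (x := ζ₀) hε
  refine (hasDerivAt_integral_of_dominated_loc_of_deriv_le (s := Metric.ball ζ₀ ε)
    (F := fun ζ t => b t / (z t + ζ)) (F' := fun ζ t => -(b t * ((z t + ζ) ^ 2)⁻¹))
    (bound := fun t => ‖b t‖ * (ε ^ 2)⁻¹)
    (Metric.ball_mem_nhds _ hε) ?_ ?_ (meas ζ₀ h0 2).neg.aestronglyMeasurable ?_
    (hb.norm.mul_const _) ?_).2.differentiableAt
  · filter_upwards [Metric.ball_mem_nhds ζ₀ hε] with ζ hζ
    simpa [div_eq_mul_inv] using (meas ζ hζ 1).aestronglyMeasurable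
  · simpa [div_eq_mul_inv] using meas ζ₀ h0 1
  · refine Eventually.of_forall fun t ζ hζ => ?_
    rw [norm_neg, norm_mul, norm_inv, norm_pow]
    have := hsep ζ hζ _ (h.mem t)
    gcongr
  · refine Eventually.of_forall fun t ζ hζ => ?_
    have hd := (((hasDerivAt_id ζ).const_add (z t)).inv (hne ζ hζ _ (h.mem t))).const_mul (b t)
    have e : b t * (-1 / (z t + ζ) ^ 2) = -(b t * ((z t + ζ) ^ 2)⁻¹) := by ring
    simp only [id] at hd
    rw [e] at hd
    exact hd.congr_of_eventuallyEq (Eventually.of_forall fun y => div_eq_mul_inv _ _)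

theorem CauchySources.tendsto_mul_integral (h : CauchySources z S D) {b : T → ℂ}
    (hb : Integrable b μ) (hD : ∀ᶠ ζ in Bornology.cobounded ℂ, ζ ∈ D) :
    Tendsto (fun ζ => ζ * ∫ t, b t / (z t + ζ) ∂μ) (Bornology.cobounded ℂ)
      (𝓝 (∫ t, b t ∂μ)) := by
  obtain ⟨M, hM⟩ := h.isCompact.isBounded.exists_norm_le
  have hlim : Tendsto (fun ζ : ℂ => (∫ t, ‖b t‖ ∂μ) * (M * (‖ζ‖ - M)⁻¹)) (Bornology.cobounded ℂ)
      (𝓝 ((∫ t, ‖b t‖ ∂μ) * (M * 0))) := by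
    refine ((tendsto_inv_atTop_zero.comp ?_).const_mul M).const_mul _
    exact tendsto_atTop_add_const_right _ (-M) tendsto_norm_cobounded_atTop
  rw [mul_zero, mul_zero] at hlim
  rw [tendsto_iff_norm_sub_tendsto_zero]
  refine squeeze_zero' (Eventually.of_forall fun _ => norm_nonneg _) ?_ hlim
  filter_upwards [hD, tendsto_norm_cobounded_atTop.eventually_gt_atTop M] with ζ hζ hgt
  have e := h.add_mul_integral hb hζ 0
  rw [zero_add] at e
  rw [e, add_sub_cancel_left]
  have hb' : Integrable (fun t => b t * (0 - z t)) μ :=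
    h.integrable_mul (g := fun σ => 0 - σ) hb (by fun_prop)
  refine (norm_integral_le_integral_norm _).trans ?_
  rw [← integral_mul_const]
  refine integral_mono (h.integrable_div hb' hζ).norm (hb.norm.mul_const _) fun t => ?_
  simp only
  rw [zero_sub, norm_div, norm_mul, norm_neg, mul_div_assoc, div_eq_mul_inv]
  have h1 := hM _ (h.mem t)
  have h2 : ‖ζ‖ - M ≤ ‖z t + ζ‖ := by
    have := norm_sub_le (z t + ζ) (z t)
    rw [add_sub_cancel_left] at this
    linarith
  have h3 : 0 < ‖ζ‖ - M := by linarith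
  have h4 : 0 ≤ M := (norm_nonneg _).trans h1
  gcongr

/-- Fubini and the partial fractions 1/((s+ζ)(t−ζ)) = (1/(s+ζ) + 1/(t−ζ))/(s+t), antisymmetrised in
the two sources. The denominator s+t does not vanish because S ⊆ D. -/
theorem CauchySources.integral_mul_integral_sub [SFinite μ] (h : CauchySources z S D)
    {a b : T → ℂ} (ha : Integrable a μ) (hb : Integrable b μ) {ζ : ℂ} (h1 : ζ ∈ D) (h2 : -ζ ∈ D) :
    (∫ t, a t / (z t + ζ) ∂μ) * (∫ t, b t / (z t + -ζ) ∂μ)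
      - (∫ t, b t / (z t + ζ) ∂μ) * (∫ t, a t / (z t + -ζ) ∂μ)
    = (∫ t, a t * ((1 / (z t + ζ) - 1 / (z t + -ζ)) * ∫ t', b t' / (z t' + z t) ∂μ) ∂μ)
      - ∫ t, b t * ((1 / (z t + ζ) - 1 / (z t + -ζ)) * ∫ t', a t' / (z t' + z t) ∂μ) ∂μ := by
  have hab := ha.mul_prod hb
  have key : ∀ g : ℂ × ℂ → ℂ, ContinuousOn g (S ×ˢ S) →
      Integrable (fun q : T × T => a q.1 * b q.2 * g (z q.1, z q.2)) (μ.prod μ) := fun g hg =>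
    integrable_mul_continuousOn (z := fun q : T × T => (z q.1, z q.2))
      ((h.measurable.comp measurable_fst).prodMk (h.measurable.comp measurable_snd))
      (h.isCompact.prod h.isCompact) (fun q => ⟨h.mem _, h.mem _⟩) hab hg
  have c1 : ∀ ξ ∈ D, ContinuousOn (fun q : ℂ × ℂ => 1 / (q.1 + ξ)) (S ×ˢ S) := fun ξ hξ =>
    ContinuousOn.div (by fun_prop) (by fun_prop) fun q hq => h.add_ne_zero hq.1 hξ
  have c2 : ∀ ξ ∈ D, ContinuousOn (fun q : ℂ × ℂ => 1 / (q.2 + ξ)) (S ×ˢ S) := fun ξ hξ =>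
    ContinuousOn.div (by fun_prop) (by fun_prop) fun q hq => h.add_ne_zero hq.2 hξ
  have c3 : ContinuousOn (fun q : ℂ × ℂ => 1 / (q.1 + q.2)) (S ×ˢ S) :=
    ContinuousOn.div (by fun_prop) (by fun_prop) fun q hq =>
      h.add_ne_zero hq.1 (h.subset hq.2)
  have i1 : Integrable (fun q : T × T => a q.1 * b q.2
      * (1 / (z q.1 + ζ) * (1 / (z q.2 + -ζ)))) (μ.prod μ) := key _ ((c1 ζ h1).mul (c2 _ h2))
  have i2 : Integrable (fun q : T × T => a q.1 * b q.2
      * (1 / (z q.2 + ζ) * (1 / (z q.1 + -ζ)))) (μ.prod μ) := key _ ((c2 ζ h1).mul (c1 _ h2))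
  have i3 : Integrable (fun q : T × T => a q.1 * b q.2 * (1 / (z q.1 + z q.2)
      * (1 / (z q.1 + ζ) - 1 / (z q.1 + -ζ)))) (μ.prod μ) :=
    key _ (c3.mul ((c1 ζ h1).sub (c1 _ h2)))
  have i4 : Integrable (fun q : T × T => a q.1 * b q.2 * (1 / (z q.1 + z q.2)
      * (1 / (z q.2 + ζ) - 1 / (z q.2 + -ζ)))) (μ.prod μ) :=
    key _ (c3.mul ((c2 ζ h1).sub (c2 _ h2)))
  have e1 : (∫ t, a t / (z t + ζ) ∂μ) * (∫ t, b t / (z t + -ζ) ∂μ)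
      = ∫ q : T × T, a q.1 * b q.2 * (1 / (z q.1 + ζ) * (1 / (z q.2 + -ζ))) ∂μ.prod μ := by
    rw [← integral_prod_mul]
    refine integral_congr_ae (Eventually.of_forall fun q => ?_)
    simp only; ring
  have e2 : (∫ t, b t / (z t + ζ) ∂μ) * (∫ t, a t / (z t + -ζ) ∂μ)
      = ∫ q : T × T, a q.1 * b q.2 * (1 / (z q.2 + ζ) * (1 / (z q.1 + -ζ))) ∂μ.prod μ := by
    rw [mul_comm, ← integral_prod_mul]
    refine integral_congr_ae (Eventually.of_forall fun q => ?_)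
    simp only; ring
  have e3 : (∫ t, a t * ((1 / (z t + ζ) - 1 / (z t + -ζ)) * ∫ t', b t' / (z t' + z t) ∂μ) ∂μ)
      = ∫ q : T × T, a q.1 * b q.2 * (1 / (z q.1 + z q.2)
        * (1 / (z q.1 + ζ) - 1 / (z q.1 + -ζ))) ∂μ.prod μ := by
    rw [integral_prod _ i3]
    refine integral_congr_ae (Eventually.of_forall fun t => ?_)
    simp only
    rw [← mul_assoc, ← integral_const_mul]
    refine integral_congr_ae (Eventually.of_forall fun t' => ?_)
    simp only
    rw [add_comm (z t) (z t')]; ring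
  have e4 : (∫ t, b t * ((1 / (z t + ζ) - 1 / (z t + -ζ)) * ∫ t', a t' / (z t' + z t) ∂μ) ∂μ)
      = ∫ q : T × T, a q.1 * b q.2 * (1 / (z q.1 + z q.2)
        * (1 / (z q.2 + ζ) - 1 / (z q.2 + -ζ))) ∂μ.prod μ := by
    rw [integral_prod_symm _ i4]
    refine integral_congr_ae (Eventually.of_forall fun t => ?_)
    simp only
    rw [← mul_assoc, ← integral_const_mul]
    refine integral_congr_ae (Eventually.of_forall fun t' => ?_)
    simp only
    ring
  rw [e1, e2, e3, e4, ← integral_sub i1 i2, ← integral_sub i3 i4]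
  refine integral_congr_ae (Eventually.of_forall fun q => ?_)
  have n1 := h.add_ne_zero' h1 q.1
  have n2 := h.add_ne_zero' h2 q.1
  have n3 := h.add_ne_zero' h1 q.2
  have n4 := h.add_ne_zero' h2 q.2
  have n5 := h.add_ne_zero (h.mem q.1) (h.subset (h.mem q.2))
  simp only
  field_simp
  ring

/-! ## The linear integral equation -/

/-- `f` solves `f(ζ) = 1 + ∫ W f ρ / (z + ζ)` on `D`. -/
def SolvesCauchyEq (μ : Measure T) (z W : T → ℂ) (D : Set ℂ) (r f : ℂ → ℂ) : Prop :=
  Integrable (fun t => W t * f (z t) * r (z t)) μ ∧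
    ∀ ζ ∈ D, f ζ = 1 + ∫ t, W t * f (z t) * r (z t) / (z t + ζ) ∂μ

variable {W : T → ℂ} {r r' r'' f f' f'' : ℂ → ℂ}

theorem SolvesCauchyEq.linear (h : CauchySources z S D) {p q : ℂ}
    (hr' : ∀ σ ∈ S, (p - σ) * r' σ = (p + σ) * r σ)
    (hr'' : ∀ σ ∈ S, (q - σ) * r'' σ = (q + σ) * r' σ)
    (hf : SolvesCauchyEq μ z W D r f) (hf' : SolvesCauchyEq μ z W D r' f')
    (hf'' : SolvesCauchyEq μ z W D r'' f'')
    (huniq : ∀ g, SolvesCauchyEq μ z W D r' g → ∀ ζ ∈ D, g ζ = f' ζ) {ζ : ℂ} (hζ : ζ ∈ D) :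
    (q + ζ) * f'' ζ - (p + q + (∫ t, W t * f'' (z t) * r'' (z t) ∂μ)
      - ∫ t, W t * f (z t) * r (z t) ∂μ) * f' ζ + (p - ζ) * f ζ = 0 := by
  set V := p + q + (∫ t, W t * f'' (z t) * r'' (z t) ∂μ) - ∫ t, W t * f (z t) * r (z t) ∂μ with hV
  -- The subtraction of V−1 rather than V leaves the inhomogeneous term equal to 1, so g solves the
  -- equation of f' and uniqueness gives g = f'. The plane-wave shifts turn the densities of f'' and
  -- f into densities with r'.
  set g : ℂ → ℂ := fun ζ => (q + ζ) * f'' ζ + (p - ζ) * f ζ - (V - 1) * f' ζ with hg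
  have j1 : Integrable (fun t => W t * f'' (z t) * r'' (z t) * (q - z t)) μ :=
    h.integrable_mul (g := fun σ => q - σ) hf''.1 (by fun_prop)
  have j2 : Integrable (fun t => W t * f (z t) * r (z t) * (p + z t)) μ :=
    h.integrable_mul (g := fun σ => p + σ) hf.1 (by fun_prop)
  have j3 := hf'.1.const_mul (V - 1)
  have eg : ∀ t, W t * g (z t) * r' (z t) = W t * f'' (z t) * r'' (z t) * (q - z t)
      + W t * f (z t) * r (z t) * (p + z t) - (V - 1) * (W t * f' (z t) * r' (z t)) := by
    intro t
    have a1 := hr' _ (h.mem t)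
    have a2 := hr'' _ (h.mem t)
    simp only [hg]
    linear_combination W t * f (z t) * a1 - W t * f'' (z t) * a2
  have sol : SolvesCauchyEq μ z W D r' g := by
    constructor
    · simp_rw [eg]
      exact (j1.add j2).sub j3
    · intro ζ hζ
      have e : ∀ t, W t * g (z t) * r' (z t) / (z t + ζ)
          = W t * f'' (z t) * r'' (z t) * (q - z t) / (z t + ζ)
            + W t * f (z t) * r (z t) * (p + z t) / (z t + ζ)
            - (V - 1) * (W t * f' (z t) * r' (z t) / (z t + ζ)) := by
        intro t; rw [eg]; ring
      simp_rw [e]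
      have j12 : Integrable (fun t => W t * f'' (z t) * r'' (z t) * (q - z t) / (z t + ζ)
          + W t * f (z t) * r (z t) * (p + z t) / (z t + ζ)) μ :=
        (h.integrable_div j1 hζ).add (h.integrable_div j2 hζ)
      rw [integral_sub j12 ((h.integrable_div hf'.1 hζ).const_mul _),
        integral_add (h.integrable_div j1 hζ) (h.integrable_div j2 hζ), integral_const_mul]
      have b1 := h.add_mul_integral hf''.1 hζ q
      have b2 := h.sub_mul_integral hf.1 hζ p
      simp only [hg]
      rw [hf.2 ζ hζ, hf'.2 ζ hζ, hf''.2 ζ hζ]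
      linear_combination b1 + b2 - hV
  have := huniq g sol ζ hζ
  simp only [hg] at this
  linear_combination this

/-- Insert the integral equations for f and (p+ζ)f'. The product terms form an antisymmetrised
double integral, which the partial-fraction lemma reduces to iterated integrals with inner Cauchy
integrals evaluated at the sources; there the equations themselves replace them. Only 2ζ remains. -/
theorem SolvesCauchyEq.wronskian [SFinite μ] (h : CauchySources z S D) {p : ℂ}
    (hr' : ∀ σ ∈ S, (p - σ) * r' σ = (p + σ) * r σ)
    (hf : SolvesCauchyEq μ z W D r f) (hf' : SolvesCauchyEq μ z W D r' f')
    {ζ : ℂ} (h1 : ζ ∈ D) (h2 : -ζ ∈ D) :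
    (p + ζ) * f' ζ * f (-ζ) - (p - ζ) * f ζ * f' (-ζ) = 2 * ζ := by
  set b : T → ℂ := fun t => W t * f (z t) * r (z t) with hb
  set a : T → ℂ := fun t => W t * f' (z t) * r' (z t) * (p - z t) with ha
  have ib : Integrable b μ := hf.1
  have ia : Integrable a μ := h.integrable_mul (g := fun σ => p - σ) hf'.1 (by fun_prop)
  set x := ∫ t, W t * f' (z t) * r' (z t) ∂μ with hx
  have eb : ∀ ξ ∈ D, f ξ = 1 + ∫ t, b t / (z t + ξ) ∂μ := hf.2
  have ea : ∀ ξ ∈ D, (p + ξ) * f' ξ = p + ξ + x + ∫ t, a t / (z t + ξ) ∂μ := by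
    intro ξ hξ
    rw [hf'.2 ξ hξ, mul_add, h.add_mul_integral hf'.1 hξ p, mul_one, ← add_assoc]
  have dbl := h.integral_mul_integral_sub ia ib h1 h2
  have ip : Integrable (fun t => b t * (p + z t)) μ :=
    h.integrable_mul (g := fun σ => p + σ) ib (by fun_prop)
  -- the difference of the two iterated integrals is a single integral
  have cn : ∀ ξ ∈ D, ContinuousOn (fun σ => 1 / (σ + ξ)) S := fun ξ hξ =>
    ContinuousOn.div (by fun_prop) (by fun_prop) fun σ hσ => h.add_ne_zero hσ hξ
  have cC : ∀ c : T → ℂ, Integrable c μ →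
      ContinuousOn (fun σ => ∫ t', c t' / (z t' + σ) ∂μ) S := fun c hc σ hσ =>
    (h.differentiableAt hc (h.subset hσ)).continuousAt.continuousWithinAt
  have k1 : Integrable (fun t => a t * ((1 / (z t + ζ) - 1 / (z t + -ζ))
      * ∫ t', b t' / (z t' + z t) ∂μ)) μ :=
    h.integrable_mul ia (((cn ζ h1).sub (cn _ h2)).mul (cC b ib))
  have k2 : Integrable (fun t => b t * ((1 / (z t + ζ) - 1 / (z t + -ζ))
      * ∫ t', a t' / (z t' + z t) ∂μ)) μ :=
    h.integrable_mul ib (((cn ζ h1).sub (cn _ h2)).mul (cC a ia))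
  have single : (∫ t, a t * ((1 / (z t + ζ) - 1 / (z t + -ζ)) * ∫ t', b t' / (z t' + z t) ∂μ) ∂μ)
      - ∫ t, b t * ((1 / (z t + ζ) - 1 / (z t + -ζ)) * ∫ t', a t' / (z t' + z t) ∂μ) ∂μ
      = (((∫ t, b t * (p + z t) / (z t + ζ) ∂μ) + x * ∫ t, b t / (z t + ζ) ∂μ)
          - ∫ t, a t / (z t + ζ) ∂μ)
        - (((∫ t, b t * (p + z t) / (z t + -ζ) ∂μ) + x * ∫ t, b t / (z t + -ζ) ∂μ)
          - ∫ t, a t / (z t + -ζ) ∂μ) := by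
    have J : ∀ ξ ∈ D, ((∫ t, b t * (p + z t) / (z t + ξ) ∂μ) + x * ∫ t, b t / (z t + ξ) ∂μ)
          - (∫ t, a t / (z t + ξ) ∂μ)
        = ∫ t, (b t * (p + z t + x) - a t) / (z t + ξ) ∂μ := by
      intro ξ hξ
      have J12 : Integrable (fun t => b t * (p + z t) / (z t + ξ) + x * (b t / (z t + ξ))) μ :=
        (h.integrable_div ip hξ).add ((h.integrable_div ib hξ).const_mul x)
      rw [← integral_const_mul, ← integral_add (h.integrable_div ip hξ)
        ((h.integrable_div ib hξ).const_mul x), ← integral_sub J12 (h.integrable_div ia hξ)]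
      refine integral_congr_ae (Eventually.of_forall fun t => ?_)
      simp only
      ring
    have ic : Integrable (fun t => b t * (p + z t + x) - a t) μ :=
      (h.integrable_mul (g := fun σ => p + σ + x) ib (by fun_prop)).sub ia
    rw [J ζ h1, J (-ζ) h2, ← integral_sub k1 k2,
      ← integral_sub (h.integrable_div ic h1) (h.integrable_div ic h2)]
    refine integral_congr_ae (Eventually.of_forall fun t => ?_)
    have B := eb _ (h.subset (h.mem t))
    have A := ea _ (h.subset (h.mem t))
    have R := hr' _ (h.mem t)
    -- The plane-wave shift makes the products symmetric: the unknown values of f and f' at the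
    -- source cancel, leaving a∫b − b∫a as a single density.
    have AB : a t * f (z t) = b t * ((p + z t) * f' (z t)) := by
      simp only [ha, hb]
      linear_combination W t * f' (z t) * f (z t) * R
    simp only
    linear_combination (1 / (z t + ζ) - 1 / (z t + -ζ)) * (AB - a t * B + b t * A)
  rw [single] at dbl
  have s1 := h.sub_mul_integral ib h1 p
  have s2 := h.sub_mul_integral ib h2 p
  have ea1 := ea ζ h1
  have ea2 := ea (-ζ) h2
  rw [show p - ζ = p + -ζ by ring, ea1,
    show (p + -ζ) * f ζ * f' (-ζ) = (p + -ζ) * f' (-ζ) * f ζ by ring, ea2, eb ζ h1, eb (-ζ) h2]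
  linear_combination dbl - s1 + s2

end Cauchy

/-! ## The Schwarzian KdV equation -/

/-- The value and the second derivative at ζ = 0 of the linear relation; eliminating V between them
produces the increments of 𝒯. -/
theorem linear_expansion_at_zero {X Y Z : ℂ → ℂ} {a b V : ℂ} (hX : AnalyticAt ℂ X 0)
    (hY : AnalyticAt ℂ Y 0) (hZ : AnalyticAt ℂ Z 0)
    (h : ∀ᶠ ζ in 𝓝 0, (b + ζ) * X ζ - V * Y ζ + (a - ζ) * Z ζ = 0) :
    b * X 0 - V * Y 0 + a * Z 0 = 0 ∧
    b * deriv (deriv X) 0 + 2 * deriv X 0 - V * deriv (deriv Y) 0 + a * deriv (deriv Z) 0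
      - 2 * deriv Z 0 = 0 := by
  have d1 : ∀ᶠ ζ in 𝓝 (0 : ℂ), X ζ + (b + ζ) * deriv X ζ - V * deriv Y ζ
      + (-Z ζ + (a - ζ) * deriv Z ζ) = 0 := by
    filter_upwards [h.eventually_nhds, hX.eventually_analyticAt, hY.eventually_analyticAt,
      hZ.eventually_analyticAt] with ζ h1 x y z
    have e : HasDerivAt (fun ζ => (b + ζ) * X ζ - V * Y ζ + (a - ζ) * Z ζ)
        (1 * X ζ + (b + ζ) * deriv X ζ - V * deriv Y ζ + (-1 * Z ζ + (a - ζ) * deriv Z ζ)) ζ :=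
      ((((hasDerivAt_id ζ).const_add b).mul x.differentiableAt.hasDerivAt).sub
        (y.differentiableAt.hasDerivAt.const_mul V)).add
        (((hasDerivAt_id ζ).const_sub a).mul z.differentiableAt.hasDerivAt)
    have := e.unique ((hasDerivAt_const ζ (0 : ℂ)).congr_of_eventuallyEq h1)
    linear_combination this
  have dX := hX.differentiableAt.hasDerivAt
  have dZ := hZ.differentiableAt.hasDerivAt
  have dX' := hX.deriv.differentiableAt.hasDerivAt
  have dY' := hY.deriv.differentiableAt.hasDerivAt
  have dZ' := hZ.deriv.differentiableAt.hasDerivAt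
  have e : HasDerivAt (fun ζ => X ζ + (b + ζ) * deriv X ζ - V * deriv Y ζ
      + (-Z ζ + (a - ζ) * deriv Z ζ))
      (deriv X 0 + (1 * deriv X 0 + (b + 0) * deriv (deriv X) 0) - V * deriv (deriv Y) 0
        + (-deriv Z 0 + (-1 * deriv Z 0 + (a - 0) * deriv (deriv Z) 0))) 0 :=
    ((dX.add (((hasDerivAt_id (0 : ℂ)).const_add b).mul dX')).sub (dY'.const_mul V)).add
      (dZ.neg.add (((hasDerivAt_id (0 : ℂ)).const_sub a).mul dZ'))
  have e2 := e.unique ((hasDerivAt_const (0 : ℂ) (0 : ℂ)).congr_of_eventuallyEq d1)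
  have e0 := h.self_of_nhds
  exact ⟨by linear_combination e0, by linear_combination e2⟩

theorem wronskian_expansion_at_zero {Y Z : ℂ → ℂ} {a : ℂ} (hY : AnalyticAt ℂ Y 0)
    (hZ : AnalyticAt ℂ Z 0)
    (h : ∀ᶠ ζ in 𝓝 0, (a + ζ) * Y ζ * Z (-ζ) - (a - ζ) * Z ζ * Y (-ζ) = 2 * ζ) :
    Y 0 * Z 0 + a * (deriv Y 0 * Z 0 - Y 0 * deriv Z 0) = 1 := by
  have dY := hY.differentiableAt.hasDerivAt
  have dZ := hZ.differentiableAt.hasDerivAt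
  have nY : HasDerivAt (fun ζ => Y (-ζ)) (-deriv Y 0) 0 := by
    have := HasDerivAt.comp_of_eq (x := (0 : ℂ)) (y := 0) dY (hasDerivAt_neg (0 : ℂ)) (by simp)
    rwa [mul_neg_one] at this
  have nZ : HasDerivAt (fun ζ => Z (-ζ)) (-deriv Z 0) 0 := by
    have := HasDerivAt.comp_of_eq (x := (0 : ℂ)) (y := 0) dZ (hasDerivAt_neg (0 : ℂ)) (by simp)
    rwa [mul_neg_one] at this
  have e : HasDerivAt (fun ζ => (a + ζ) * Y ζ * Z (-ζ) - (a - ζ) * Z ζ * Y (-ζ))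
      ((1 * Y 0 + (a + 0) * deriv Y 0) * Z (-0) + (a + 0) * Y 0 * (-deriv Z 0)
        - ((-1 * Z 0 + (a - 0) * deriv Z 0) * Y (-0) + (a - 0) * Z 0 * (-deriv Y 0))) 0 :=
    ((((hasDerivAt_id (0 : ℂ)).const_add a).mul dY).mul nZ).sub
      ((((hasDerivAt_id (0 : ℂ)).const_sub a).mul dZ).mul nY)
  have e2 := e.unique (((hasDerivAt_id (0 : ℂ)).const_mul 2).congr_of_eventuallyEq h)
  rw [neg_zero] at e2
  linear_combination e2 / 2

theorem sum_div_step (p : Fin N → ℂ) (n : Fin N → ℤ) (k : Fin N) :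
    ∑ r, (step k n r : ℂ) / p r = (∑ r, (n r : ℂ) / p r) + 1 / p k := by
  have := sum_mul_step (fun r => (p r)⁻¹) n k
  simp only [div_eq_mul_inv, one_mul]
  simpa only [mul_comm] using this

/-- The linear relation at orders 0 and 2, with the Wronskian at order 1, gives 𝒯̃ − 𝒯 =
(1−Λ(0)Λ̃(0))/p. Adding μ leaves u−ũ = −BΛ(0)Λ̃(0)/p, and the four corner values cancel in the
cross-ratio. -/
theorem schwarzianConclusion_of_linear {p : Fin N → ℂ} (hp : ∀ r, p r ≠ 0)
    {Lam : (Fin N → ℤ) → ℂ → ℂ} {V : Fin N → Fin N → (Fin N → ℤ) → ℂ}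
    (han : ∀ n, AnalyticAt ℂ (Lam n) 0)
    (hlin : ∀ k l n, ∀ᶠ ζ in 𝓝 0, (p l + ζ) * Lam (step l (step k n)) ζ
      - V k l n * Lam (step k n) ζ + (p k - ζ) * Lam n ζ = 0)
    (hw : ∀ k n, ∀ᶠ ζ in 𝓝 0, (p k + ζ) * Lam (step k n) ζ * Lam n (-ζ)
      - (p k - ζ) * Lam n ζ * Lam (step k n) (-ζ) = 2 * ζ) : SchwarzianConclusion p Lam := by
  have hT : ∀ k l n, schwarzT p Lam l (step k n) - schwarzT p Lam k n
      = (1 - Lam n 0 * Lam (step k n) 0) / p k := by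
    intro k l n
    obtain ⟨e0, e2⟩ := linear_expansion_at_zero (han _) (han _) (han _) (hlin k l n)
    have e1 := wronskian_expansion_at_zero (han _) (han _) (hw k n)
    rw [eq_div_iff (hp k)]
    unfold schwarzT
    linear_combination (p k / 2) * (Lam (step k n) 0 * e2 - deriv (deriv (Lam (step k n))) 0 * e0)
      * (-1) + e1
  -- In `hT` the right-hand side does not involve the direction used to compute 𝒯 at the shifted
  -- point, so 𝒯 is independent of it.
  have hT' : ∀ k j n, schwarzT p Lam j n = schwarzT p Lam k n := by
    intro k j n
    have h1 := hT k k (back k n)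
    have h2 := hT k j (back k n)
    rw [step_back] at h1 h2
    linear_combination h2 - h1
  intro B μ₀ j u hu k l n
  have du : ∀ k n, u n - u (step k n) = -(B * (Lam n 0 * Lam (step k n) 0) / p k) := by
    intro k n
    have h1 := hT k j n
    rw [hT' j k n] at h1
    rw [hu, hu, sum_div_step]
    have := hp k
    linear_combination B * h1
  have d1 := du k n
  have d2 := du l n
  have d3 := du k (step l n)
  have d4 := du l (step k n)
  rw [← step_comm] at d3
  have pk := hp k
  have pl := hp l
  rw [d1, d2, d3, d4]
  refine ⟨by field_simp, fun hB hL => ?_⟩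
  have a1 := hL n
  have a2 := hL (step k n)
  have a3 := hL (step l n)
  have a4 := hL (step l (step k n))
  constructor
  · refine mul_ne_zero (neg_ne_zero.mpr ?_) (neg_ne_zero.mpr ?_) <;>
    exact div_ne_zero (mul_ne_zero hB (mul_ne_zero ‹_› ‹_›)) pl
  · field_simp

/-! ## The exterior of the contour -/

section Contour

variable {γ : ℝ → ℂ}

theorem IsPositiveJordan.continuous (h : IsPositiveJordan γ) : Continuous γ := by
  obtain ⟨C, hC⟩ := h.1
  exact hC.continuous

theorem IsPositiveJordan.isCompact_range (h : IsPositiveJordan γ) : IsCompact (Set.range γ) :=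
  h.2.1.compact_of_continuous one_ne_zero h.continuous

theorem IsPositiveJordan.cauchySources (h : IsPositiveJordan γ)
    (hneg : ∀ w ∈ Set.range γ, -w ∉ Set.range γ) :
    CauchySources γ (Set.range γ) {ζ | -ζ ∉ Set.range γ} :=
  ⟨h.continuous.measurable, h.isCompact_range, fun t => ⟨t, rfl⟩, hneg, fun _ hζ => hζ⟩

theorem IsPositiveJordan.integrable_deriv (h : IsPositiveJordan γ) :
    Integrable (deriv γ) (volume.restrict (Set.Ioc (0 : ℝ) 1)) := by
  obtain ⟨C, hC⟩ := h.1
  exact (integrable_const (C : ℝ)).mono' (aestronglyMeasurable_deriv _ _)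
    (Eventually.of_forall fun t => norm_deriv_le_of_lipschitz hC)

theorem winding_eq (γ : ℝ → ℂ) (w : ℂ) : winding γ w = 1 / (2 * Real.pi * Complex.I)
    * ∫ t, deriv γ t / (γ t + -w) ∂(volume.restrict (Set.Ioc (0 : ℝ) 1)) := by
  unfold winding
  rw [intervalIntegral.integral_of_le zero_le_one]
  rfl

/-- Off the curve the winding number is 0 or 1, so modulus less than 1 forces 0. The winding number
is itself a Cauchy integral with density γ', whence openness of the exterior and its description
near infinity. -/
theorem IsPositiveJordan.winding_eq_zero (h : IsPositiveJordan γ) {w : ℂ}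
    (hw : w ∉ Set.range γ) (h1 : ‖winding γ w‖ < 1) : w ∈ exteriorOf γ := by
  rcases h.2.2.2 w hw with h2 | h2
  · exact h2
  · rw [h2.2, norm_one] at h1
    exact absurd h1 (lt_irrefl _)

theorem IsPositiveJordan.isOpen_exterior (h : IsPositiveJordan γ)
    (hneg : ∀ w ∈ Set.range γ, -w ∉ Set.range γ) : IsOpen {ζ | -ζ ∈ exteriorOf γ} := by
  rw [isOpen_iff_mem_nhds]
  intro ζ hζ
  have hc : ContinuousAt (fun ζ => ‖winding γ (-ζ)‖) ζ := by
    have h1 := ((h.cauchySources hneg).differentiableAt h.integrable_deriv hζ.1).continuousAt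
    simp_rw [winding_eq, neg_neg]
    exact (continuousAt_const.mul h1).norm
  have h0 : ‖winding γ (-ζ)‖ < 1 := by rw [hζ.2]; simp
  have ho : IsOpen {ζ | -ζ ∉ Set.range γ} :=
    h.isCompact_range.isClosed.isOpen_compl.preimage continuous_neg
  filter_upwards [hc.eventually (gt_mem_nhds h0), ho.mem_nhds hζ.1] with ξ a b
  exact h.winding_eq_zero b a

theorem IsPositiveJordan.eventually_exterior (h : IsPositiveJordan γ)
    (hneg : ∀ w ∈ Set.range γ, -w ∉ Set.range γ) :
    ∀ᶠ ζ in Bornology.cobounded ℂ, -ζ ∈ exteriorOf γ := by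
  have hD : ∀ᶠ ζ in Bornology.cobounded ℂ, -ζ ∉ Set.range γ := by
    have hb : Bornology.IsBounded (-Set.range γ) := h.isCompact_range.neg.isBounded
    filter_upwards [hb] with ζ hζ h1 using hζ h1
  have h1 := tendsto_inv₀_cobounded.mul
    ((h.cauchySources hneg).tendsto_mul_integral h.integrable_deriv hD)
  have h2 := (h1.const_mul (1 / (2 * Real.pi * Complex.I))).norm
  rw [zero_mul, mul_zero, norm_zero] at h2
  have hne : ∀ᶠ ζ in Bornology.cobounded ℂ, ζ ≠ 0 := by
    filter_upwards [Bornology.isBounded_singleton (x := (0 : ℂ))] with ζ hζ using hζ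
  filter_upwards [h2.eventually (gt_mem_nhds one_pos), hD, hne] with ζ a b hζ
  refine h.winding_eq_zero b ?_
  rwa [inv_mul_cancel_left₀ hζ, ← neg_neg ζ, ← winding_eq] at a

end Contour

/-! ## The singular integral equation -/

section Inverse

variable {K : ℝ} {p : Fin N → ℂ} {s : ℤ → Fin N} {υ : ℤ → ℂ} {c : ℂ → ℂ} {γ : ℝ → ℂ}

/-- The contour and the zeros of `A`, as sources of a Cauchy integral. -/
def spectralPoint (γ : ℝ → ℂ) (Z : Set ℂ) : ℝ ⊕ Z → ℂ := Sum.elim γ Subtype.val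

/-- The density of the singular integral equation. -/
noncomputable def spectralDensity (K : ℝ) (p : Fin N → ℂ) (s : ℤ → Fin N) (υ : ℤ → ℂ)
    (c : ℂ → ℂ) (γ : ℝ → ℂ) : ℝ ⊕ zerosA K p s υ → ℂ :=
  Sum.elim (fun t => 1 / (2 * Real.pi * Complex.I)
    * (specB p s υ (γ t) / specA p s υ (γ t) * deriv γ t)) fun z => -normC K p s υ c z

/-- Arc parameter on `(0, 1]` and counting measure on a set of points. -/
noncomputable def spectralMeasure (Z : Set ℂ) : Measure (ℝ ⊕ Z) :=
  (volume.restrict (Set.Ioc (0 : ℝ) 1)).map Sum.inl + Measure.count.map Sum.inr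

instance {Z : Set ℂ} [Finite Z] : IsFiniteMeasure (spectralMeasure Z) := by
  unfold spectralMeasure; infer_instance

theorem measurableEmbedding_inl {α β : Type*} [MeasurableSpace α] [MeasurableSpace β] :
    MeasurableEmbedding (Sum.inl : α → α ⊕ β) :=
  ⟨Sum.inl_injective, measurable_inl, fun _ hs => MeasurableSet.inl_image hs⟩

theorem measurableEmbedding_inr {α β : Type*} [MeasurableSpace α] [MeasurableSpace β] :
    MeasurableEmbedding (Sum.inr : β → α ⊕ β) :=
  ⟨Sum.inr_injective, measurable_inr, fun _ hs => MeasurableSet.inr_image hs⟩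

theorem integrable_spectralMeasure_iff {Z : Set ℂ} [Finite Z] {f : ℝ ⊕ Z → ℂ} :
    Integrable f (spectralMeasure Z) ↔ IntervalIntegrable (fun t => f (Sum.inl t)) volume 0 1 := by
  unfold spectralMeasure
  rw [integrable_add_measure, measurableEmbedding_inl.integrable_map_iff,
    measurableEmbedding_inr.integrable_map_iff, intervalIntegrable_iff_integrableOn_Ioc_of_le
    zero_le_one]
  exact and_iff_left (Integrable.of_finite)

theorem integral_spectralMeasure {Z : Set ℂ} [Fintype Z] {f : ℝ ⊕ Z → ℂ}
    (hf : Integrable f (spectralMeasure Z)) :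
    ∫ t, f t ∂spectralMeasure Z = (∫ t in (0 : ℝ)..1, f (Sum.inl t)) + ∑ z, f (Sum.inr z) := by
  unfold spectralMeasure at hf ⊢
  rw [integrable_add_measure] at hf
  rw [integral_add_measure hf.1 hf.2, measurableEmbedding_inl.integral_map,
    measurableEmbedding_inr.integral_map, integral_count,
    intervalIntegral.integral_of_le zero_le_one]

theorem IsContourFor.cauchySources (h : IsContourFor K p s υ γ) (hZ : (zerosA K p s υ).Finite) :
    CauchySources (spectralPoint γ (zerosA K p s υ)) (Set.range γ ∪ zerosA K p s υ)
      {ζ | -ζ ∈ exteriorOf γ} := by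
  obtain ⟨hJ, -, -, -, hint, hneg, -, -⟩ := h
  refine ⟨?_, hJ.isCompact_range.union hZ.isCompact, ?_, ?_, ?_⟩
  · exact hJ.continuous.measurable.sumElim measurable_subtype_coe
  · rintro (t | z)
    · exact Or.inl ⟨t, rfl⟩
    · exact Or.inr z.2
  · rintro w (hw | hw)
    · exact hneg w (Or.inl hw)
    · exact hneg w (Or.inr (hint hw))
  · rintro ζ hζ (hw | hw)
    · exact hζ.1 hw
    · have h1 := (hint hw).2
      rw [hζ.2] at h1
      exact zero_ne_one h1

/-- With arc parameter on the contour and counting measure on the zeros of A, the residue sum and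
the contour integral become one Cauchy integral. -/
theorem solvesIntegralEq_iff (h : IsContourFor K p s υ γ) (hZ : (zerosA K p s υ).Finite)
    (n : Fin N → ℤ) (f : ℂ → ℂ) :
    SolvesIntegralEq K p s υ c γ n f ↔
      SolvesCauchyEq (spectralMeasure (zerosA K p s υ)) (spectralPoint γ (zerosA K p s υ))
        (spectralDensity K p s υ c γ) {ζ | -ζ ∈ exteriorOf γ} (rho p n) f := by
  have : Fintype (zerosA K p s υ) := hZ.fintype
  have hπ : (1 / (2 * Real.pi * Complex.I) : ℂ) ≠ 0 := by
    simp [Real.pi_ne_zero]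
  have hi : IntervalIntegrable
      (fun t => specB p s υ (γ t) / specA p s υ (γ t) * f (γ t) * rho p n (γ t) * deriv γ t)
      volume 0 1 ↔ Integrable (fun t => spectralDensity K p s υ c γ t
        * f (spectralPoint γ (zerosA K p s υ) t) * rho p n (spectralPoint γ (zerosA K p s υ) t))
        (spectralMeasure (zerosA K p s υ)) := by
    rw [integrable_spectralMeasure_iff]
    simp only [spectralDensity, spectralPoint, Sum.elim_inl]
    constructor
    · intro hI
      convert hI.const_mul (1 / (2 * Real.pi * Complex.I)) using 2 with t
      ring
    · intro hI
      convert hI.const_mul (1 / (2 * Real.pi * Complex.I))⁻¹ using 2 with t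
      rw [mul_assoc (1 / (2 * Real.pi * Complex.I)), mul_assoc (1 / (2 * Real.pi * Complex.I)),
        inv_mul_cancel_left₀ hπ]
      ring
  unfold SolvesIntegralEq SolvesCauchyEq
  rw [hi]
  refine and_congr_right fun hI => forall₂_congr fun ζ hζ => ?_
  rw [integral_spectralMeasure ((h.cauchySources hZ).integrable_div hI hζ),
    ← finsum_set_coe_eq_finsum_mem (zerosA K p s υ), finsum_eq_sum_of_fintype,
    ← intervalIntegral.integral_const_mul]
  simp only [spectralDensity, spectralPoint, Sum.elim_inl, Sum.elim_inr]
  have e1 : ∀ t, 1 / (2 * Real.pi * Complex.I) * (specB p s υ (γ t) / specA p s υ (γ t)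
        * f (γ t) / (γ t + ζ) * rho p n (γ t) * deriv γ t)
      = 1 / (2 * Real.pi * Complex.I) * (specB p s υ (γ t) / specA p s υ (γ t) * deriv γ t)
        * f (γ t) * rho p n (γ t) / (γ t + ζ) := fun t => by ring
  have e2 : ∀ z : zerosA K p s υ, -normC K p s υ c z * f z * rho p n z / (z + ζ)
      = -(normC K p s υ c z * f z / (ζ + z) * rho p n z) := fun z => by
    rw [add_comm (z : ℂ) ζ]; ring
  simp_rw [e1, e2, Finset.sum_neg_distrib]
  constructor <;> intro h1 <;> rw [h1] <;> ring

theorem rho_step (p : Fin N → ℂ) (n : Fin N → ℤ) (k : Fin N) {σ : ℂ} (h1 : p k + σ ≠ 0)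
    (h2 : p k - σ ≠ 0) : (p k - σ) * rho p (step k n) σ = (p k + σ) * rho p n σ := by
  have e : rho p (step k n) σ = rho p n σ * ((p k + σ) / (p k - σ)) := by
    unfold rho step
    have : ∀ r, ((p r + σ) / (p r - σ)) ^ ((n + Pi.single k 1 : Fin N → ℤ) r)
        = ((p r + σ) / (p r - σ)) ^ n r * (if r = k then (p k + σ) / (p k - σ) else 1) := by
      intro r
      by_cases hr : r = k
      · subst hr
        simp [zpow_add₀ (div_ne_zero h1 h2)]
      · simp [hr]
    simp_rw [this, Finset.prod_mul_distrib]
    simp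
  rw [e]
  field_simp

theorem inverseScattering_conclusions (hp : ∀ r, p r ≠ 0) (hZ : (zerosA K p s υ).Finite)
    (hγ : IsContourFor K p s υ γ) {Lam : (Fin N → ℤ) → ℂ → ℂ}
    (hLam : IsInverseScatteringJost K p s υ c γ Lam) :
    (∀ ζ, -ζ ∈ exteriorOf γ ∨ ζ ∈ exteriorOf γ) ∧
    (∀ ζ, -ζ ∈ exteriorOf γ →
      SolvesClosedForm p ζ (fun n => Lam n ζ) ∧ MKdVConclusionFor p ζ (fun n => Lam n ζ)) ∧
    (∀ k l : Fin N, k ≠ l → p k + p l ≠ 0 → -p k ∈ exteriorOf γ → -p l ∈ exteriorOf γ →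
      TodaConclusion p k l (fun n => Lam n (p k)) (fun n => Lam n (p l))) ∧
    SchwarzianConclusion p Lam ∧
    (∃ x : (Fin N → ℤ) → ℂ,
      (∀ n, Tendsto (fun ζ => ζ * (Lam n ζ - 1)) (Bornology.cobounded ℂ) (𝓝 (x n))) ∧
      KdVConclusion p x) := by
  have cs := hγ.cauchySources hZ
  have : Finite (zerosA K p s υ) := hZ.to_subtype
  obtain ⟨hJ, -, -, h0, -, hneg, hpr, hpz⟩ := id hγ
  have hneg' : ∀ w ∈ Set.range γ, -w ∉ Set.range γ := fun w hw => (hneg w (Or.inl hw)).1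
  set D : Set ℂ := {ζ | -ζ ∈ exteriorOf γ} with hD
  set z := spectralPoint γ (zerosA K p s υ)
  set W := spectralDensity K p s υ c γ
  set μ := spectralMeasure (zerosA K p s υ)
  have hDo : IsOpen D := hJ.isOpen_exterior hneg'
  have hD0 : D ∈ 𝓝 (0 : ℂ) := hDo.mem_nhds (by rwa [hD, Set.mem_ofPred_eq, neg_zero])
  have hDi : ∀ᶠ ζ in Bornology.cobounded ℂ, ζ ∈ D := hJ.eventually_exterior hneg'
  have sol : ∀ n, SolvesCauchyEq μ z W D (rho p n) (Lam n) := fun n =>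
    (solvesIntegralEq_iff hγ hZ n _).mp (hLam n).1
  -- No ±p_r is a source, so the plane-wave factors are regular and nonzero at every source.
  have hρ : ∀ k n, ∀ σ ∈ Set.range γ ∪ zerosA K p s υ,
      (p k - σ) * rho p (step k n) σ = (p k + σ) * rho p n σ := by
    intro k n σ hσ
    refine rho_step p n k (fun e => ?_) (fun e => ?_)
    · have e' : σ = -p k := by linear_combination e
      rw [e'] at hσ
      exact hσ.elim (hpr k).2 (hpz k).2
    · have e' : σ = p k := by linear_combination -e
      rw [e'] at hσ
      exact hσ.elim (hpr k).1 (hpz k).1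
  let x : (Fin N → ℤ) → ℂ := fun n => ∫ t, W t * Lam n (z t) * rho p n (z t) ∂μ
  have lin : ∀ ζ ∈ D, ∀ k l n, (p l + ζ) * Lam (step l (step k n)) ζ
      - (p k + p l + x (step l (step k n)) - x n) * Lam (step k n) ζ
      + (p k - ζ) * Lam n ζ = 0 := fun ζ hζ k l n =>
    SolvesCauchyEq.linear cs (hρ k n) (hρ l _) (sol n) (sol _) (sol _)
      (fun g hg => (hLam _).2 g ((solvesIntegralEq_iff hγ hZ _ g).mpr hg)) hζ
  have pair := fun ζ hζ => linearPair_of_linear (L := fun n => Lam n ζ) (lin ζ hζ)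
  have an : ∀ n, AnalyticAt ℂ (Lam n) 0 := fun n => by
    have : DifferentiableOn ℂ (Lam n) D := by
      refine DifferentiableOn.congr (f := fun ζ => 1 + ∫ t, W t * Lam n (z t) * rho p n (z t)
        / (z t + ζ) ∂μ) (fun ζ hζ => ?_) (sol n).2
      exact ((cs.differentiableAt (sol n).1 hζ).const_add 1).differentiableWithinAt
    exact this.analyticAt hD0
  have hDn : ∀ᶠ ζ in 𝓝 (0 : ℂ), -ζ ∈ D := by
    have h1 : Tendsto (fun ζ : ℂ => -ζ) (𝓝 0) (𝓝 0) := by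
      simpa using (continuous_neg (G := ℂ)).tendsto 0
    exact h1.eventually hD0
  have hx : ∀ n, Tendsto (fun ζ => ζ * (Lam n ζ - 1)) (Bornology.cobounded ℂ) (𝓝 (x n)) := by
    intro n
    refine (cs.tendsto_mul_integral (sol n).1 hDi).congr' ?_
    filter_upwards [hDi] with ζ hζ
    rw [(sol n).2 ζ hζ, add_sub_cancel_left]
  refine ⟨fun ζ => ?_, fun ζ hζ => ⟨solvesClosedForm_of_linearPair fun k l => ⟨_, pair ζ hζ k l⟩,
    fun α hα hα0 => mKdVConclusion_of_linearPair (fun k l => ⟨_, pair ζ hζ k l⟩) hα hα0⟩,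
    fun k l hkl hpq hk hl => todaConclusion_of_linearPair hkl hpq (pair _ hk k l) (pair _ hl k l),
    schwarzianConclusion_of_linear hp an
      (V := fun k l n => p k + p l + x (step l (step k n)) - x n) (fun k l n => ?_) fun k n => ?_,
    x, hx, kdVConclusion_of_mul (mul_eq_of_expansion hx fun k l n =>
      hDi.mono fun ζ hζ => lin ζ hζ k l n)⟩
  -- If −ζ is on or inside the contour, its reflection ζ lies in the exterior.
  · by_cases hr : -ζ ∈ Set.range γ
    · right; simpa using hneg _ (Or.inl hr)
    · refine (hJ.2.2.2 _ hr).imp id fun h => ?_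
      simpa using hneg _ (Or.inr h)
  · filter_upwards [hD0] with ζ hζ using lin ζ hζ k l n
  · filter_upwards [hD0, hDn] with ζ h1 h2
    exact SolvesCauchyEq.wronskian cs (hρ k n) (sol n) (sol _) h1 h2

end Inverse

end LatticeIST

/-! ### Assembly of the three parts -/

theorem mainTheorem9 {N : ℕ} (p : Fin N → ℂ) :
    -- solutions of `Q3_δ`
    (∀ (P : Fin N → ℂ) (a b δ : ℂ) (u U : (Fin N → ℤ) → ℂ),
      (∀ k, P k ^ 2 = (p k ^ 2 - a ^ 2) * (p k ^ 2 - b ^ 2)) → (∀ k, P k ≠ 0) →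
      LatticeIST.IsQ3Solution p P δ u →
      LatticeIST.IsFactorisation p P a b δ u U → (∀ n, U n ≠ 0) →
      (∀ k l n, LatticeIST.linCoeff p P u U k l n = LatticeIST.linCoeff p P u U l k n) ∧
      (∀ (ζ : ℂ) (α : Fin N → ℂ) (φ : (Fin N → ℤ) → Fin 2 → ℂ) (Lam : (Fin N → ℤ) → ℂ),
        ζ ^ 2 ≠ b ^ 2 → (∀ r, α r ^ 2 = p r ^ 2 - ζ ^ 2) → (∀ r, α r ≠ 0) →
        LatticeIST.IsLaxSolution p P b δ u U ζ α φ →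
        (∀ n, φ n 0 = Lam n * LatticeIST.rhoHalf p α ζ n) →
        (∀ k l n, (p l + ζ) * Lam (LatticeIST.step l (LatticeIST.step k n)) + (p k - ζ) * Lam n
          = LatticeIST.linCoeff p P u U k l n * Lam (LatticeIST.step k n)) ∧
        LatticeIST.SolvesClosedForm p ζ Lam ∧
        LatticeIST.MKdVConclusion p α (fun n => φ n 0)) ∧
      (∀ (k l : Fin N) (Ψ Ω : (Fin N → ℤ) → Fin 2 → ℂ),
        k ≠ l → p k ≠ 0 → p l ≠ 0 → p k + p l ≠ 0 →
        LatticeIST.IsReducedLaxSolution p P b δ u U (p k) Ψ →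
        LatticeIST.IsReducedLaxSolution p P b δ u U (p l) Ω →
        LatticeIST.TodaConclusion p k l (fun n => Ψ n 0) (fun n => Ω n 0))) ∧
    -- the inverse scattering transform
    (∀ (K : ℝ) (s : ℤ → Fin N) (υ : ℤ → ℂ) (c : ℂ → ℂ) (γ : ℝ → ℂ)
      (Lam : (Fin N → ℤ) → ℂ → ℂ),
      (∀ r, p r ≠ 0) → 1 < K →
      LatticeIST.IsAdmissible K p s υ → LatticeIST.IsContourFor K p s υ γ →
      (∀ z ∈ LatticeIST.zerosA K p s υ, z ∈ LatticeIST.regionPstar K p s →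
        LatticeIST.IsProportionality p s υ z (c z)) →
      LatticeIST.IsInverseScatteringJost K p s υ c γ Lam →
      (∀ ζ, -ζ ∈ LatticeIST.exteriorOf γ ∨ ζ ∈ LatticeIST.exteriorOf γ) ∧
      (∀ ζ, -ζ ∈ LatticeIST.exteriorOf γ →
        LatticeIST.SolvesClosedForm p ζ (fun n => Lam n ζ) ∧
        LatticeIST.MKdVConclusionFor p ζ (fun n => Lam n ζ)) ∧
      (∀ k l : Fin N, k ≠ l → p k + p l ≠ 0 →
        -p k ∈ LatticeIST.exteriorOf γ → -p l ∈ LatticeIST.exteriorOf γ →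
        LatticeIST.TodaConclusion p k l (fun n => Lam n (p k)) (fun n => Lam n (p l))) ∧
      LatticeIST.SchwarzianConclusion p Lam ∧
      (∃ x : (Fin N → ℤ) → ℂ,
        (∀ n, Filter.Tendsto (fun ζ => ζ * (Lam n ζ - 1)) (Bornology.cobounded ℂ) (nhds (x n))) ∧
        LatticeIST.KdVConclusion p x)) ∧
    -- the summability conditions, down to `K = 1`
    (∀ (K : ℝ) (s : ℤ → Fin N) (υ : ℤ → ℂ),
      (∀ r, p r ≠ 0) → 1 ≤ K → LatticeIST.WeightedSummable K υ →
      LatticeIST.JostExists K p s υ ∧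
      ∀ (Lam : (Fin N → ℤ) → ℂ → ℂ) (x : (Fin N → ℤ) → ℂ),
        LatticeIST.IsLinearProblemJost K p s υ Lam →
        ¬ Bornology.IsBounded (LatticeIST.regionP K p s)ᶜ →
        (∀ n, Filter.Tendsto (fun ζ => ζ * (Lam n ζ - 1))
          (Bornology.cobounded ℂ ⊓ Filter.principal (LatticeIST.regionP K p s)ᶜ) (nhds (x n))) →
        (∀ ζ, ζ ∉ LatticeIST.regionP K p s →
          LatticeIST.SolvesClosedForm p ζ (fun n => Lam n ζ) ∧
          LatticeIST.MKdVConclusionFor p ζ (fun n => Lam n ζ)) ∧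
        (∀ k l : Fin N, k ≠ l → p k + p l ≠ 0 →
          p k ∉ LatticeIST.regionP K p s → p l ∉ LatticeIST.regionP K p s →
          LatticeIST.TodaConclusion p k l (fun n => Lam n (p k)) (fun n => Lam n (p l))) ∧
        LatticeIST.KdVConclusion p x) := by
  refine ⟨fun P a b δ u U hP hP0 hu hU hU0 => ⟨?_, ?_, ?_⟩, ?_, ?_⟩
  · exact LatticeIST.linCoeff_symm hP hP0 hu hU hU0
  · exact fun ζ α φ Lam hζ hα hα0 hφ hLam =>
      LatticeIST.q3_conclusions hP hP0 hu hU hU0 hζ hα hα0 hφ hLam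
  · exact fun k l Ψ Ω hkl hk hl hpq hΨ hΩ =>
      LatticeIST.q3_todaConclusion hP hP0 hu hU hU0 hkl hk hl hpq hΨ hΩ
  · exact fun K s υ c γ Lam hp _ hυ hγ _ hLam =>
      LatticeIST.inverseScattering_conclusions hp hυ.2.1 hγ hLam
  · exact fun K s υ hp hK hυ => ⟨LatticeIST.jostExists hK hp hυ, fun Lam x hL hb hx =>
      LatticeIST.linearProblem_conclusions hL hb hx⟩
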